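/- For $\delta\ge1$ let $[\delta]$ denote the function $\tau\mapsto\eta(\delta\tau)$ on the upper half plane $\mathfrak H$, where $\eta$ is the Dedekind eta function. For $(r,N)=(4,2),(3,3),(2,4)$ define $$\mathscr A_4=\frac{(2^6[2]^{24}+[1]^{24})^{1/4}}{[1]^2[2]^2},\quad \mathscr B_4=\frac{[1]^4}{[2]^2},\quad \mathscr C_4=2^{3/2}\frac{[2]^4}{[1]^2};$$ $$\mathscr A_3=\frac{(3^3[3]^{12}+[1]^{12})^{1/3}}{[1][3]},\quad \mathscr B_3=\frac{[1]^3}{[3]},\quad \mathscr C_3=3\,\frac{[3]^3}{[1]};$$ $$\mathscr A_2=\frac{(2^4[4]^{8}+[1]^{8})^{1/2}}{[2]^2},\quad \mathscr B_2=\frac{[1]^4}{[2]^2},\quad \mathscr C_2=2^2\,\frac{[4]^4}{[2]^2}.$$ Here each $\mathscr A_r$ is the potentially multivalued function on $\mathfrak H$ obtained by analytic continuation of the branch, near $\tau=\mathrm i\infty$, that tends to $1$ at $\mathrm i\infty$. A (single-valued) modular form of integral weight $k$ on $\Gamma_0(N)$ is a holomorphic function $f$ on $\mathfrak H$ with $f(\frac{a\tau+b}{c\tau+d})=\chi(\gamma)(c\tau+d)^kf(\tau)$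 for all $\gamma=\left(\begin{smallmatrix}a&b\\c&d\end{smallmatrix}\right)\in\Gamma_0(N)$, for some multiplier system $\chi:\Gamma_0(N)\to\mathbf C^\times$ (a homomorphism), which is also holomorphic at all cusps. A multivalued form of weight $k$ is one of which the $m$-th power, for some $m\ge1$, is a single-valued form of weight $mk$. Orders of vanishing on $\mathfrak H^*=\mathfrak H\cup\mathbf Q\cup\{\mathrm i\infty\}$ are computed with respect to a local parameter for $\Gamma_0(N)$: at $s\in\mathfrak H$ the order is the usual one divided by the ramification index of $s$ (half the order of its stabilizer in $\Gamma_0(N)$), and at a cusp $s=g(\mathrm i\infty)$, $g\in SL(2,\mathbf Z)$, of width $h$ it is $h$ times the leading exponent of $q=e^{2\pi\mathrm i\tau}$ in $f|_kg$; for a multivalued form the order is $1/m$ times that of its $m$-th power. Then: 1. For each $(r,N)$, $\mathscr A_r,\mathscr B_r,\mathscr C_r$ are weight-$1$ modular forms on $\Gamma_0(N)$, and each is single-valued except for $\mathscr A_4$, which is not single-valued but the square of which is. 2. Each of them has exactly one $\Gamma_0(N)$-equivalence class of zeros on $\mathfrak H^*$, at which its order of vanishing is $1/r$, its order at all other points being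 $0$. For $\mathscr B_r$ this is the class of the cusp $0$, and for $\mathscr C_r$ that of the cusp $\mathrm i\infty$. For $\mathscr A_4$ it is the class of the quadratic elliptic point $\frac{1+\mathrm i}2$ of $\Gamma_0(2)$, for $\mathscr A_3$ that of the cubic elliptic point $\frac12+\frac{\mathrm i\sqrt3}6$ of $\Gamma_0(3)$, and for $\mathscr A_2$ that of the cusp $\frac12$ of $\Gamma_0(4)$. 3. Under the Fricke involution $W_N:\tau\mapsto-1/(N\tau)$, acting in weight $2$ by $(f|W_N)(\tau)=N^{-1}\tau^{-2}f(-1/(N\tau))$, one has $\mathscr B_r^2|W_N=-\mathscr C_r^2$, $\mathscr C_r^2|W_N=-\mathscr B_r^2$ and $\mathscr A_r^2|W_N=-\mathscr A_r^2$. 4. $\mathscr A_2=[2]^{10}/([1]^4[4]^4)$. -/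

import Mathlib

open UpperHalfPlane hiding I
open Complex Filter Topology
open scoped MatrixGroups ModularForm Manifold

noncomputable section

namespace EtaForms

/-! ### Modular forms with multiplier system -/

/-- A (single-valued) modular form of integral weight `k` on `Γ ≤ SL(2, ℤ)` with some multiplier
system `χ : Γ → ℂˣ`: holomorphic on the upper half plane, `f(γτ) = χ(γ) (cτ + d) ^ k f(τ)` for
`γ ∈ Γ`, and holomorphic (i.e. bounded) at every cusp `g∞`, `g ∈ SL(2, ℤ)`. -/
structure IsModularForm (Γ : Subgroup SL(2, ℤ)) (k : ℤ) (f : ℍ → ℂ) : Prop where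
  holo : MDifferentiable 𝓘(ℂ) 𝓘(ℂ) f
  slash_eq : ∃ χ : Γ →* ℂˣ, ∀ γ : Γ, f ∣[k] (γ : SL(2, ℤ)) = ((χ γ : ℂˣ) : ℂ) • f
  bdd_at_cusps : ∀ g : SL(2, ℤ), IsBoundedAtImInfty (f ∣[k] g)

/-! ### Points of `ℍ* = ℍ ∪ ℙ¹(ℚ)` and orders of vanishing -/

/-- The extended upper half plane `ℍ* = ℍ ∪ ℚ ∪ {i∞}`. -/
inductive HStar where
  | pt (τ : ℍ)
  | cusp (c : OnePoint ℚ)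

/-- The action of `SL(2, ℤ)` on `ℍ*` by fractional linear transformations. -/
def HStar.act (g : SL(2, ℤ)) : HStar → HStar
  | .pt τ => .pt (g • τ)
  | .cusp c => .cusp (Matrix.SpecialLinearGroup.mapGL ℚ g • c)

/-- `Γ`-equivalence of points of `ℍ*`. -/
def HStar.Equivalent (Γ : Subgroup SL(2, ℤ)) (s t : HStar) : Prop :=
  ∃ γ ∈ Γ, HStar.act γ s = t

/-- The ramification index at `τ ∈ ℍ` of `ℍ → Γ \ ℍ`, for `Γ` containing `-1`: half the order of
the stabilizer; it is `1` unless `τ` is an elliptic fixed point (quadratic: `2`, cubic: `3`). -/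
def ramification (Γ : Subgroup SL(2, ℤ)) (τ : ℍ) : ℚ :=
  (Nat.card (MulAction.stabilizer Γ τ) : ℚ) / 2

/-- The width of the cusp `g∞` of `Γ`, for `Γ` containing `-1`: the least `h ≥ 1` such that
`g T ^ h g⁻¹ ∈ Γ`, where `T` is the translation `τ ↦ τ + 1`. -/
def cuspWidth (Γ : Subgroup SL(2, ℤ)) (g : SL(2, ℤ)) : ℕ :=
  sInf {h : ℕ | 0 < h ∧ g * ModularGroup.T ^ h * g⁻¹ ∈ Γ}

/-- `HasOrd Γ k f s α`: the function `f`, of weight `k`, has order of vanishing `α` at `s ∈ ℍ*`,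
computed with respect to a local parameter for `Γ`.

* At `τ ∈ ℍ` the usual order of vanishing of `f` is `α` times the ramification index.
* At a cusp `g∞` of width `h`, the leading term of `f ∣[k] g` at `i∞` is a nonzero multiple of
  `q ^ (α / h)`, where `q ^ x = exp (2 π i x τ)`. -/
def HasOrd (Γ : Subgroup SL(2, ℤ)) (k : ℤ) (f : ℍ → ℂ) : HStar → ℚ → Prop
  | .pt τ, α => ∃ n : ℕ, analyticOrderAt (f ∘ ofComplex) (τ : ℂ) = n ∧
      (n : ℚ) = ramification Γ τ * α
  | .cusp c, α => ∀ g : SL(2, ℤ),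
      Matrix.SpecialLinearGroup.mapGL ℚ g • (OnePoint.infty : OnePoint ℚ) = c →
      ∃ L : ℂ, L ≠ 0 ∧ Tendsto
        (fun τ : ℍ => (f ∣[k] g) τ *
          exp (-(2 * Real.pi * I * ((α / cuspWidth Γ g : ℚ) : ℂ) * (τ : ℂ))))
        atImInfty (𝓝 L)

/-! ### Potentially multivalued functions

A potentially multivalued function on `ℍ` is given by a function `F` near `i∞` (its values for
small `Im τ` are irrelevant), to be continued analytically to all of `ℍ`. -/

/-- `F` continues analytically from a neighbourhood of `i∞` to the single-valued holomorphic
function `f` on the whole upper half plane. -/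
def Continues (F f : ℍ → ℂ) : Prop :=
  MDifferentiable 𝓘(ℂ) 𝓘(ℂ) f ∧ F =ᶠ[atImInfty] f

/-- The potentially multivalued function given near `i∞` by `F` is in fact single-valued. -/
def IsSingleValued (F : ℍ → ℂ) : Prop := ∃ f : ℍ → ℂ, Continues F f

/-- The `m`-th power of the potentially multivalued function given near `i∞` by `F` is a
single-valued modular form of weight `m * k`, so that `F` is a form of weight `k` on `Γ`, which
is multivalued in the sense of being an `m`-th root of a conventional one. For `m = 1`, `F` is
itself single-valued. -/
def IsRootForm (Γ : Subgroup SL(2, ℤ)) (k : ℤ) (m : ℕ) (F : ℍ → ℂ) : Prop :=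
  ∃ f : ℍ → ℂ, Continues (F ^ m) f ∧ IsModularForm Γ (m * k) f

/-- The order of vanishing of a potentially multivalued form of weight `k`: it is `α` if that of
some single-valued `m`-th power, `m ≥ 1`, is `m * α`. -/
def HasRootOrd (Γ : Subgroup SL(2, ℤ)) (k : ℤ) (F : ℍ → ℂ) (s : HStar) (α : ℚ) : Prop :=
  ∃ m : ℕ, 0 < m ∧ ∃ f : ℍ → ℂ, Continues (F ^ m) f ∧ HasOrd Γ (m * k) f s (m * α)

/-! ### The eta quotients -/

/-- `etaMul δ` is the function `[δ] : τ ↦ η(δτ)`. -/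
def etaMul (δ : ℕ) (τ : ℍ) : ℂ := ModularForm.eta (δ * (τ : ℂ))

/-- `𝒜₄ = (2⁶ [2]²⁴ + [1]²⁴)^(1/4) / ([1]² [2]²)`, the branch that is `1` at `i∞`: the quantity
under the principal root below tends to `1` at `i∞`. Only the values near `i∞` matter. -/
def A4 (τ : ℍ) : ℂ :=
  ((2 ^ 6 * etaMul 2 τ ^ 24 + etaMul 1 τ ^ 24) / (etaMul 1 τ ^ 2 * etaMul 2 τ ^ 2) ^ 4) ^
    (1 / 4 : ℂ)

def B4 (τ : ℍ) : ℂ := etaMul 1 τ ^ 4 / etaMul 2 τ ^ 2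

def C4 (τ : ℍ) : ℂ := (2 : ℂ) ^ (3 / 2 : ℂ) * etaMul 2 τ ^ 4 / etaMul 1 τ ^ 2

/-- `𝒜₃ = (3³ [3]¹² + [1]¹²)^(1/3) / ([1] [3])`, the branch that is `1` at `i∞`.
Only the values near `i∞` matter. -/
def A3 (τ : ℍ) : ℂ :=
  ((3 ^ 3 * etaMul 3 τ ^ 12 + etaMul 1 τ ^ 12) / (etaMul 1 τ * etaMul 3 τ) ^ 3) ^ (1 / 3 : ℂ)

def B3 (τ : ℍ) : ℂ := etaMul 1 τ ^ 3 / etaMul 3 τ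

def C3 (τ : ℍ) : ℂ := 3 * etaMul 3 τ ^ 3 / etaMul 1 τ

/-- `𝒜₂ = (2⁴ [4]⁸ + [1]⁸)^(1/2) / [2]²`, the branch that is `1` at `i∞`.
Only the values near `i∞` matter. -/
def A2 (τ : ℍ) : ℂ :=
  ((2 ^ 4 * etaMul 4 τ ^ 8 + etaMul 1 τ ^ 8) / (etaMul 2 τ ^ 2) ^ 2) ^ (1 / 2 : ℂ)

def B2 (τ : ℍ) : ℂ := etaMul 1 τ ^ 4 / etaMul 2 τ ^ 2

def C2 (τ : ℍ) : ℂ := 2 ^ 2 * etaMul 4 τ ^ 4 / etaMul 2 τ ^ 2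

/-! ### Fixed points and Fricke involution -/

/-- The quadratic elliptic point `(1 + i) / 2` of `Γ₀(2)`. -/
def ellipticTwo : ℍ := ⟨⟨1 / 2, 1 / 2⟩, by norm_num⟩

/-- The cubic elliptic point `1 / 2 + i √3 / 6` of `Γ₀(3)`. -/
def ellipticThree : ℍ := ⟨⟨1 / 2, √3 / 6⟩, by
  show (0 : ℝ) < √3 / 6
  positivity⟩

/-- The matrix of the Fricke involution `W_N : τ ↦ -1 / (N τ)`. In weight `2`, the slash action
`f ∣[2] fricke N` is `N⁻¹ τ⁻² f(-1 / (N τ))`. -/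
def fricke (N : ℕ) [NeZero N] : GL (Fin 2) ℝ :=
  Matrix.GeneralLinearGroup.mkOfDetNeZero !![0, -1; (N : ℝ), 0]
    (by simp [Matrix.det_fin_two, NeZero.ne N])

end EtaForms

end

/-!
For `N = 2, 3, 4` the group `Γ₀(N)` is generated by `-1`, by `τ ↦ τ + 1` and by the conjugate of the
latter under the Fricke involution (`Gamma0_le_of_generators_mem`). Hence a function is modular up to
a multiplier system as soon as it and its Fricke transform are multiplied by constants under
translation (`semiInvariant_of_mem_Gamma0`). Its behaviour at the cusps `i∞` and `0` is read off the
leading terms of the function and of its Fricke transform at `i∞`. For `N = 4` there is the third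
cusp `1 / 2`, which is reached by the Fricke conjugate of `τ ↦ τ - 1 / 2`.

The forms `ℬ` and `𝒞` have no zeros on the upper half plane, and the transformation of `η` under
`τ ↦ -1 / τ` shows that the Fricke involution interchanges them (`FrickePair`). Their
exponents of `q` at `i∞` are `0` and `1 / r`, so that their orders at the cusp `0` are `1 / r` and `0`.

For `𝒜`, whose `r`-th power is `ℬ ^ r + 𝒞 ^ r`, a holomorphic representative is needed. In levels
two and three it comes from the Eisenstein series `E = (N E₂(N τ) - E₂(τ)) / (N - 1)` (`eisTwo`).

* In level two `E² = ℬ⁴ + 𝒞⁴` (`eisTwo_two_sq`), so that `𝒜₄² = E`.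
* In level three `E³ = (ℬ³ + 𝒞³)²` (`eisTwo_three_cube`), so that `(ℬ³ + 𝒞³) / E` is holomorphic, with
  square `E` and cube `ℬ³ + 𝒞³`; this is `𝒜₃` (`cubicA`).
* In level four the eta quotient `[2]¹⁰ / ([1]⁴ [4]⁴)` is `ℬ₂` with `q` replaced by `-q`
  (`etaQuot_eq`), and its square is `ℬ² + 𝒞²` (`etaQuot_sq`). It has no zeros on the upper half plane
  and vanishes at the cusp `1 / 2` only.

In each of these identities the difference of both sides, divided by a form without zeros, is a
modular function without poles that vanishes at `i∞`, hence zero (`eq_zero_of_fricke`).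

The zeros of `E` are located directly. At the root `τ₀` of `N τ² - N τ + 1 = 0`, the elliptic
point, the Fricke involution acts like a translation, while `E` is multiplied by `-N τ₀² ≠ 1` under
the former and by `1` under the latter; so `E(τ₀) = 0` (`eisTwo_eq_zero_of_root`). Every point can be
moved by `Γ₀(N)` and the Fricke involution to one with `Im τ ≥ √3 / (2 N)` (`exists_reduced`), that
is, into a disc `‖q‖ < 1 / 14` or `‖q‖ < 1 / 6`. For `N = 2` the linear term `24 q` dominates there,
and `E` has a single simple zero in terms of `q` (`norm_eisSeries_two_sub_le`). For `N = 3` the linear Taylor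
coefficient at the zero vanishes, as `E` is a square, and the quadratic term `36 q²` dominates
(`norm_eisSeries_three_sub_taylor_le`), whence `𝒜₃` has a single simple zero. The stabilizers of the
elliptic points have orders `4` and `6`, which turns a simple zero of `𝒜₄²` and of `𝒜₃` into the orders
`1 / 2` and `1 / 3`. Finally `𝒜₄` is not single-valued, as `E` has a zero of odd order.
-/

noncomputable section

namespace EtaForms

open CongruenceSubgroup ModularGroup

/-! ### Generators and cosets of `Γ₀(N)` -/

/-- The lower triangular matrix with lower left entry `n`. -/
def lowerTri (n : ℤ) : SL(2, ℤ) := ⟨!![1, 0; n, 1], by simp [Matrix.det_fin_two]⟩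

lemma coe_lowerTri (n : ℤ) :
    (lowerTri n : Matrix (Fin 2) (Fin 2) ℤ) = !![1, 0; n, 1] := rfl

lemma lowerTri_zpow (n m : ℤ) : lowerTri n ^ m = lowerTri (n * m) := by
  have hadd : ∀ a b : ℤ, lowerTri (a + b) = lowerTri a * lowerTri b := fun a b ↦ by
    ext i j
    rw [Matrix.SpecialLinearGroup.coe_mul]
    fin_cases i <;> fin_cases j <;> simp [coe_lowerTri, Matrix.mul_apply, Fin.sum_univ_two]
  have hzero : lowerTri 0 = 1 := by
    ext i j
    fin_cases i <;> fin_cases j <;> simp [lowerTri]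
  induction m with
  | zero => simp [hzero]
  | succ i hi => rw [zpow_add_one, hi, mul_add, mul_one, hadd]
  | pred i hi =>
    rw [zpow_sub_one, hi, mul_inv_eq_iff_eq_mul, ← hadd]
    congr 1
    ring

lemma mem_Gamma0_iff_dvd {N : ℕ} {g : SL(2, ℤ)} : g ∈ Gamma0 N ↔ (N : ℤ) ∣ g 1 0 := by
  rw [Gamma0_mem, ZMod.intCast_zmod_eq_zero_iff_dvd]

/-- Division with remainder of least absolute value. -/
lemma exists_two_mul_abs_add_mul_le (d : ℤ) {c : ℤ} (hc : c ≠ 0) :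
    ∃ n : ℤ, 2 * |d + n * c| ≤ |c| := by
  have h1 := Int.emod_nonneg d hc
  have h2 := Int.emod_lt_abs d hc
  have h3 := Int.emod_add_mul_ediv d c
  rcases le_total (2 * (d % c)) |c| with h | h
  · refine ⟨-(d / c), ?_⟩
    rw [show d + -(d / c) * c = d % c by linarith, abs_of_nonneg h1]
    exact h
  · refine ⟨-(d / c) - c.sign, ?_⟩
    have h4 : c.sign * c = |c| := Int.sign_mul_self_eq_abs c
    rw [show d + (-(d / c) - c.sign) * c = d % c - |c| by linarith, abs_of_nonpos (by linarith)]
    linarith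

lemma eq_T_zpow_or_eq_neg_of_lower_left_eq_zero {g : SL(2, ℤ)} (hg : g 1 0 = 0) :
    g = T ^ (g 0 1) ∨ g = -T ^ (-(g 0 1)) := by
  have hdet := g.det_coe
  rw [Matrix.det_fin_two, hg, mul_zero, sub_zero] at hdet
  rcases Int.mul_eq_one_iff_eq_one_or_neg_one.mp hdet with ⟨ha, hd⟩ | ⟨ha, hd⟩
  · left
    ext i j
    fin_cases i <;> fin_cases j <;> simp [coe_T_zpow, ha, hd, hg]
  · right
    ext i j
    fin_cases i <;> fin_cases j <;> simp [-zpow_neg, coe_T_zpow, ha, hd, hg]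

/-- For `2 ≤ N ≤ 4` the group `Γ₀(N)` is generated by `-1`, by `τ ↦ τ + 1` and by its conjugate
under the Fricke involution. The Euclidean algorithm on the lower row `(c, d)`, with steps
`d ↦ d + n c` and `c ↦ c + m N d`, gets from `|c|` to at most `N |c| / 4`; equality for `N = 4` is
excluded as `c` and `d` are coprime. -/
theorem Gamma0_le_of_generators_mem {N : ℕ} (h2 : 2 ≤ N) (h4 : N ≤ 4) {H : Subgroup SL(2, ℤ)}
    (hneg : -1 ∈ H) (hT : T ∈ H) (hU : lowerTri N ∈ H) : Gamma0 N ≤ H := by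
  intro γ
  induction hn : (γ 1 0).natAbs using Nat.strong_induction_on generalizing γ with
  | _ n ih =>
  intro hγ
  rw [mem_Gamma0_iff_dvd] at hγ
  by_cases hc : γ 1 0 = 0
  · rcases eq_T_zpow_or_eq_neg_of_lower_left_eq_zero hc with h | h
    · rw [h]; exact H.zpow_mem hT _
    · rw [h, ← neg_one_mul]; exact H.mul_mem hneg (H.zpow_mem hT _)
  obtain ⟨n1, hn1⟩ := exists_two_mul_abs_add_mul_le (γ 1 1) hc
  set c := γ 1 0 with hcdef
  set d := γ 1 1 + n1 * c with hd
  have hcop : IsCoprime c d := by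
    refine ⟨-(γ 0 1 + n1 * γ 0 0), γ 0 0, ?_⟩
    have hdet := γ.det_coe
    rw [Matrix.det_fin_two] at hdet
    rw [hd]
    linear_combination hdet
  have hd0 : d ≠ 0 := by
    intro h0
    rw [h0, isCoprime_zero_right, Int.isUnit_iff] at hcop
    rcases hcop with h | h <;> rw [h] at hγ <;> obtain ⟨k, hk⟩ := hγ
    · have := Int.eq_one_or_neg_one_of_mul_eq_one hk.symm
      omega
    · have := Int.eq_one_or_neg_one_of_mul_eq_neg_one hk.symm
      omega
  have hN0 : (N : ℤ) * d ≠ 0 := mul_ne_zero (by omega) hd0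
  obtain ⟨m, hm⟩ := exists_two_mul_abs_add_mul_le c hN0
  have hent : (γ * T ^ n1 * lowerTri N ^ m) 1 0 = c + m * (N * d) := by
    rw [lowerTri_zpow, Matrix.SpecialLinearGroup.coe_mul, Matrix.SpecialLinearGroup.coe_mul,
      coe_T_zpow, coe_lowerTri]
    simp [Matrix.mul_apply, Fin.sum_univ_two, hd]
    ring
  have hmem : γ * T ^ n1 * lowerTri N ^ m ∈ H := by
    refine ih _ ?_ rfl ?_
    · rw [hent, ← hn]
      zify
      rw [abs_mul, Nat.abs_cast] at hm
      have hNle : (N : ℤ) * |d| ≤ 4 * |d| := by gcongr; exact_mod_cast h4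
      refine lt_of_le_of_ne (by linarith) fun heq ↦ ?_
      have hcd : |c| = 2 * |d| := by linarith
      have hd1 : IsUnit d := hcop.symm.isUnit_of_dvd' dvd_rfl
        ((abs_dvd_abs d c).mp ⟨2, by rw [hcd]; ring⟩)
      have hd2 : |d| = 1 := Int.isUnit_iff_abs_eq.mp hd1
      have hN4 : N = 4 := by
        rw [hd2] at hm hcd
        omega
      have hcc := (dvd_abs _ _).mpr hγ
      rw [hcd, hd2, hN4] at hcc
      norm_num at hcc
    · rw [mem_Gamma0_iff_dvd, hent]
      exact dvd_add hγ ⟨m * d, by ring⟩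
  rw [H.mul_mem_cancel_right (H.zpow_mem hU _), H.mul_mem_cancel_right (H.zpow_mem hT _)] at hmem
  exact hmem

/-- The cosets `Γ₀(N) g` with lower left entry of `g` prime to `N`, that is, those with `g ∞`
equivalent to the cusp `0`, are represented by `S T ^ j`. -/
lemma exists_eq_mul_S_mul_T_zpow {N : ℕ} {g : SL(2, ℤ)} (hg : IsCoprime (g 1 0) (N : ℤ)) :
    ∃ γ ∈ Gamma0 N, ∃ j : ℤ, g = γ * S * T ^ j := by
  obtain ⟨u, v, huv⟩ := hg
  refine ⟨g * T ^ (-(u * g 1 1)) * S⁻¹, ?_, u * g 1 1, by group⟩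
  rw [mem_Gamma0_iff_dvd]
  refine ⟨-(v * g 1 1), ?_⟩
  rw [Matrix.SpecialLinearGroup.coe_mul, Matrix.SpecialLinearGroup.coe_mul, coe_T_zpow,
    Matrix.SpecialLinearGroup.coe_inv, coe_S, Matrix.adjugate_fin_two]
  simp [Matrix.mul_apply, Fin.sum_univ_two]
  linear_combination (g 1 1) * huv

/-- The elements of `SL(2, ℤ)` with lower left entry `2` modulo `4`, that is, those mapping `∞` to a
cusp equivalent to `1 / 2`, form one coset of `Γ₀(4)`. -/
lemma exists_eq_mul_lowerTri_two {g : SL(2, ℤ)} (hg : g 1 0 % 4 = 2) :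
    ∃ γ ∈ Gamma0 4, g = γ * lowerTri 2 := by
  refine ⟨g * (lowerTri 2)⁻¹, ?_, by group⟩
  have hdet := g.det_coe
  rw [Matrix.det_fin_two] at hdet
  have hodd : (g 1 1) % 2 = 1 := by
    by_contra h
    obtain ⟨x, hx⟩ : ∃ x, g 1 1 = 2 * x := ⟨g 1 1 / 2, by omega⟩
    obtain ⟨y, hy⟩ : ∃ y, g 1 0 = 2 * y := ⟨g 1 0 / 2, by omega⟩
    rw [hx, hy] at hdet
    have : 2 * (g 0 0 * x - g 0 1 * y) = 1 := by linear_combination hdet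
    omega
  rw [mem_Gamma0_iff_dvd]
  rw [Matrix.SpecialLinearGroup.coe_mul, Matrix.SpecialLinearGroup.coe_inv,
    Matrix.adjugate_fin_two]
  simp [Matrix.mul_apply, Fin.sum_univ_two, coe_lowerTri]
  omega

lemma exists_eq_smul_infty (c : OnePoint ℚ) :
    ∃ g : SL(2, ℤ), Matrix.SpecialLinearGroup.mapGL ℚ g • (OnePoint.infty : OnePoint ℚ) = c :=
  OnePoint.exists_mem_SL2 ℤ c

/-- A cusp `g ∞` determines the lower left entry of `g`, the denominator of the cusp, up to sign. -/
lemma lower_left_eq_or_eq_neg_of_smul_infty_eq {g h : SL(2, ℤ)}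
    (hgh : Matrix.SpecialLinearGroup.mapGL ℚ g • (OnePoint.infty : OnePoint ℚ) =
      Matrix.SpecialLinearGroup.mapGL ℚ h • (OnePoint.infty : OnePoint ℚ)) :
    g 1 0 = h 1 0 ∨ g 1 0 = -h 1 0 := by
  have h1 : Matrix.SpecialLinearGroup.mapGL ℚ (h⁻¹ * g) • (OnePoint.infty : OnePoint ℚ) =
      OnePoint.infty := by
    rw [map_mul, mul_smul, hgh, ← mul_smul, ← map_mul]
    simp
  rw [OnePoint.smul_infty_eq_self_iff, Matrix.SpecialLinearGroup.mapGL_coe_matrix] at h1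
  have h2 : (h⁻¹ * g) 1 0 = 0 := by
    simpa [-Matrix.SpecialLinearGroup.coe_mul, -Matrix.SpecialLinearGroup.coe_inv,
      -map_mul, -map_inv] using h1
  have h3 : g = h * (h⁻¹ * g) := by group
  rcases eq_T_zpow_or_eq_neg_of_lower_left_eq_zero h2 with h4 | h4 <;> rw [h4] at h3
  · left
    rw [h3]
    simp [Matrix.mul_apply, Fin.sum_univ_two, coe_T_zpow]
  · right
    rw [h3]
    simp [-zpow_neg, Matrix.mul_apply, Fin.sum_univ_two, coe_T_zpow]

/-! ### Semi-invariance under `Γ₀(N)` from translations and the Fricke involution -/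

/-- `f ∣[k] g` is a nonzero multiple of `f`. -/
def SemiInvariant (k : ℤ) (f : ℍ → ℂ) (g : SL(2, ℤ)) : Prop :=
  ∃ c : ℂ, c ≠ 0 ∧ f ∣[k] g = c • f

/-- The subgroup of all `g ∈ SL(2, ℤ)` under which `f` is semi-invariant in weight `k`. -/
def semiStabilizer (k : ℤ) (f : ℍ → ℂ) : Subgroup SL(2, ℤ) where
  carrier := {g | SemiInvariant k f g}
  one_mem' := ⟨1, one_ne_zero, by simp⟩
  mul_mem' := by
    rintro g h ⟨c, hc, hg⟩ ⟨d, hd, hh⟩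
    refine ⟨c * d, mul_ne_zero hc hd, ?_⟩
    rw [SlashAction.slash_mul, hg, ModularForm.SL_smul_slash, hh, smul_smul]
  inv_mem' := by
    rintro g ⟨c, hc, hg⟩
    refine ⟨c⁻¹, inv_ne_zero hc, ?_⟩
    have h : (f ∣[k] g) ∣[k] g⁻¹ = f := by rw [← SlashAction.slash_mul]; simp
    rw [hg, ModularForm.SL_smul_slash] at h
    rw [← h, smul_smul, inv_mul_cancel₀ hc, one_smul, h]

/-- The subgroup of all `g ∈ SL(2, ℤ)` under which `f` is invariant in weight `k`. -/
def slashStabilizer (k : ℤ) (f : ℍ → ℂ) : Subgroup SL(2, ℤ) where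
  carrier := {g | f ∣[k] g = f}
  one_mem' := by simp
  mul_mem' := by
    rintro g h (hg : _ = _) (hh : _ = _)
    change _ = _
    rw [SlashAction.slash_mul, hg, hh]
  inv_mem' := by
    rintro g (hg : _ = _)
    change _ = _
    have h : (f ∣[k] g) ∣[k] g⁻¹ = f := by rw [← SlashAction.slash_mul]; simp
    rwa [hg] at h

lemma slash_neg_one (k : ℤ) (f : ℍ → ℂ) : f ∣[k] (-1 : SL(2, ℤ)) = (-1 : ℂ) ^ k • f := by
  ext τ
  have : (-1 : SL(2, ℤ)) • τ = τ := by simp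
  rw [ModularForm.SL_slash_apply, this, ModularGroup.denom_apply]
  simp [mul_comm, ← inv_zpow]

lemma det_fricke (N : ℕ) [NeZero N] : (fricke N).det.val = N := by
  simp [fricke, Matrix.GeneralLinearGroup.mkOfDetNeZero, Matrix.det_fin_two]

lemma det_fricke_pos (N : ℕ) [NeZero N] : 0 < (fricke N).det.val := by
  rw [det_fricke]
  exact_mod_cast Nat.pos_of_ne_zero (NeZero.ne N)

lemma coe_fricke_smul (N : ℕ) [NeZero N] (τ : ℍ) :
    ((fricke N • τ : ℍ) : ℂ) = -1 / (N * (τ : ℂ)) := by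
  rw [coe_smul_of_det_pos (det_fricke_pos N)]
  simp [num, denom, fricke, Matrix.GeneralLinearGroup.mkOfDetNeZero]

lemma slash_fricke_apply (N : ℕ) [NeZero N] (k : ℤ) (f : ℍ → ℂ) (τ : ℍ) :
    (f ∣[k] fricke N) τ = f (fricke N • τ) * (N : ℂ) ^ (k - 1) * (N * (τ : ℂ)) ^ (-k) := by
  rw [ModularForm.slash_apply, det_fricke, σ, if_pos (det_fricke_pos N)]
  simp [denom, fricke, Matrix.GeneralLinearGroup.mkOfDetNeZero]

lemma smul_slash_fricke (N : ℕ) [NeZero N] (k : ℤ) (f : ℍ → ℂ) (c : ℂ) :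
    (c • f) ∣[k] fricke N = c • f ∣[k] fricke N := by
  ext τ
  simp [slash_fricke_apply, mul_assoc]

/-- The Fricke involution conjugates `T⁻¹` to the matrix `(1 0; N 1)`. -/
lemma lowerTri_mul_fricke (N : ℕ) [NeZero N] :
    (Matrix.SpecialLinearGroup.mapGL ℝ (lowerTri N)) * fricke N =
      fricke N * Matrix.SpecialLinearGroup.mapGL ℝ (T ^ (-1 : ℤ)) := by
  ext i j
  rw [Matrix.GeneralLinearGroup.coe_mul, Matrix.GeneralLinearGroup.coe_mul,
    Matrix.SpecialLinearGroup.mapGL_coe_matrix, Matrix.SpecialLinearGroup.mapGL_coe_matrix]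
  simp only [Matrix.SpecialLinearGroup.map_apply_coe, coe_T_zpow, coe_lowerTri, fricke,
    Matrix.GeneralLinearGroup.mkOfDetNeZero]
  fin_cases i <;> fin_cases j <;> simp [Matrix.mul_apply, Fin.sum_univ_two]

lemma slash_lowerTri_slash_fricke (N : ℕ) [NeZero N] (k : ℤ) (f : ℍ → ℂ) :
    (f ∣[k] lowerTri N) ∣[k] fricke N = (f ∣[k] fricke N) ∣[k] T⁻¹ := by
  rw [ModularForm.SL_slash, ModularForm.SL_slash, ← SlashAction.slash_mul,
    ← SlashAction.slash_mul]
  congr 1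
  rw [← zpow_neg_one T]
  exact lowerTri_mul_fricke N

lemma slash_fricke_injective (N : ℕ) [NeZero N] (k : ℤ) {f g : ℍ → ℂ}
    (h : f ∣[k] fricke N = g ∣[k] fricke N) : f = g := by
  have := congrArg (· ∣[k] (fricke N)⁻¹) h
  simpa [← SlashAction.slash_mul] using this

/-- Semi-invariance under `Γ₀(N)` holds as soon as `f` and its Fricke transform are semi-invariant
under translation. -/
theorem semiInvariant_of_mem_Gamma0 {N : ℕ} [NeZero N] (h2 : 2 ≤ N) (h4 : N ≤ 4) {k : ℤ}
    {f : ℍ → ℂ} (hT : SemiInvariant k f T) (hW : SemiInvariant k (f ∣[k] fricke N) T)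
    {γ : SL(2, ℤ)} (hγ : γ ∈ Gamma0 N) : SemiInvariant k f γ := by
  refine Gamma0_le_of_generators_mem (H := semiStabilizer k f) h2 h4 ?_ hT ?_ hγ
  · exact ⟨(-1) ^ k, zpow_ne_zero _ (by norm_num), slash_neg_one k f⟩
  · obtain ⟨c, hc, h⟩ := (semiStabilizer k (f ∣[k] fricke N)).inv_mem hW
    refine ⟨c, hc, slash_fricke_injective N k ?_⟩
    rw [slash_lowerTri_slash_fricke, h, smul_slash_fricke]

/-- The analogue of `semiInvariant_of_mem_Gamma0` for invariance. The weight is even so that `-1` acts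
trivially. -/
theorem slash_eq_of_mem_Gamma0 {N : ℕ} [NeZero N] (h2 : 2 ≤ N) (h4 : N ≤ 4) {k : ℤ}
    (hk : Even k) {f : ℍ → ℂ} (hT : f ∣[k] T = f)
    (hW : (f ∣[k] fricke N) ∣[k] T = f ∣[k] fricke N)
    {γ : SL(2, ℤ)} (hγ : γ ∈ Gamma0 N) : f ∣[k] γ = f := by
  refine Gamma0_le_of_generators_mem (H := slashStabilizer k f) h2 h4 ?_ hT ?_ hγ
  · change _ = _
    rw [slash_neg_one, hk.neg_one_zpow, one_smul]
  · refine slash_fricke_injective N k ?_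
    rw [slash_lowerTri_slash_fricke]
    exact (slashStabilizer k (f ∣[k] fricke N)).inv_mem hW

lemma slash_T_apply (k : ℤ) (f : ℍ → ℂ) (τ : ℍ) : (f ∣[k] T) τ = f ((1 : ℝ) +ᵥ τ) := by
  rw [ModularForm.SL_slash_apply, modular_T_smul, ModularGroup.denom_apply]
  simp [T]

/-! ### Behaviour at the cusps -/

/-- The point `(τ + j) / N`. -/
def shiftDiv (N : ℕ) [NeZero N] (j : ℝ) (τ : ℍ) : ℍ :=
  ⟨((τ : ℂ) + j) / N, by
    have h : (((τ : ℂ) + j) / N).im = τ.im / N := by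
      rw [Complex.div_natCast_im]
      simp
    rw [h]
    exact div_pos τ.im_pos (by exact_mod_cast Nat.pos_of_ne_zero (NeZero.ne N))⟩

lemma coe_shiftDiv (N : ℕ) [NeZero N] (j : ℝ) (τ : ℍ) :
    (shiftDiv N j τ : ℂ) = ((τ : ℂ) + j) / N := rfl

lemma im_shiftDiv (N : ℕ) [NeZero N] (j : ℝ) (τ : ℍ) : (shiftDiv N j τ).im = τ.im / N := by
  change (((τ : ℂ) + j) / N).im = _
  rw [Complex.div_natCast_im]
  simp

lemma tendsto_shiftDiv (N : ℕ) [NeZero N] (j : ℝ) :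
    Tendsto (shiftDiv N j) atImInfty atImInfty := by
  rw [atImInfty, tendsto_comap_iff]
  refine Tendsto.congr (fun τ ↦ (im_shiftDiv N j τ).symm) ?_
  exact tendsto_comap.atTop_div_const (by exact_mod_cast Nat.pos_of_ne_zero (NeZero.ne N))

lemma S_smul_T_zpow_smul (N : ℕ) [NeZero N] (j : ℤ) (τ : ℍ) :
    (S * T ^ j) • τ = fricke N • shiftDiv N j τ := by
  ext
  rw [mul_smul, modular_T_zpow_smul, modular_S_smul, coe_fricke_smul, coe_shiftDiv]
  have h1 : (N : ℂ) ≠ 0 := NeZero.ne _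
  have h2 : (τ : ℂ) + j ≠ 0 := by
    have := ((j : ℝ) +ᵥ τ).ne_zero
    rw [coe_vadd, add_comm] at this
    exact_mod_cast this
  push_cast
  rw [coe_vadd]
  push_cast
  rw [mul_div_cancel₀ _ h1, neg_div, one_div, inv_neg, add_comm]

/-- The behaviour of `f` at the cusps equivalent to `0` is that of its Fricke transform at `i∞`, with
`(τ + j) / N` in place of `τ`. -/
lemma slash_S_mul_T_zpow_apply (N : ℕ) [NeZero N] (k : ℤ) (f : ℍ → ℂ) (j : ℤ) (τ : ℍ) :
    (f ∣[k] (S * T ^ j)) τ = (N : ℂ) ^ (1 - k) * (f ∣[k] fricke N) (shiftDiv N j τ) := by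
  have h1 : (N : ℂ) ≠ 0 := NeZero.ne _
  rw [ModularForm.SL_slash_apply, S_smul_T_zpow_smul N, slash_fricke_apply, coe_shiftDiv,
    mul_div_cancel₀ _ h1]
  have hd : denom (S * T ^ j : SL(2, ℤ)) τ = (τ : ℂ) + (j : ℝ) := by
    rw [ModularGroup.denom_apply, Matrix.SpecialLinearGroup.coe_mul, coe_T_zpow, coe_S]
    simp [Matrix.mul_apply, Fin.sum_univ_two]
  rw [hd]
  have h3 : (N : ℂ) ^ (1 - k) * (N : ℂ) ^ (k - 1) = 1 := by
    rw [← zpow_add₀ h1]; simp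
  linear_combination -f (fricke N • shiftDiv N j τ) * ((τ : ℂ) + (j : ℝ)) ^ (-k) * h3

/-- `f` has the leading term `L q ^ x`, `L ≠ 0`, at `i∞`. -/
def HasLeadingExponent (f : ℍ → ℂ) (x : ℚ) : Prop :=
  ∃ L : ℂ, L ≠ 0 ∧
    Tendsto (fun τ : ℍ ↦ f τ * exp (-(2 * Real.pi * I * (x : ℂ) * (τ : ℂ)))) atImInfty (𝓝 L)

namespace HasLeadingExponent

variable {f g : ℍ → ℂ} {x y : ℚ}

lemma congr' (h : HasLeadingExponent f x) (hfg : f =ᶠ[atImInfty] g) :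
    HasLeadingExponent g x := by
  obtain ⟨L, hL, ht⟩ := h
  exact ⟨L, hL, ht.congr' (hfg.mono fun τ hτ ↦ by simp only [hτ])⟩

lemma mul (hf : HasLeadingExponent f x) (hg : HasLeadingExponent g y) :
    HasLeadingExponent (f * g) (x + y) := by
  obtain ⟨L, hL, hLt⟩ := hf
  obtain ⟨M, hM, hMt⟩ := hg
  refine ⟨L * M, mul_ne_zero hL hM, (hLt.mul hMt).congr fun τ ↦ ?_⟩
  rw [mul_mul_mul_comm, ← Complex.exp_add, Pi.mul_apply]
  congr 2
  push_cast
  ring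

lemma inv (hf : HasLeadingExponent f x) : HasLeadingExponent f⁻¹ (-x) := by
  obtain ⟨L, hL, hLt⟩ := hf
  refine ⟨L⁻¹, inv_ne_zero hL, (hLt.inv₀ hL).congr fun τ ↦ ?_⟩
  rw [mul_inv, ← Complex.exp_neg, Pi.inv_apply]
  congr 2
  push_cast
  ring

lemma div (hf : HasLeadingExponent f x) (hg : HasLeadingExponent g y) :
    HasLeadingExponent (f / g) (x - y) := by
  rw [div_eq_mul_inv, sub_eq_add_neg]
  exact hf.mul hg.inv

lemma of_tendsto {L : ℂ} (hL : L ≠ 0) (h : Tendsto f atImInfty (𝓝 L)) :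
    HasLeadingExponent f 0 :=
  ⟨L, hL, by simpa using h⟩

lemma const {c : ℂ} (hc : c ≠ 0) : HasLeadingExponent (fun _ ↦ c) 0 :=
  of_tendsto hc tendsto_const_nhds

lemma smul {c : ℂ} (hc : c ≠ 0) (hf : HasLeadingExponent f x) :
    HasLeadingExponent (c • f) x := by
  have := (const hc).mul hf
  rw [zero_add] at this
  exact this

lemma pow (hf : HasLeadingExponent f x) (n : ℕ) : HasLeadingExponent (f ^ n) (n * x) := by
  induction n with
  | zero =>
    rw [pow_zero, Nat.cast_zero, zero_mul]
    exact const one_ne_zero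
  | succ n ih =>
    rw [pow_succ]
    convert ih.mul hf using 1
    push_cast
    ring

lemma shiftDiv (hf : HasLeadingExponent f x) (N : ℕ) [NeZero N] (j : ℝ) :
    HasLeadingExponent (fun τ ↦ f (shiftDiv N j τ)) (x / N) := by
  obtain ⟨L, hL, hLt⟩ := hf
  refine ⟨L * exp (2 * Real.pi * I * x * j / N), mul_ne_zero hL (exp_ne_zero _), ?_⟩
  refine ((hLt.comp (tendsto_shiftDiv N j)).mul_const _).congr fun τ ↦ ?_
  simp only [Function.comp_apply]
  rw [mul_assoc, ← Complex.exp_add, coe_shiftDiv]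
  congr 2
  push_cast
  ring

lemma isBoundedAtImInfty (hf : HasLeadingExponent f x) (hx : 0 ≤ x) :
    IsBoundedAtImInfty f := by
  obtain ⟨L, -, hLt⟩ := hf
  have h1 := hLt.isBigO_one ℝ
  refine Asymptotics.IsBigO.trans (.of_bound 1 ?_) h1
  have h2 : ∀ᶠ τ : ℍ in atImInfty, (0 : ℝ) ≤ τ.im := Eventually.of_forall fun τ ↦ τ.im_pos.le
  refine h2.mono fun τ hτ ↦ ?_
  rw [norm_mul, one_mul]
  refine le_mul_of_one_le_right (norm_nonneg _) ?_
  rw [Complex.norm_exp, Real.one_le_exp_iff]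
  have : (-(2 * (Real.pi : ℂ) * I * (x : ℂ) * (τ : ℂ))).re = 2 * Real.pi * x * τ.im := by
    have h3 : (-(2 * (Real.pi : ℂ) * I * (x : ℂ) * (τ : ℂ))) =
        ((2 * Real.pi * x : ℝ) : ℂ) * (-(I * τ)) := by push_cast; ring
    rw [h3, Complex.re_ofReal_mul]
    simp
  rw [this]
  have : (0 : ℝ) ≤ x := by exact_mod_cast hx
  positivity

end HasLeadingExponent

/-- The width of the cusp `g ∞`, whose denominator is `c = g 1 0`, is the least `h ≥ 1` with
`N ∣ c ^ 2 h`. -/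
lemma cuspWidth_eq {N : ℕ} {g : SL(2, ℤ)} {w : ℕ} (hw : 0 < w) (h1 : (N : ℤ) ∣ (g 1 0) ^ 2 * w)
    (h2 : ∀ h : ℕ, (N : ℤ) ∣ (g 1 0) ^ 2 * h → w ∣ h) : cuspWidth (Gamma0 N) g = w := by
  have hmem : ∀ h : ℕ, g * T ^ h * g⁻¹ ∈ Gamma0 N ↔ (N : ℤ) ∣ (g 1 0) ^ 2 * h := by
    intro h
    rw [mem_Gamma0_iff_dvd, ← zpow_natCast, Matrix.SpecialLinearGroup.coe_mul,
      Matrix.SpecialLinearGroup.coe_mul, Matrix.SpecialLinearGroup.coe_inv, coe_T_zpow,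
      Matrix.adjugate_fin_two, ← dvd_neg]
    simp [Matrix.mul_apply, Fin.sum_univ_two]
    ring_nf
  rw [cuspWidth]
  refine le_antisymm (Nat.sInf_le ⟨hw, (hmem w).mpr h1⟩) (le_csInf ⟨w, hw, (hmem w).mpr h1⟩ ?_)
  rintro h ⟨h0, hh⟩
  exact Nat.le_of_dvd h0 (h2 h ((hmem h).mp hh))

section cusps

variable {N : ℕ} {k : ℤ} {f : ℍ → ℂ} {x : ℚ}

lemma slash_eq_smul_of_semiInvariant {γ g : SL(2, ℤ)} (h : SemiInvariant k f γ) :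
    ∃ c : ℂ, c ≠ 0 ∧ f ∣[k] (γ * g) = c • f ∣[k] g := by
  obtain ⟨c, hc, h⟩ := h
  exact ⟨c, hc, by rw [SlashAction.slash_mul, h, ModularForm.SL_smul_slash]⟩

lemma hasLeadingExponent_slash_of_mem (hf : ∀ γ ∈ Gamma0 N, SemiInvariant k f γ)
    (hx : HasLeadingExponent f x) {g : SL(2, ℤ)} (hg : g ∈ Gamma0 N) :
    HasLeadingExponent (f ∣[k] g) (x / cuspWidth (Gamma0 N) g) := by
  obtain ⟨c, hc, h⟩ := hf g hg
  rw [cuspWidth_eq one_pos (by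
    rw [Nat.cast_one, mul_one, pow_two]
    exact (mem_Gamma0_iff_dvd.mp hg).mul_left _) (fun h _ ↦ one_dvd h), Nat.cast_one, div_one, h]
  exact hx.smul hc

lemma hasLeadingExponent_slash_of_isCoprime [NeZero N]
    (hf : ∀ γ ∈ Gamma0 N, SemiInvariant k f γ)
    (hx : HasLeadingExponent (f ∣[k] fricke N) x) {g : SL(2, ℤ)}
    (hg : IsCoprime (g 1 0) (N : ℤ)) :
    HasLeadingExponent (f ∣[k] g) (x / cuspWidth (Gamma0 N) g) := by
  rw [cuspWidth_eq (N := N) (w := N) (Nat.pos_of_ne_zero (NeZero.ne N)) (dvd_mul_left _ _)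
    (fun h hh ↦ by
      exact_mod_cast (IsCoprime.pow_left (m := 2) hg).symm.dvd_of_dvd_mul_left hh)]
  obtain ⟨γ, hγ, j, rfl⟩ := exists_eq_mul_S_mul_T_zpow hg
  obtain ⟨c, hc, h⟩ := slash_eq_smul_of_semiInvariant (g := S * T ^ j) (hf γ hγ)
  rw [mul_assoc, h]
  refine HasLeadingExponent.smul hc (((hx.shiftDiv N j).smul
    (zpow_ne_zero (1 - k) (NeZero.ne (N : ℂ)))).congr' (Eventually.of_forall fun τ ↦ ?_))
  rw [slash_S_mul_T_zpow_apply N]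
  rfl

lemma hasLeadingExponent_slash_of_mod_four (hf : ∀ γ ∈ Gamma0 4, SemiInvariant k f γ)
    (hx : HasLeadingExponent (f ∣[k] lowerTri 2) x) {g : SL(2, ℤ)} (hg : g 1 0 % 4 = 2) :
    HasLeadingExponent (f ∣[k] g) (x / cuspWidth (Gamma0 4) g) := by
  rw [cuspWidth_eq one_pos (by
    obtain ⟨y, hy⟩ : ∃ y, g 1 0 = 2 * y := ⟨g 1 0 / 2, by omega⟩
    rw [hy]
    exact ⟨y ^ 2, by push_cast; ring⟩) (fun h _ ↦ one_dvd h), Nat.cast_one, div_one]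
  obtain ⟨γ, hγ, rfl⟩ := exists_eq_mul_lowerTri_two hg
  obtain ⟨c, hc, h⟩ := slash_eq_smul_of_semiInvariant (g := lowerTri 2) (hf γ hγ)
  rw [h]
  exact hx.smul hc

lemma isBoundedAtImInfty_smul {f : ℍ → ℂ} (hf : IsBoundedAtImInfty f) (c : ℂ) :
    IsBoundedAtImInfty (c • f) :=
  Asymptotics.IsBigO.const_mul_left hf c

lemma isBoundedAtImInfty_slash_of_mem (hf : ∀ γ ∈ Gamma0 N, SemiInvariant k f γ)
    (hx : IsBoundedAtImInfty f) {g : SL(2, ℤ)} (hg : g ∈ Gamma0 N) :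
    IsBoundedAtImInfty (f ∣[k] g) := by
  obtain ⟨c, hc, h⟩ := hf g hg
  rw [h]
  exact isBoundedAtImInfty_smul hx c

lemma isBoundedAtImInfty_slash_of_isCoprime [NeZero N]
    (hf : ∀ γ ∈ Gamma0 N, SemiInvariant k f γ)
    (hx : IsBoundedAtImInfty (f ∣[k] fricke N)) {g : SL(2, ℤ)}
    (hg : IsCoprime (g 1 0) (N : ℤ)) : IsBoundedAtImInfty (f ∣[k] g) := by
  obtain ⟨γ, hγ, j, rfl⟩ := exists_eq_mul_S_mul_T_zpow hg
  obtain ⟨c, hc, h⟩ := slash_eq_smul_of_semiInvariant (g := S * T ^ j) (hf γ hγ)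
  rw [mul_assoc, h]
  refine isBoundedAtImInfty_smul ?_ c
  have h1 : IsBoundedAtImInfty (fun τ ↦ (f ∣[k] fricke N) (shiftDiv N j τ)) :=
    Asymptotics.IsBigO.comp_tendsto hx (tendsto_shiftDiv N j)
  have h2 := isBoundedAtImInfty_smul h1 ((N : ℂ) ^ (1 - k))
  convert h2 using 1
  ext τ
  rw [slash_S_mul_T_zpow_apply N]
  rfl

lemma isBoundedAtImInfty_slash_of_mod_four (hf : ∀ γ ∈ Gamma0 4, SemiInvariant k f γ)
    (hx : IsBoundedAtImInfty (f ∣[k] lowerTri 2)) {g : SL(2, ℤ)} (hg : g 1 0 % 4 = 2) :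
    IsBoundedAtImInfty (f ∣[k] g) := by
  obtain ⟨γ, hγ, rfl⟩ := exists_eq_mul_lowerTri_two hg
  obtain ⟨c, hc, h⟩ := slash_eq_smul_of_semiInvariant (g := lowerTri 2) (hf γ hγ)
  rw [h]
  exact isBoundedAtImInfty_smul hx c

end cusps

/-! ### Equivalence classes of cusps -/

section classes

variable {N : ℕ}

lemma not_equivalent_pt_cusp {Γ : Subgroup SL(2, ℤ)} (τ : ℍ) (c : OnePoint ℚ) :
    ¬ HStar.Equivalent Γ (.pt τ) (.cusp c) := by
  rintro ⟨γ, -, h⟩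
  simp [HStar.act] at h

lemma not_equivalent_cusp_pt {Γ : Subgroup SL(2, ℤ)} (τ : ℍ) (c : OnePoint ℚ) :
    ¬ HStar.Equivalent Γ (.cusp c) (.pt τ) := by
  rintro ⟨γ, -, h⟩
  simp [HStar.act] at h

lemma equivalent_smul_infty {g h : SL(2, ℤ)} {c : OnePoint ℚ}
    (hc : Matrix.SpecialLinearGroup.mapGL ℚ h • (OnePoint.infty : OnePoint ℚ) = c) :
    HStar.Equivalent (Gamma0 N) (.cusp c)
      (.cusp (Matrix.SpecialLinearGroup.mapGL ℚ g • (OnePoint.infty : OnePoint ℚ))) ↔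
    ∃ γ ∈ Gamma0 N, Matrix.SpecialLinearGroup.mapGL ℚ g • (OnePoint.infty : OnePoint ℚ) =
      Matrix.SpecialLinearGroup.mapGL ℚ (γ * h) • (OnePoint.infty : OnePoint ℚ) := by
  simp only [HStar.Equivalent, HStar.act, HStar.cusp.injEq, map_mul, mul_smul, hc]
  exact exists_congr fun γ ↦ and_congr_right fun _ ↦ eq_comm

lemma T_zpow_smul_infty (j : ℤ) :
    Matrix.SpecialLinearGroup.mapGL ℚ (T ^ j) • (OnePoint.infty : OnePoint ℚ) =
      OnePoint.infty := by
  rw [OnePoint.smul_infty_eq_self_iff, Matrix.SpecialLinearGroup.mapGL_coe_matrix]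
  simp [-map_zpow, coe_T_zpow]

lemma S_smul_infty : Matrix.SpecialLinearGroup.mapGL ℚ S • (OnePoint.infty : OnePoint ℚ) =
    ((0 : ℚ) : OnePoint ℚ) := by
  rw [OnePoint.smul_infty_eq_ite, Matrix.SpecialLinearGroup.mapGL_coe_matrix]
  simp [coe_S]

lemma lowerTri_two_smul_infty :
    Matrix.SpecialLinearGroup.mapGL ℚ (lowerTri 2) • (OnePoint.infty : OnePoint ℚ) =
      ((1 / 2 : ℚ) : OnePoint ℚ) := by
  rw [OnePoint.smul_infty_eq_ite, Matrix.SpecialLinearGroup.mapGL_coe_matrix]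
  simp [coe_lowerTri]

lemma equivalent_infty_iff {g : SL(2, ℤ)} :
    HStar.Equivalent (Gamma0 N) (.cusp OnePoint.infty)
      (.cusp (Matrix.SpecialLinearGroup.mapGL ℚ g • (OnePoint.infty : OnePoint ℚ))) ↔
    g ∈ Gamma0 N := by
  rw [equivalent_smul_infty (h := 1) (by simp)]
  constructor
  · rintro ⟨γ, hγ, h⟩
    rw [mul_one] at h
    rw [mem_Gamma0_iff_dvd] at hγ ⊢
    rcases lower_left_eq_or_eq_neg_of_smul_infty_eq h with h | h <;> rw [h]
    · exact hγ
    · exact hγ.neg_right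
  · intro hg
    exact ⟨g, hg, by rw [mul_one]⟩

lemma equivalent_zero_iff {g : SL(2, ℤ)} :
    HStar.Equivalent (Gamma0 N) (.cusp (0 : ℚ))
      (.cusp (Matrix.SpecialLinearGroup.mapGL ℚ g • (OnePoint.infty : OnePoint ℚ))) ↔
    IsCoprime (g 1 0) (N : ℤ) := by
  rw [equivalent_smul_infty S_smul_infty]
  constructor
  · rintro ⟨γ, hγ, h⟩
    rw [mem_Gamma0_iff_dvd] at hγ
    obtain ⟨y, hy⟩ := hγ
    have hcop : IsCoprime (γ 1 1) (N : ℤ) := by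
      refine ⟨γ 0 0, -(γ 0 1) * y, ?_⟩
      have hdet := γ.det_coe
      rw [Matrix.det_fin_two, hy] at hdet
      linear_combination hdet
    have hent : (γ * S) 1 0 = γ 1 1 := by
      rw [Matrix.SpecialLinearGroup.coe_mul, coe_S]
      simp [Matrix.mul_apply, Fin.sum_univ_two]
    rcases lower_left_eq_or_eq_neg_of_smul_infty_eq h with h | h <;> rw [h, hent]
    · exact hcop
    · exact hcop.neg_left
  · intro hg
    obtain ⟨γ, hγ, j, rfl⟩ := exists_eq_mul_S_mul_T_zpow hg
    refine ⟨γ, hγ, ?_⟩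
    rw [map_mul _ (γ * S), mul_smul, T_zpow_smul_infty]

lemma equivalent_half_iff {g : SL(2, ℤ)} :
    HStar.Equivalent (Gamma0 4) (.cusp (1 / 2 : ℚ))
      (.cusp (Matrix.SpecialLinearGroup.mapGL ℚ g • (OnePoint.infty : OnePoint ℚ))) ↔
    g 1 0 % 4 = 2 := by
  rw [equivalent_smul_infty lowerTri_two_smul_infty]
  constructor
  · rintro ⟨γ, hγ, h⟩
    rw [mem_Gamma0_iff_dvd] at hγ
    have hodd : (γ 1 1) % 2 = 1 := by
      by_contra hne
      obtain ⟨x, hx⟩ : ∃ x, γ 1 1 = 2 * x := ⟨γ 1 1 / 2, by omega⟩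
      obtain ⟨y, hy⟩ := hγ
      have hdet := γ.det_coe
      rw [Matrix.det_fin_two, hx, hy] at hdet
      have : 2 * (γ 0 0 * x - γ 0 1 * (2 * y)) = 1 := by
        push_cast at hdet
        linear_combination hdet
      omega
    have hent : (γ * lowerTri 2) 1 0 = γ 1 0 + 2 * γ 1 1 := by
      rw [Matrix.SpecialLinearGroup.coe_mul, coe_lowerTri]
      simp [Matrix.mul_apply, Fin.sum_univ_two]
      ring
    rcases lower_left_eq_or_eq_neg_of_smul_infty_eq h with h | h <;> omega
  · intro hg
    obtain ⟨γ, hγ, rfl⟩ := exists_eq_mul_lowerTri_two hg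
    exact ⟨γ, hγ, rfl⟩

lemma mem_Gamma0_or_isCoprime (hN : N.Prime) (g : SL(2, ℤ)) :
    g ∈ Gamma0 N ∨ IsCoprime (g 1 0) (N : ℤ) := by
  rw [mem_Gamma0_iff_dvd, or_iff_not_imp_left]
  exact fun h ↦ ((Nat.prime_iff_prime_int.mp hN).coprime_iff_not_dvd.mpr h).symm

lemma mem_Gamma0_four_iff {g : SL(2, ℤ)} : g ∈ Gamma0 4 ↔ g 1 0 % 4 = 0 := by
  rw [mem_Gamma0_iff_dvd]
  push_cast
  omega

lemma isCoprime_four_iff {c : ℤ} : IsCoprime c ((4 : ℕ) : ℤ) ↔ c % 2 = 1 := by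
  constructor
  · rintro ⟨u, v, h⟩
    by_contra hc
    obtain ⟨y, hy⟩ : ∃ y, c = 2 * y := ⟨c / 2, by omega⟩
    have : 2 * (u * y + v * 2) = 1 := by
      rw [hy] at h
      push_cast at h
      linear_combination h
    omega
  · intro h
    have h2 : IsCoprime c 2 := ⟨1, -(c / 2), by omega⟩
    have := h2.pow_right (n := 2)
    norm_num at this ⊢
    exact this

end classes

/-! ### Euler's product -/

/-- Euler's product `∏ (1 - q ^ n)` over `n ≥ 1`. -/
def eulerProd (q : ℂ) : ℂ := ∏' n : ℕ, (1 - q ^ (n + 1))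

lemma eulerProd_zero : eulerProd 0 = 1 := by simp [eulerProd]

lemma multipliable_one_sub_pow_comp {q : ℂ} (hq : ‖q‖ < 1) {u : ℕ → ℕ}
    (hu : Function.Injective u) : Multipliable fun n ↦ 1 - q ^ u n := by
  have : Summable fun n ↦ ‖-q ^ u n‖ := by
    simp only [norm_neg, norm_pow]
    exact (summable_geometric_of_lt_one (norm_nonneg _) hq).comp_injective hu
  simpa [sub_eq_add_neg] using multipliable_one_add_of_summable this

lemma differentiableAt_eulerProd {q : ℂ} (hq : ‖q‖ < 1) : DifferentiableAt ℂ eulerProd q :=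
  ModularForm.differentiableOn_tprod_one_sub_pow.differentiableAt
    (Metric.isOpen_ball.mem_nhds (by simpa using hq))

/-- The product `∏ (1 - q ^ n)` over odd `n ≥ 1`. -/
def oddProd (q : ℂ) : ℂ := ∏' n : ℕ, (1 - q ^ (2 * n + 1))

lemma eulerProd_eq_oddProd_mul {q : ℂ} (hq : ‖q‖ < 1) :
    eulerProd q = oddProd q * eulerProd (q ^ 2) := by
  have h := tprod_even_mul_odd (f := fun n : ℕ ↦ 1 - q ^ (n + 1))
    (multipliable_one_sub_pow_comp hq fun a b h ↦ by simpa using h)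
    (multipliable_one_sub_pow_comp hq fun a b h ↦ by simpa using h)
  rw [eulerProd, ← h, oddProd, eulerProd]
  congr 1
  refine tprod_congr fun n ↦ ?_
  rw [← pow_mul]
  ring_nf

lemma oddProd_mul_oddProd_neg {q : ℂ} (hq : ‖q‖ < 1) :
    oddProd q * oddProd (-q) = oddProd (q ^ 2) := by
  have hinj : Function.Injective fun n : ℕ ↦ 2 * n + 1 := fun a b h ↦ by simpa using h
  rw [oddProd, oddProd, ← (multipliable_one_sub_pow_comp hq hinj).tprod_mul
    (multipliable_one_sub_pow_comp (q := -q) (by simpa using hq) hinj), oddProd]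
  refine tprod_congr fun n ↦ ?_
  rw [← pow_mul, Odd.neg_pow ⟨n, rfl⟩]
  ring

lemma norm_sq_lt_one {q : ℂ} (hq : ‖q‖ < 1) : ‖q ^ 2‖ < 1 := by
  rw [norm_pow]
  exact pow_lt_one₀ (norm_nonneg _) hq two_ne_zero

/-- The effect of `q ↦ -q` on Euler's product: split the product into even and odd factors. -/
lemma eulerProd_mul_eulerProd_neg {q : ℂ} (hq : ‖q‖ < 1) :
    eulerProd q * eulerProd (-q) * eulerProd (q ^ 4) = eulerProd (q ^ 2) ^ 3 := by
  have h1 := eulerProd_eq_oddProd_mul hq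
  have h2 := eulerProd_eq_oddProd_mul (q := -q) (by simpa using hq)
  have h3 := eulerProd_eq_oddProd_mul (norm_sq_lt_one hq)
  rw [neg_sq] at h2
  rw [← pow_mul] at h3
  norm_num at h3
  have h4 := oddProd_mul_oddProd_neg hq
  rw [h1, h2]
  have h5 : eulerProd (q ^ 2) ^ 3 =
      eulerProd (q ^ 2) ^ 2 * (oddProd (q ^ 2) * eulerProd (q ^ 4)) := by
    rw [← h3]; ring
  rw [h5, ← h4]
  ring

/-- The linear coefficient of Euler's product, which is that of its first factor: the partial
products all have derivative `-1` at `0`, and derivatives pass to locally uniform limits. -/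
lemma hasDerivAt_eulerProd_zero : HasDerivAt eulerProd (-1) 0 := by
  have hd := (differentiableAt_eulerProd (q := 0) (by simp)).hasDerivAt
  have hlim := ModularForm.multipliableLocallyUniformlyOn_one_sub_pow.hasProdLocallyUniformlyOn
  have hl : TendstoLocallyUniformlyOn
      (fun (s : Finset ℕ) (q : ℂ) ↦ ∏ i ∈ s, (1 - q ^ (i + 1)))
      eulerProd atTop (Metric.ball 0 1) := hlim
  have hder := (hl.deriv (.of_forall fun s ↦ by
      simpa [Finset.prod_fn] using
        DifferentiableOn.finsetProd (fun _ _ ↦ by fun_prop)) Metric.isOpen_ball).tendsto_at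
        (Metric.mem_ball_self one_pos)
  have hpart : ∀ s : Finset ℕ, 0 ∈ s →
      deriv (fun q : ℂ ↦ ∏ i ∈ s, (1 - q ^ (i + 1))) 0 = -1 := by
    intro s hs
    have := HasDerivAt.fun_finsetProd (u := s) (x := (0 : ℂ))
      (f := fun i q ↦ 1 - q ^ (i + 1)) (f' := fun i ↦ -(((i + 1 : ℕ) : ℂ) * 0 ^ i))
      (fun i _ ↦ by
        have := (hasDerivAt_pow (i + 1) (0 : ℂ)).const_sub 1
        simpa using this)
    rw [this.deriv, Finset.sum_eq_single_of_mem 0 hs]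
    · simp
    · intro i _ hi
      simp [hi]
  have h2 : Tendsto (fun s : Finset ℕ ↦ deriv (fun q : ℂ ↦ ∏ i ∈ s, (1 - q ^ (i + 1))) 0)
      atTop (𝓝 (-1)) := by
    refine tendsto_const_nhds.congr' ?_
    filter_upwards [eventually_ge_atTop {0}] with s hs
    exact (hpart s (by simpa using hs)).symm
  rw [tendsto_nhds_unique hder h2] at hd
  exact hd

/-! ### The functions `τ ↦ η(δτ)` -/

/-- The root `q ^ (1 / 24) = exp (2 π i τ / 24)` of the nome. -/
def qRoot (τ : ℍ) : ℂ := exp (2 * Real.pi * I * τ / 24)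

/-- The nome `q = exp (2 π i τ)`. -/
def nome (τ : ℍ) : ℂ := exp (2 * Real.pi * I * τ)

lemma qRoot_pow (τ : ℍ) : qRoot τ ^ 24 = nome τ := by
  rw [qRoot, nome, ← Complex.exp_nat_mul]
  congr 1
  push_cast
  ring

lemma qRoot_ne_zero (τ : ℍ) : qRoot τ ≠ 0 := exp_ne_zero _

lemma nome_ne_zero (τ : ℍ) : nome τ ≠ 0 := exp_ne_zero _

lemma norm_nome (τ : ℍ) : ‖nome τ‖ = Real.exp (-(2 * Real.pi * τ.im)) := by
  rw [nome, Complex.norm_exp]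
  congr 1
  have : 2 * (Real.pi : ℂ) * I * τ = ((2 * Real.pi : ℝ) : ℂ) * (I * τ) := by push_cast; ring
  rw [this, Complex.re_ofReal_mul]
  simp

lemma norm_nome_lt_one (τ : ℍ) : ‖nome τ‖ < 1 := by
  rw [norm_nome, Real.exp_lt_one_iff]
  have := τ.im_pos
  have := Real.pi_pos
  simp only [Left.neg_neg_iff]
  positivity

lemma tendsto_nome : Tendsto nome atImInfty (𝓝 0) := by
  rw [tendsto_zero_iff_norm_tendsto_zero]
  simp only [norm_nome]
  refine Real.tendsto_exp_neg_atTop_nhds_zero.comp ?_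
  exact tendsto_comap.const_mul_atTop (by positivity)

lemma tendsto_nome_punctured : Tendsto nome atImInfty (𝓝[≠] 0) :=
  tendsto_nhdsWithin_iff.mpr ⟨tendsto_nome, .of_forall nome_ne_zero⟩

lemma natCast_mul_mem {δ : ℕ} (hδ : δ ≠ 0) (τ : ℍ) :
    (δ : ℂ) * (τ : ℂ) ∈ upperHalfPlaneSet := by
  change 0 < ((δ : ℂ) * (τ : ℂ)).im
  rw [← Complex.ofReal_natCast, Complex.im_ofReal_mul]
  exact mul_pos (by exact_mod_cast Nat.pos_of_ne_zero hδ) τ.im_pos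

lemma etaMul_eq (δ : ℕ) (τ : ℍ) : etaMul δ τ = qRoot τ ^ δ * eulerProd (nome τ ^ δ) := by
  rw [etaMul, ModularForm.eta, eulerProd]
  have h1 : Function.Periodic.qParam 24 ((δ : ℂ) * τ) = qRoot τ ^ δ := by
    rw [Function.Periodic.qParam, qRoot, ← Complex.exp_nat_mul]
    congr 1
    push_cast
    ring
  have h2 : Function.Periodic.qParam 1 ((δ : ℂ) * τ) = nome τ ^ δ := by
    rw [Function.Periodic.qParam, nome, ← Complex.exp_nat_mul]
    congr 1
    push_cast
    ring
  rw [h1]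
  simp only [ModularForm.eta_q, h2]

lemma etaMul_ne_zero {δ : ℕ} (hδ : δ ≠ 0) (τ : ℍ) : etaMul δ τ ≠ 0 :=
  ModularForm.eta_ne_zero (natCast_mul_mem hδ τ)

lemma mdifferentiable_etaMul {δ : ℕ} (hδ : δ ≠ 0) :
    MDifferentiable 𝓘(ℂ) 𝓘(ℂ) (etaMul δ) := by
  rw [UpperHalfPlane.mdifferentiable_iff]
  have h : DifferentiableOn ℂ (fun z : ℂ ↦ ModularForm.eta (δ * z)) {z | 0 < z.im} := by
    intro z hz
    have h1 := ModularForm.differentiableAt_eta_of_mem_upperHalfPlaneSet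
      (natCast_mul_mem hδ ⟨z, hz⟩)
    exact (h1.comp z (f := fun z : ℂ ↦ (δ : ℂ) * z) (by fun_prop)).differentiableWithinAt
  exact h.congr fun z hz ↦ by simp [etaMul, ofComplex_apply_of_im_pos hz]

lemma nome_vadd_one (τ : ℍ) : nome ((1 : ℝ) +ᵥ τ) = nome τ := by
  rw [nome, nome, coe_vadd, Complex.exp_eq_exp_iff_exists_int]
  exact ⟨1, by push_cast; ring⟩

lemma nome_vadd_neg_half (τ : ℍ) : nome ((-(1 / 2) : ℝ) +ᵥ τ) = -nome τ := by
  rw [nome, nome, coe_vadd]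
  push_cast
  rw [mul_add, Complex.exp_add]
  rw [show 2 * (Real.pi : ℂ) * I * (-(1 / 2)) = -(Real.pi * I) by ring, Complex.exp_neg,
    Complex.exp_pi_mul_I]
  norm_num

lemma qRoot_vadd (x : ℝ) (τ : ℍ) :
    qRoot (x +ᵥ τ) = exp (2 * Real.pi * I * x / 24) * qRoot τ := by
  rw [qRoot, qRoot, coe_vadd, ← Complex.exp_add]
  congr 1
  ring

/-- `f (τ + 1)` is a nonzero constant multiple of `f τ`. -/
def SemiPeriodic (f : ℍ → ℂ) : Prop :=
  ∃ c : ℂ, c ≠ 0 ∧ ∀ τ, f ((1 : ℝ) +ᵥ τ) = c * f τ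

lemma SemiPeriodic.mul {f g : ℍ → ℂ} (hf : SemiPeriodic f) (hg : SemiPeriodic g) :
    SemiPeriodic (f * g) := by
  obtain ⟨c, hc, hf⟩ := hf
  obtain ⟨d, hd, hg⟩ := hg
  exact ⟨c * d, mul_ne_zero hc hd, fun τ ↦ by simp only [Pi.mul_apply, hf, hg]; ring⟩

lemma SemiPeriodic.div {f g : ℍ → ℂ} (hf : SemiPeriodic f) (hg : SemiPeriodic g) :
    SemiPeriodic (f / g) := by
  obtain ⟨c, hc, hf⟩ := hf
  obtain ⟨d, hd, hg⟩ := hg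
  refine ⟨c / d, div_ne_zero hc hd, fun τ ↦ ?_⟩
  simp only [Pi.div_apply, hf, hg, mul_div_mul_comm]

lemma SemiPeriodic.smul {f : ℍ → ℂ} (c : ℂ) (hf : SemiPeriodic f) : SemiPeriodic (c • f) := by
  obtain ⟨d, hd, hf⟩ := hf
  refine ⟨d, hd, fun τ ↦ ?_⟩
  simp only [Pi.smul_apply, hf, smul_eq_mul]
  ring

lemma SemiPeriodic.pow {f : ℍ → ℂ} (hf : SemiPeriodic f) (n : ℕ) : SemiPeriodic (f ^ n) := by
  obtain ⟨c, hc, hf⟩ := hf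
  exact ⟨c ^ n, pow_ne_zero n hc, fun τ ↦ by simp only [Pi.pow_apply, hf, mul_pow]⟩

lemma SemiPeriodic.semiInvariant {f : ℍ → ℂ} (hf : SemiPeriodic f) (k : ℤ) :
    SemiInvariant k f T := by
  obtain ⟨c, hc, hf⟩ := hf
  refine ⟨c, hc, ?_⟩
  ext τ
  rw [slash_T_apply, hf]
  rfl

lemma semiPeriodic_etaMul (δ : ℕ) : SemiPeriodic (etaMul δ) := by
  refine ⟨exp (2 * Real.pi * I * (1 : ℝ) / 24) ^ δ, pow_ne_zero _ (exp_ne_zero _), fun τ ↦ ?_⟩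
  rw [etaMul_eq, etaMul_eq, nome_vadd_one, qRoot_vadd, mul_pow]
  ring

lemma tendsto_eulerProd_nome {δ : ℕ} (hδ : δ ≠ 0) :
    Tendsto (fun τ ↦ eulerProd (nome τ ^ δ)) atImInfty (𝓝 1) := by
  have h1 : Tendsto (fun τ ↦ nome τ ^ δ) atImInfty (𝓝 0) := by
    simpa [hδ] using tendsto_nome.pow δ
  have h2 := (differentiableAt_eulerProd (q := 0) (by simp)).continuousAt.tendsto
  rw [eulerProd_zero] at h2
  exact h2.comp h1

lemma hasLeadingExponent_etaMul {δ : ℕ} (hδ : δ ≠ 0) :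
    HasLeadingExponent (etaMul δ) (δ / 24) := by
  refine ⟨1, one_ne_zero, (tendsto_eulerProd_nome hδ).congr fun τ ↦ ?_⟩
  rw [etaMul_eq, mul_right_comm, qRoot, ← Complex.exp_nat_mul, ← Complex.exp_add]
  have : (δ : ℂ) * (2 * Real.pi * I * τ / 24) + -(2 * Real.pi * I * ((δ / 24 : ℚ) : ℂ) * τ) = 0 := by
    push_cast
    ring
  rw [this, Complex.exp_zero, one_mul]

/-- The transformation of `η` under the Fricke involution; `s` is the square root of `τ / i` that
it introduces. -/
lemma etaMul_fricke (N : ℕ) [NeZero N] (τ : ℍ) :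
    ∃ s : ℂ, s ≠ 0 ∧ s ^ 2 = -I * τ ∧ ∀ δ M : ℕ, δ * M = N →
      etaMul δ (fricke N • τ) = (√(M : ℝ) : ℝ) * s * etaMul M τ := by
  have hsq : ∀ z : ℂ, z ≠ 0 → Complex.sqrt z ^ 2 = z := fun z hz ↦ by
    rw [Complex.sqrt, ← Complex.cpow_nat_mul]
    norm_num
  have hI : Complex.sqrt I ≠ 0 := fun h ↦ by
    have := hsq I I_ne_zero
    rw [h] at this
    norm_num at this
    exact I_ne_zero this.symm
  have ht : Complex.sqrt τ ≠ 0 := fun h ↦ by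
    have := hsq τ τ.ne_zero
    rw [h] at this
    norm_num at this
    exact τ.ne_zero this.symm
  refine ⟨(Complex.sqrt I)⁻¹ * Complex.sqrt τ, mul_ne_zero (inv_ne_zero hI) ht, ?_, ?_⟩
  · rw [mul_pow, inv_pow, hsq _ I_ne_zero, hsq _ τ.ne_zero, inv_I]
  · intro δ M h
    have hM : M ≠ 0 := by
      rintro rfl
      exact NeZero.ne N (by simpa using h.symm)
    have hδ : δ ≠ 0 := by
      rintro rfl
      exact NeZero.ne N (by simpa using h.symm)
    have hM' : (M : ℂ) ≠ 0 := by exact_mod_cast hM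
    have hδ' : (δ : ℂ) ≠ 0 := by exact_mod_cast hδ
    have hτ := τ.ne_zero
    have h1 := ModularForm.eta_comp_eq_csqrt_I_inv (natCast_mul_mem hM τ)
    have h2 : (δ : ℂ) * ((fricke N • τ : ℍ) : ℂ) = -1 / ((M : ℂ) * τ) := by
      rw [coe_fricke_smul, ← h]
      push_cast
      field_simp
    rw [etaMul, h2]
    have h3 : Complex.sqrt ((M : ℂ) * τ) = (√(M : ℝ) : ℝ) * Complex.sqrt τ := by
      rw [Complex.sqrt, Complex.sqrt]
      have hM0 : (0 : ℝ) < M := by exact_mod_cast Nat.pos_of_ne_zero hM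
      rw [Real.sqrt_eq_rpow, Complex.ofReal_cpow hM0.le, ← Complex.ofReal_natCast,
        Complex.cpow_def_of_ne_zero (mul_ne_zero (by exact_mod_cast hM) hτ),
        Complex.cpow_def_of_ne_zero (by exact_mod_cast hM), Complex.cpow_def_of_ne_zero hτ,
        Complex.log_ofReal_mul hM0 hτ, ← Complex.exp_add, Complex.ofReal_log hM0.le]
      congr 1
      push_cast
      ring
    simp only [Function.comp_apply, Pi.smul_apply, Pi.mul_apply, smul_eq_mul] at h1
    rw [h1, h3, etaMul]
    ring

/-! ### Criteria for modular forms and orders of vanishing -/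

/-- A nonzero function determines the factors of its semi-invariance, which are therefore
multiplicative. -/
lemma exists_multiplier {Γ : Subgroup SL(2, ℤ)} {k : ℤ} {f : ℍ → ℂ} (hf : f ≠ 0)
    (h : ∀ γ ∈ Γ, SemiInvariant k f γ) :
    ∃ χ : Γ →* ℂˣ, ∀ γ : Γ, f ∣[k] (γ : SL(2, ℤ)) = ((χ γ : ℂˣ) : ℂ) • f := by
  choose c hc hcf using fun γ : Γ ↦ h γ γ.2
  have huniq : ∀ a b : ℂ, a • f = b • f → a = b := fun a b hab ↦ smul_left_injective ℂ hf hab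
  refine ⟨MonoidHom.mk' (fun γ ↦ Units.mk0 (c γ) (hc γ)) fun γ δ ↦ ?_, fun γ ↦ hcf γ⟩
  ext
  refine huniq _ _ ?_
  simp only [Units.val_mk0, Units.val_mul]
  rw [← hcf, Subgroup.coe_mul, SlashAction.slash_mul, hcf, ModularForm.SL_smul_slash, hcf,
    smul_smul]

/-- For prime `N` the cusps of `Γ₀(N)` are `i∞` and `0`, so that boundedness is needed for `f` and its
Fricke transform only. -/
theorem isModularForm_of_prime {N : ℕ} [NeZero N] (hN : N.Prime) {k : ℤ} {f : ℍ → ℂ}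
    (hf : f ≠ 0) (hol : MDifferentiable 𝓘(ℂ) 𝓘(ℂ) f)
    (hinv : ∀ γ ∈ Gamma0 N, SemiInvariant k f γ)
    (hb : IsBoundedAtImInfty f) (hbW : IsBoundedAtImInfty (f ∣[k] fricke N)) :
    IsModularForm (Gamma0 N) k f := by
  refine ⟨hol, exists_multiplier hf hinv, fun g ↦ ?_⟩
  rcases mem_Gamma0_or_isCoprime hN g with hg | hg
  · exact isBoundedAtImInfty_slash_of_mem hinv hb hg
  · exact isBoundedAtImInfty_slash_of_isCoprime hinv hbW hg

lemma mod_four_cases (g : SL(2, ℤ)) :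
    g ∈ Gamma0 4 ∨ IsCoprime (g 1 0) ((4 : ℕ) : ℤ) ∨ g 1 0 % 4 = 2 := by
  rw [mem_Gamma0_four_iff, isCoprime_four_iff]
  omega

/-- In level `4` the third cusp `1 / 2 = (1 0; 2 1) ∞` has to be considered in addition. -/
theorem isModularForm_of_four {k : ℤ} {f : ℍ → ℂ}
    (hf : f ≠ 0) (hol : MDifferentiable 𝓘(ℂ) 𝓘(ℂ) f)
    (hinv : ∀ γ ∈ Gamma0 4, SemiInvariant k f γ)
    (hb : IsBoundedAtImInfty f) (hbW : IsBoundedAtImInfty (f ∣[k] fricke 4))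
    (hbV : IsBoundedAtImInfty (f ∣[k] lowerTri 2)) :
    IsModularForm (Gamma0 4) k f := by
  refine ⟨hol, exists_multiplier hf hinv, fun g ↦ ?_⟩
  rcases mod_four_cases g with hg | hg | hg
  · exact isBoundedAtImInfty_slash_of_mem hinv hb hg
  · exact isBoundedAtImInfty_slash_of_isCoprime hinv hbW hg
  · exact isBoundedAtImInfty_slash_of_mod_four hinv hbV hg

lemma analyticAt_comp_ofComplex {f : ℍ → ℂ} (hf : MDifferentiable 𝓘(ℂ) 𝓘(ℂ) f) {z : ℂ}
    (hz : 0 < z.im) : AnalyticAt ℂ (f ∘ ofComplex) z :=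
  (UpperHalfPlane.mdifferentiable_iff.mp hf).analyticAt
    (isOpen_upperHalfPlaneSet.mem_nhds hz)

lemma hasOrd_pt_zero {Γ : Subgroup SL(2, ℤ)} {k : ℤ} {f : ℍ → ℂ}
    (hf : MDifferentiable 𝓘(ℂ) 𝓘(ℂ) f) {τ : ℍ} (hτ : f τ ≠ 0) : HasOrd Γ k f (.pt τ) 0 := by
  refine ⟨0, ?_, by simp⟩
  rw [Nat.cast_zero, (analyticAt_comp_ofComplex hf τ.im_pos).analyticOrderAt_eq_zero]
  simpa using hτ

section hasOrd

variable {N : ℕ} {k : ℤ} {f : ℍ → ℂ} {x : ℚ} {s : HStar}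

lemma hasOrd_of_equivalent_infty (hinv : ∀ γ ∈ Gamma0 N, SemiInvariant k f γ)
    (hx : HasLeadingExponent f x)
    (hs : HStar.Equivalent (Gamma0 N) (.cusp OnePoint.infty) s) : HasOrd (Gamma0 N) k f s x := by
  cases s with
  | pt τ => exact absurd hs (not_equivalent_cusp_pt _ _)
  | cusp c =>
    rintro g rfl
    exact hasLeadingExponent_slash_of_mem hinv hx (equivalent_infty_iff.mp hs)

lemma hasOrd_of_equivalent_zero [NeZero N] (hinv : ∀ γ ∈ Gamma0 N, SemiInvariant k f γ)
    (hx : HasLeadingExponent (f ∣[k] fricke N) x)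
    (hs : HStar.Equivalent (Gamma0 N) (.cusp (0 : ℚ)) s) : HasOrd (Gamma0 N) k f s x := by
  cases s with
  | pt τ => exact absurd hs (not_equivalent_cusp_pt _ _)
  | cusp c =>
    rintro g rfl
    exact hasLeadingExponent_slash_of_isCoprime hinv hx (equivalent_zero_iff.mp hs)

lemma hasOrd_of_equivalent_half (hinv : ∀ γ ∈ Gamma0 4, SemiInvariant k f γ)
    (hx : HasLeadingExponent (f ∣[k] lowerTri 2) x)
    (hs : HStar.Equivalent (Gamma0 4) (.cusp (1 / 2 : ℚ)) s) : HasOrd (Gamma0 4) k f s x := by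
  cases s with
  | pt τ => exact absurd hs (not_equivalent_cusp_pt _ _)
  | cusp c =>
    rintro g rfl
    exact hasLeadingExponent_slash_of_mod_four hinv hx (equivalent_half_iff.mp hs)

end hasOrd

lemma cusp_cases_prime {N : ℕ} (hN : N.Prime) (c : OnePoint ℚ) :
    HStar.Equivalent (Gamma0 N) (.cusp OnePoint.infty) (.cusp c) ∨
      HStar.Equivalent (Gamma0 N) (.cusp (0 : ℚ)) (.cusp c) := by
  obtain ⟨g, rfl⟩ := exists_eq_smul_infty c
  rw [equivalent_infty_iff, equivalent_zero_iff]
  exact mem_Gamma0_or_isCoprime hN g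

lemma cusp_cases_four (c : OnePoint ℚ) :
    HStar.Equivalent (Gamma0 4) (.cusp OnePoint.infty) (.cusp c) ∨
      HStar.Equivalent (Gamma0 4) (.cusp (0 : ℚ)) (.cusp c) ∨
      HStar.Equivalent (Gamma0 4) (.cusp (1 / 2 : ℚ)) (.cusp c) := by
  obtain ⟨g, rfl⟩ := exists_eq_smul_infty c
  rw [equivalent_infty_iff, equivalent_zero_iff, equivalent_half_iff]
  exact mod_four_cases g

/-! ### Pairs of forms interchanged by the Fricke involution -/

/-- Two functions without zeros on `ℍ`, of exponents `0` and `x` at `i∞`, which are interchanged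
in weight `1` by the Fricke involution `W_N`, with multiplier `-i √N τ`. -/
structure FrickePair (N : ℕ) [NeZero N] (B C : ℍ → ℂ) (x : ℚ) : Prop where
  holo_left : MDifferentiable 𝓘(ℂ) 𝓘(ℂ) B
  holo_right : MDifferentiable 𝓘(ℂ) 𝓘(ℂ) C
  left_ne_zero : ∀ τ, B τ ≠ 0
  right_ne_zero : ∀ τ, C τ ≠ 0
  left_fricke : ∀ τ, B (fricke N • τ) = -I * (√(N : ℝ) : ℝ) * τ * C τ
  right_fricke : ∀ τ, C (fricke N • τ) = -I * (√(N : ℝ) : ℝ) * τ * B τ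
  left_periodic : SemiPeriodic B
  right_periodic : SemiPeriodic C
  left_exponent : HasLeadingExponent B 0
  right_exponent : HasLeadingExponent C x

lemma ofReal_sqrt_natCast_sq (N : ℕ) : (((√(N : ℝ) : ℝ) : ℂ)) ^ 2 = N := by
  rw [← Complex.ofReal_pow, Real.sq_sqrt (Nat.cast_nonneg N), Complex.ofReal_natCast]

lemma slash_fricke_of_apply {N : ℕ} [NeZero N] {f g : ℍ → ℂ}
    (h : ∀ τ, f (fricke N • τ) = -I * (√(N : ℝ) : ℝ) * τ * g τ) :
    f ∣[(1 : ℤ)] fricke N = (-I * (√(N : ℝ) : ℝ) / N) • g := by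
  ext τ
  have h1 : (N : ℂ) ≠ 0 := NeZero.ne _
  have h2 := τ.ne_zero
  rw [slash_fricke_apply, h, sub_self, zpow_zero, zpow_neg_one]
  simp only [Pi.smul_apply, smul_eq_mul]
  field_simp

lemma sq_slash_fricke_of_apply {N : ℕ} [NeZero N] {f g : ℍ → ℂ}
    (h : ∀ τ, f (fricke N • τ) = -I * (√(N : ℝ) : ℝ) * τ * g τ) :
    (f ^ 2) ∣[(2 : ℤ)] fricke N = -g ^ 2 := by
  ext τ
  have h1 : (N : ℂ) ≠ 0 := NeZero.ne _
  have h2 := τ.ne_zero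
  rw [slash_fricke_apply, Pi.pow_apply, h]
  simp only [Pi.neg_apply, Pi.pow_apply]
  norm_num
  rw [mul_pow, mul_pow, mul_pow, ofReal_sqrt_natCast_sq, I_sq, mul_pow, mul_inv]
  field_simp

lemma fricke_multiplier_ne_zero (N : ℕ) [NeZero N] : (-I * (√(N : ℝ) : ℝ) / N : ℂ) ≠ 0 := by
  have h1 : (N : ℂ) ≠ 0 := NeZero.ne _
  have h2 : ((√(N : ℝ) : ℝ) : ℂ) ≠ 0 := fun h ↦ by
    have := ofReal_sqrt_natCast_sq N
    rw [h] at this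
    norm_num at this
    exact h1 this.symm
  exact div_ne_zero (mul_ne_zero (neg_ne_zero.mpr I_ne_zero) h2) h1

namespace FrickePair

variable {N : ℕ} [NeZero N] {B C : ℍ → ℂ} {x : ℚ}

lemma slash_left (h : FrickePair N B C x) :
    B ∣[(1 : ℤ)] fricke N = (-I * (√(N : ℝ) : ℝ) / N) • C :=
  slash_fricke_of_apply h.left_fricke

lemma slash_right (h : FrickePair N B C x) :
    C ∣[(1 : ℤ)] fricke N = (-I * (√(N : ℝ) : ℝ) / N) • B :=
  slash_fricke_of_apply h.right_fricke

lemma semiInvariant_left (h : FrickePair N B C x) (h2 : 2 ≤ N) (h4 : N ≤ 4) :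
    ∀ γ ∈ Gamma0 N, SemiInvariant 1 B γ := fun γ hγ ↦ by
  refine semiInvariant_of_mem_Gamma0 h2 h4 (h.left_periodic.semiInvariant 1) ?_ hγ
  rw [h.slash_left]
  exact (h.right_periodic.smul _).semiInvariant 1

lemma semiInvariant_right (h : FrickePair N B C x) (h2 : 2 ≤ N) (h4 : N ≤ 4) :
    ∀ γ ∈ Gamma0 N, SemiInvariant 1 C γ := fun γ hγ ↦ by
  refine semiInvariant_of_mem_Gamma0 h2 h4 (h.right_periodic.semiInvariant 1) ?_ hγ
  rw [h.slash_right]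
  exact (h.left_periodic.smul _).semiInvariant 1

lemma slash_left_exponent (h : FrickePair N B C x) :
    HasLeadingExponent (B ∣[(1 : ℤ)] fricke N) x := by
  rw [h.slash_left]
  exact h.right_exponent.smul (fricke_multiplier_ne_zero N)

lemma slash_right_exponent (h : FrickePair N B C x) :
    HasLeadingExponent (C ∣[(1 : ℤ)] fricke N) 0 := by
  rw [h.slash_right]
  exact h.left_exponent.smul (fricke_multiplier_ne_zero N)

lemma left_ne (h : FrickePair N B C x) : B ≠ 0 :=
  fun hB ↦ h.left_ne_zero .I (by rw [hB]; rfl)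

lemma right_ne (h : FrickePair N B C x) : C ≠ 0 :=
  fun hC ↦ h.right_ne_zero .I (by rw [hC]; rfl)

theorem isModularForm_left (h : FrickePair N B C x) (hN : N.Prime) (h4 : N ≤ 4) (hx : 0 ≤ x) :
    IsModularForm (Gamma0 N) 1 B :=
  isModularForm_of_prime hN h.left_ne h.holo_left (h.semiInvariant_left hN.two_le h4)
    (h.left_exponent.isBoundedAtImInfty le_rfl) (h.slash_left_exponent.isBoundedAtImInfty hx)

theorem isModularForm_right (h : FrickePair N B C x) (hN : N.Prime) (h4 : N ≤ 4) (hx : 0 ≤ x) :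
    IsModularForm (Gamma0 N) 1 C :=
  isModularForm_of_prime hN h.right_ne h.holo_right (h.semiInvariant_right hN.two_le h4)
    (h.right_exponent.isBoundedAtImInfty hx) (h.slash_right_exponent.isBoundedAtImInfty le_rfl)

theorem hasOrd_left (h : FrickePair N B C x) (hN : N.Prime) (h4 : N ≤ 4) (s : HStar) :
    (HStar.Equivalent (Gamma0 N) (.cusp (0 : ℚ)) s → HasOrd (Gamma0 N) 1 B s x) ∧
    (¬ HStar.Equivalent (Gamma0 N) (.cusp (0 : ℚ)) s → HasOrd (Gamma0 N) 1 B s 0) := by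
  have hinv := h.semiInvariant_left hN.two_le h4
  refine ⟨hasOrd_of_equivalent_zero hinv h.slash_left_exponent, fun hs ↦ ?_⟩
  cases s with
  | pt τ => exact hasOrd_pt_zero h.holo_left (h.left_ne_zero τ)
  | cusp c =>
    exact hasOrd_of_equivalent_infty hinv h.left_exponent
      ((cusp_cases_prime hN c).resolve_right hs)

theorem hasOrd_right (h : FrickePair N B C x) (hN : N.Prime) (h4 : N ≤ 4) (s : HStar) :
    (HStar.Equivalent (Gamma0 N) (.cusp OnePoint.infty) s → HasOrd (Gamma0 N) 1 C s x) ∧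
    (¬ HStar.Equivalent (Gamma0 N) (.cusp OnePoint.infty) s → HasOrd (Gamma0 N) 1 C s 0) := by
  have hinv := h.semiInvariant_right hN.two_le h4
  refine ⟨hasOrd_of_equivalent_infty hinv h.right_exponent, fun hs ↦ ?_⟩
  cases s with
  | pt τ => exact hasOrd_pt_zero h.holo_right (h.right_ne_zero τ)
  | cusp c =>
    exact hasOrd_of_equivalent_zero hinv h.slash_right_exponent
      ((cusp_cases_prime hN c).resolve_left hs)

end FrickePair

/-! ### The forms `ℬ` and `𝒞` -/

lemma mdifferentiable_div {f g : ℍ → ℂ} (hf : MDifferentiable 𝓘(ℂ) 𝓘(ℂ) f)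
    (hg : MDifferentiable 𝓘(ℂ) 𝓘(ℂ) g) (h0 : ∀ τ, g τ ≠ 0) :
    MDifferentiable 𝓘(ℂ) 𝓘(ℂ) (f / g) := by
  rw [UpperHalfPlane.mdifferentiable_iff] at hf hg ⊢
  exact hf.div hg fun z _ ↦ h0 _

lemma mdifferentiable_pow {f : ℍ → ℂ} (hf : MDifferentiable 𝓘(ℂ) 𝓘(ℂ) f) (n : ℕ) :
    MDifferentiable 𝓘(ℂ) 𝓘(ℂ) (f ^ n) := by
  rw [UpperHalfPlane.mdifferentiable_iff] at hf ⊢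
  exact hf.pow n

lemma two_cpow_three_halves_sq : ((2 : ℂ) ^ (3 / 2 : ℂ)) ^ 2 = 8 := by
  rw [← Complex.cpow_nat_mul]
  norm_num

lemma two_cpow_three_halves : (2 : ℂ) ^ (3 / 2 : ℂ) = 2 * (√2 : ℝ) := by
  rw [show (3 / 2 : ℂ) = 1 + 1 / 2 by norm_num, Complex.cpow_add _ _ two_ne_zero,
    Complex.cpow_one, Real.sqrt_eq_rpow, Complex.ofReal_cpow zero_le_two]
  norm_num

theorem frickePair_two : FrickePair 2 B4 C4 (1 / 4) := by
  have h1 := fun τ ↦ etaMul_ne_zero one_ne_zero τ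
  have h2 := fun τ ↦ etaMul_ne_zero two_ne_zero τ
  have hc : (2 : ℂ) ^ (3 / 2 : ℂ) ≠ 0 := by simp
  have hB : B4 = etaMul 1 ^ 4 / etaMul 2 ^ 2 := rfl
  have hC : C4 = ((2 : ℂ) ^ (3 / 2 : ℂ)) • (etaMul 2 ^ 4 / etaMul 1 ^ 2) := by
    ext τ
    simp [C4, mul_div_assoc]
  have hs2 : (((√2 : ℝ) : ℂ)) ^ 2 = 2 := by simpa using ofReal_sqrt_natCast_sq 2
  have e1 := hasLeadingExponent_etaMul one_ne_zero
  have e2 := hasLeadingExponent_etaMul two_ne_zero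
  refine ⟨?_, ?_, fun τ ↦ ?_, fun τ ↦ ?_, fun τ ↦ ?_, fun τ ↦ ?_, ?_, ?_, ?_, ?_⟩
  · exact mdifferentiable_div (mdifferentiable_pow (mdifferentiable_etaMul one_ne_zero) 4)
      (mdifferentiable_pow (mdifferentiable_etaMul two_ne_zero) 2) fun τ ↦ pow_ne_zero 2 (h2 τ)
  · rw [hC]
    exact (mdifferentiable_div (mdifferentiable_pow (mdifferentiable_etaMul two_ne_zero) 4)
      (mdifferentiable_pow (mdifferentiable_etaMul one_ne_zero) 2)
      fun τ ↦ pow_ne_zero 2 (h1 τ)).const_smul _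
  · exact div_ne_zero (pow_ne_zero _ (h1 τ)) (pow_ne_zero _ (h2 τ))
  · exact div_ne_zero (mul_ne_zero hc (pow_ne_zero _ (h2 τ))) (pow_ne_zero _ (h1 τ))
  · obtain ⟨s, hs, hss, h⟩ := etaMul_fricke 2 τ
    have := h1 τ
    have := h2 τ
    simp only [B4, C4, h 1 2 rfl, h 2 1 rfl, two_cpow_three_halves]
    simp only [Nat.cast_one, Real.sqrt_one, Complex.ofReal_one, one_mul, Nat.cast_ofNat]
    rw [mul_assoc (-I), mul_comm _ (τ : ℂ), ← mul_assoc (-I), ← hss]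
    field_simp
    rw [hs2]
  · obtain ⟨s, hs, hss, h⟩ := etaMul_fricke 2 τ
    have := h1 τ
    have := h2 τ
    have hs0 : (((√2 : ℝ) : ℂ)) ≠ 0 := fun h0 ↦ by simp [h0] at hs2
    simp only [B4, C4, h 1 2 rfl, h 2 1 rfl, two_cpow_three_halves]
    simp only [Nat.cast_one, Real.sqrt_one, Complex.ofReal_one, one_mul, Nat.cast_ofNat]
    rw [mul_assoc (-I), mul_comm _ (τ : ℂ), ← mul_assoc (-I), ← hss]
    field_simp
    rw [hs2]
  · exact ((semiPeriodic_etaMul 1).pow 4).div ((semiPeriodic_etaMul 2).pow 2)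
  · rw [hC]
    exact (((semiPeriodic_etaMul 2).pow 4).div ((semiPeriodic_etaMul 1).pow 2)).smul _
  · rw [hB]
    convert (e1.pow 4).div (e2.pow 2) using 1
    norm_num
  · rw [hC]
    convert ((e2.pow 4).div (e1.pow 2)).smul hc using 1
    norm_num

theorem frickePair_three : FrickePair 3 B3 C3 (1 / 3) := by
  have h1 := fun τ ↦ etaMul_ne_zero one_ne_zero τ
  have h3 := fun τ ↦ etaMul_ne_zero three_ne_zero τ
  have hB : B3 = etaMul 1 ^ 3 / etaMul 3 := rfl
  have hC : C3 = (3 : ℂ) • (etaMul 3 ^ 3 / etaMul 1) := by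
    ext τ
    simp [C3, mul_div_assoc]
  have hs3 : (((√3 : ℝ) : ℂ)) ^ 2 = 3 := by simpa using ofReal_sqrt_natCast_sq 3
  have e1 := hasLeadingExponent_etaMul one_ne_zero
  have e3 := hasLeadingExponent_etaMul three_ne_zero
  refine ⟨?_, ?_, fun τ ↦ ?_, fun τ ↦ ?_, fun τ ↦ ?_, fun τ ↦ ?_, ?_, ?_, ?_, ?_⟩
  · exact mdifferentiable_div (mdifferentiable_pow (mdifferentiable_etaMul one_ne_zero) 3)
      (mdifferentiable_etaMul three_ne_zero) h3
  · rw [hC]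
    exact (mdifferentiable_div (mdifferentiable_pow (mdifferentiable_etaMul three_ne_zero) 3)
      (mdifferentiable_etaMul one_ne_zero) h1).const_smul _
  · exact div_ne_zero (pow_ne_zero _ (h1 τ)) (h3 τ)
  · exact div_ne_zero (mul_ne_zero three_ne_zero (pow_ne_zero _ (h3 τ))) (h1 τ)
  · obtain ⟨s, hs, hss, h⟩ := etaMul_fricke 3 τ
    have := h1 τ
    have := h3 τ
    simp only [B3, C3, h 1 3 rfl, h 3 1 rfl]
    simp only [Nat.cast_one, Real.sqrt_one, Complex.ofReal_one, one_mul, Nat.cast_ofNat]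
    rw [mul_assoc (-I), mul_comm _ (τ : ℂ), ← mul_assoc (-I), ← hss]
    field_simp
    rw [hs3]
  · obtain ⟨s, hs, hss, h⟩ := etaMul_fricke 3 τ
    have := h1 τ
    have := h3 τ
    have hs0 : (((√3 : ℝ) : ℂ)) ≠ 0 := fun h0 ↦ by simp [h0] at hs3
    simp only [B3, C3, h 1 3 rfl, h 3 1 rfl]
    simp only [Nat.cast_one, Real.sqrt_one, Complex.ofReal_one, one_mul, Nat.cast_ofNat]
    rw [mul_assoc (-I), mul_comm _ (τ : ℂ), ← mul_assoc (-I), ← hss]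
    field_simp
    rw [hs3]
  · exact ((semiPeriodic_etaMul 1).pow 3).div (semiPeriodic_etaMul 3)
  · rw [hC]
    exact (((semiPeriodic_etaMul 3).pow 3).div (semiPeriodic_etaMul 1)).smul _
  · rw [hB]
    convert (e1.pow 3).div e3 using 1
    norm_num
  · rw [hC]
    convert ((e3.pow 3).div e1).smul three_ne_zero using 1
    norm_num

theorem frickePair_four : FrickePair 4 B2 C2 (1 / 2) := by
  have h1 := fun τ ↦ etaMul_ne_zero one_ne_zero τ
  have h2 := fun τ ↦ etaMul_ne_zero two_ne_zero τ
  have h4 := fun τ ↦ etaMul_ne_zero four_ne_zero τ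
  have hB : B2 = etaMul 1 ^ 4 / etaMul 2 ^ 2 := rfl
  have hC : C2 = (2 ^ 2 : ℂ) • (etaMul 4 ^ 4 / etaMul 2 ^ 2) := by
    ext τ
    simp [C2, mul_div_assoc]
  have hs2 : (((√2 : ℝ) : ℂ)) ^ 2 = 2 := by simpa using ofReal_sqrt_natCast_sq 2
  have hs4 : √(4 : ℝ) = 2 := by
    rw [show (4 : ℝ) = 2 ^ 2 by norm_num, Real.sqrt_sq zero_le_two]
  have hc : (2 ^ 2 : ℂ) ≠ 0 := by norm_num
  have e1 := hasLeadingExponent_etaMul one_ne_zero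
  have e2 := hasLeadingExponent_etaMul two_ne_zero
  have e4 := hasLeadingExponent_etaMul four_ne_zero
  have hs0 : (((√2 : ℝ) : ℂ)) ≠ 0 := fun h0 ↦ by simp [h0] at hs2
  refine ⟨?_, ?_, fun τ ↦ ?_, fun τ ↦ ?_, fun τ ↦ ?_, fun τ ↦ ?_, ?_, ?_, ?_, ?_⟩
  · exact mdifferentiable_div (mdifferentiable_pow (mdifferentiable_etaMul one_ne_zero) 4)
      (mdifferentiable_pow (mdifferentiable_etaMul two_ne_zero) 2) fun τ ↦ pow_ne_zero 2 (h2 τ)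
  · rw [hC]
    exact (mdifferentiable_div (mdifferentiable_pow (mdifferentiable_etaMul four_ne_zero) 4)
      (mdifferentiable_pow (mdifferentiable_etaMul two_ne_zero) 2)
      fun τ ↦ pow_ne_zero 2 (h2 τ)).const_smul _
  · exact div_ne_zero (pow_ne_zero _ (h1 τ)) (pow_ne_zero _ (h2 τ))
  · exact div_ne_zero (mul_ne_zero hc (pow_ne_zero _ (h4 τ))) (pow_ne_zero _ (h2 τ))
  · obtain ⟨s, hs, hss, h⟩ := etaMul_fricke 4 τ
    have := h2 τ
    simp only [B2, C2, h 1 4 rfl, h 2 2 rfl]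
    simp only [Nat.cast_ofNat, hs4]
    rw [mul_assoc (-I), mul_comm _ (τ : ℂ), ← mul_assoc (-I), ← hss]
    field_simp
    rw [hs2]
    push_cast
    ring
  · obtain ⟨s, hs, hss, h⟩ := etaMul_fricke 4 τ
    have := h2 τ
    simp only [B2, C2, h 4 1 rfl, h 2 2 rfl]
    simp only [Nat.cast_ofNat, Nat.cast_one, Real.sqrt_one, Complex.ofReal_one, one_mul, hs4]
    rw [mul_assoc (-I), mul_comm _ (τ : ℂ), ← mul_assoc (-I), ← hss]
    field_simp
    rw [hs2]
    push_cast
    ring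
  · exact ((semiPeriodic_etaMul 1).pow 4).div ((semiPeriodic_etaMul 2).pow 2)
  · rw [hC]
    exact (((semiPeriodic_etaMul 4).pow 4).div ((semiPeriodic_etaMul 2).pow 2)).smul _
  · rw [hB]
    convert (e1.pow 4).div (e2.pow 2) using 1
    norm_num
  · rw [hC]
    convert ((e4.pow 4).div (e2.pow 2)).smul hc using 1
    norm_num

/-! ### The eta quotient representing `𝒜₂` -/

/-- The eta quotient `[2]¹⁰ / ([1]⁴ [4]⁴)`. -/
def etaQuot (τ : ℍ) : ℂ := etaMul 2 τ ^ 10 / (etaMul 1 τ ^ 4 * etaMul 4 τ ^ 4)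

lemma etaQuot_ne_zero (τ : ℍ) : etaQuot τ ≠ 0 :=
  div_ne_zero (pow_ne_zero _ (etaMul_ne_zero two_ne_zero τ))
    (mul_ne_zero (pow_ne_zero _ (etaMul_ne_zero one_ne_zero τ))
      (pow_ne_zero _ (etaMul_ne_zero four_ne_zero τ)))

lemma mdifferentiable_etaQuot : MDifferentiable 𝓘(ℂ) 𝓘(ℂ) etaQuot := by
  have h : etaQuot = etaMul 2 ^ 10 / (etaMul 1 ^ 4) / etaMul 4 ^ 4 := by
    ext τ
    simp only [etaQuot, Pi.div_apply, Pi.pow_apply, div_div]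
  rw [h]
  exact mdifferentiable_div (mdifferentiable_div
    (mdifferentiable_pow (mdifferentiable_etaMul two_ne_zero) 10)
    (mdifferentiable_pow (mdifferentiable_etaMul one_ne_zero) 4)
    fun τ ↦ pow_ne_zero _ (etaMul_ne_zero one_ne_zero τ))
    (mdifferentiable_pow (mdifferentiable_etaMul four_ne_zero) 4)
    fun τ ↦ pow_ne_zero _ (etaMul_ne_zero four_ne_zero τ)

lemma eulerProd_nome_ne_zero {δ : ℕ} (hδ : δ ≠ 0) (τ : ℍ) : eulerProd (nome τ ^ δ) ≠ 0 := by
  have := etaMul_ne_zero hδ τ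
  rw [etaMul_eq] at this
  exact right_ne_zero_of_mul this

lemma B2_eq (τ : ℍ) : B2 τ = eulerProd (nome τ) ^ 4 / eulerProd (nome τ ^ 2) ^ 2 := by
  have h2 := eulerProd_nome_ne_zero two_ne_zero τ
  have h0 := qRoot_ne_zero τ
  rw [B2, etaMul_eq, etaMul_eq]
  field_simp

lemma C2_eq (τ : ℍ) :
    C2 τ = 4 * qRoot τ ^ 12 * eulerProd (nome τ ^ 4) ^ 4 / eulerProd (nome τ ^ 2) ^ 2 := by
  have h2 := eulerProd_nome_ne_zero two_ne_zero τ
  have h0 := qRoot_ne_zero τ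
  rw [C2, etaMul_eq, etaMul_eq]
  field_simp
  ring

/-- The product identity behind `[2]¹⁰ / ([1]⁴ [4]⁴)` being `ℬ₂` with `q` replaced by `-q`. -/
lemma etaQuot_eq (τ : ℍ) :
    etaQuot τ = eulerProd (-nome τ) ^ 4 / eulerProd (nome τ ^ 2) ^ 2 := by
  have h1 := eulerProd_nome_ne_zero one_ne_zero τ
  have h2 := eulerProd_nome_ne_zero two_ne_zero τ
  have h4 := eulerProd_nome_ne_zero four_ne_zero τ
  have h0 := qRoot_ne_zero τ
  rw [pow_one] at h1
  have h := eulerProd_mul_eulerProd_neg (norm_nome_lt_one τ)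
  rw [etaQuot, etaMul_eq, etaMul_eq, etaMul_eq, pow_one, pow_one]
  have h5 : (qRoot τ ^ 2 * eulerProd (nome τ ^ 2)) ^ 10 =
      qRoot τ ^ 20 * (eulerProd (nome τ ^ 2) ^ 3) ^ 4 / eulerProd (nome τ ^ 2) ^ 2 := by
    field_simp
  rw [h5, ← h]
  field_simp

lemma B2_vadd_neg_half (τ : ℍ) : B2 ((-(1 / 2) : ℝ) +ᵥ τ) = etaQuot τ := by
  rw [B2_eq, etaQuot_eq, nome_vadd_neg_half, neg_sq]

lemma etaQuot_vadd_neg_half (τ : ℍ) : etaQuot ((-(1 / 2) : ℝ) +ᵥ τ) = B2 τ := by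
  rw [B2_eq, etaQuot_eq, nome_vadd_neg_half, neg_sq, neg_neg]

lemma C2_vadd_neg_half : ∃ c : ℂ, c ≠ 0 ∧ ∀ τ, C2 ((-(1 / 2) : ℝ) +ᵥ τ) = c * C2 τ := by
  refine ⟨_, pow_ne_zero 12 (exp_ne_zero (2 * Real.pi * I * (-(1 / 2) : ℝ) / 24)), fun τ ↦ ?_⟩
  rw [C2_eq, C2_eq, nome_vadd_neg_half, qRoot_vadd, neg_sq, Even.neg_pow ⟨2, rfl⟩]
  ring

lemma etaQuot_vadd_one (τ : ℍ) : etaQuot ((1 : ℝ) +ᵥ τ) = etaQuot τ := by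
  rw [etaQuot_eq, etaQuot_eq, nome_vadd_one]

lemma sqrt_four : √(((4 : ℕ) : ℝ)) = 2 := by
  rw [show ((4 : ℕ) : ℝ) = 2 ^ 2 by norm_num, Real.sqrt_sq zero_le_two]

lemma etaQuot_fricke (τ : ℍ) :
    etaQuot (fricke 4 • τ) = -I * (√((4 : ℕ) : ℝ) : ℝ) * τ * etaQuot τ := by
  have hs2 : (((√2 : ℝ) : ℂ)) ^ 2 = 2 := by simpa using ofReal_sqrt_natCast_sq 2
  obtain ⟨s, hs, hss, h⟩ := etaMul_fricke 4 τ
  have := etaMul_ne_zero one_ne_zero τ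
  have := etaMul_ne_zero two_ne_zero τ
  have := etaMul_ne_zero four_ne_zero τ
  simp only [etaQuot, h 4 1 rfl, h 2 2 rfl, h 1 4 rfl, sqrt_four]
  simp only [Nat.cast_ofNat, Nat.cast_one, Real.sqrt_one, Complex.ofReal_one, one_mul]
  rw [mul_assoc (-I), mul_comm _ (τ : ℂ), ← mul_assoc (-I), ← hss]
  field_simp
  rw [show ((√2 : ℝ) : ℂ) ^ 10 = (((√2 : ℝ) : ℂ) ^ 2) ^ 5 by ring, hs2]
  push_cast
  ring

/-- The matrix `(1 0; 2 1)` is the Fricke conjugate of `τ ↦ τ - 1 / 2` in level `4`. -/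
lemma lowerTri_two_smul (τ : ℍ) :
    lowerTri 2 • τ = fricke 4 • ((-(1 / 2) : ℝ) +ᵥ (fricke 4 • τ)) := by
  ext
  have h0 := τ.ne_zero
  have hd : (2 : ℂ) * τ + 1 ≠ 0 := by
    have := denom_ne_zero (lowerTri 2) τ
    rw [ModularGroup.denom_apply, coe_lowerTri] at this
    simpa using this
  rw [coe_fricke_smul, coe_vadd, coe_fricke_smul, UpperHalfPlane.specialLinearGroup_apply]
  simp only [coe_lowerTri]
  norm_num
  have hz : -(1 / 2 : ℂ) + -1 / (4 * τ) = -(2 * τ + 1) / (4 * τ) := by field_simp; ring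
  rw [hz]
  have hd2 : -((2 : ℂ) * τ + 1) ≠ 0 := neg_ne_zero.mpr hd
  field_simp

/-- The expansion of `f` at the cusp `1 / 2` is obtained by a Fricke involution, the translation
by `-1 / 2` and another Fricke involution. -/
lemma slash_lowerTri_two {f g h : ℍ → ℂ} {c : ℂ}
    (h1 : ∀ τ, f (fricke 4 • τ) = -I * (√((4 : ℕ) : ℝ) : ℝ) * τ * g τ)
    (h2 : ∀ τ, g ((-(1 / 2) : ℝ) +ᵥ (fricke 4 • τ)) =
      c * (-I * (√((4 : ℕ) : ℝ) : ℝ) * τ * h τ)) :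
    f ∣[(1 : ℤ)] lowerTri 2 = c • h := by
  ext τ
  have h0 := τ.ne_zero
  have hd : (2 : ℂ) * τ + 1 ≠ 0 := by
    have := denom_ne_zero (lowerTri 2) τ
    rw [ModularGroup.denom_apply, coe_lowerTri] at this
    simpa using this
  rw [ModularForm.SL_slash_apply, ModularGroup.denom_apply, lowerTri_two_smul, h1, h2, coe_vadd,
    coe_fricke_smul, coe_lowerTri, sqrt_four]
  simp only [Pi.smul_apply, smul_eq_mul]
  norm_num
  field_simp
  rw [I_sq]
  ring

lemma B2_slash_lowerTri_two : ∃ c : ℂ, c ≠ 0 ∧ B2 ∣[(1 : ℤ)] lowerTri 2 = c • B2 := by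
  obtain ⟨c, hc, h⟩ := C2_vadd_neg_half
  exact ⟨c, hc, slash_lowerTri_two frickePair_four.left_fricke fun τ ↦ by
    rw [h, frickePair_four.right_fricke]⟩

lemma C2_slash_lowerTri_two : C2 ∣[(1 : ℤ)] lowerTri 2 = etaQuot := by
  rw [slash_lowerTri_two (h := etaQuot) (c := 1) frickePair_four.right_fricke fun τ ↦ by
    rw [B2_vadd_neg_half, etaQuot_fricke, one_mul], one_smul]

lemma etaQuot_slash_lowerTri_two : etaQuot ∣[(1 : ℤ)] lowerTri 2 = C2 := by
  rw [slash_lowerTri_two (h := C2) (c := 1) etaQuot_fricke fun τ ↦ by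
    rw [etaQuot_vadd_neg_half, frickePair_four.left_fricke, one_mul], one_smul]

lemma tendsto_etaQuot : Tendsto etaQuot atImInfty (𝓝 1) := by
  rw [show (1 : ℂ) = 1 ^ 10 / (1 ^ 4 * 1 ^ 4) by norm_num]
  have h1 := tendsto_eulerProd_nome one_ne_zero
  have h2 := tendsto_eulerProd_nome two_ne_zero
  have h4 := tendsto_eulerProd_nome four_ne_zero
  refine ((h2.pow 10).div ((h1.pow 4).mul (h4.pow 4)) (by norm_num)).congr fun τ ↦ ?_
  have h0 := qRoot_ne_zero τ
  rw [Pi.div_apply, etaQuot, etaMul_eq, etaMul_eq, etaMul_eq]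
  field_simp

lemma hasLeadingExponent_etaQuot : HasLeadingExponent etaQuot 0 :=
  .of_tendsto one_ne_zero tendsto_etaQuot

lemma semiInvariant_etaQuot : ∀ γ ∈ Gamma0 4, SemiInvariant 1 etaQuot γ := fun γ hγ ↦ by
  have hT : SemiPeriodic etaQuot :=
    ⟨1, one_ne_zero, fun τ ↦ by rw [etaQuot_vadd_one, one_mul]⟩
  refine semiInvariant_of_mem_Gamma0 (by norm_num) le_rfl (hT.semiInvariant 1) ?_ hγ
  rw [slash_fricke_of_apply etaQuot_fricke]
  exact (hT.smul _).semiInvariant 1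

lemma hasLeadingExponent_etaQuot_slash_fricke :
    HasLeadingExponent (etaQuot ∣[(1 : ℤ)] fricke 4) 0 := by
  rw [slash_fricke_of_apply etaQuot_fricke]
  exact hasLeadingExponent_etaQuot.smul (fricke_multiplier_ne_zero 4)

lemma hasLeadingExponent_etaQuot_slash_lowerTri :
    HasLeadingExponent (etaQuot ∣[(1 : ℤ)] lowerTri 2) (1 / 2) := by
  rw [etaQuot_slash_lowerTri_two]
  exact frickePair_four.right_exponent

lemma hasLeadingExponent_B2_slash_lowerTri :
    HasLeadingExponent (B2 ∣[(1 : ℤ)] lowerTri 2) 0 := by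
  obtain ⟨c, hc, h⟩ := B2_slash_lowerTri_two
  rw [h]
  exact frickePair_four.left_exponent.smul hc

lemma hasLeadingExponent_C2_slash_lowerTri :
    HasLeadingExponent (C2 ∣[(1 : ℤ)] lowerTri 2) 0 := by
  rw [C2_slash_lowerTri_two]
  exact hasLeadingExponent_etaQuot

theorem isModularForm_etaQuot : IsModularForm (Gamma0 4) 1 etaQuot :=
  isModularForm_of_four (fun h ↦ etaQuot_ne_zero .I (by rw [h]; rfl)) mdifferentiable_etaQuot
    semiInvariant_etaQuot (hasLeadingExponent_etaQuot.isBoundedAtImInfty le_rfl)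
    (hasLeadingExponent_etaQuot_slash_fricke.isBoundedAtImInfty le_rfl)
    (hasLeadingExponent_etaQuot_slash_lowerTri.isBoundedAtImInfty (by norm_num))

theorem isModularForm_B2 : IsModularForm (Gamma0 4) 1 B2 :=
  isModularForm_of_four frickePair_four.left_ne frickePair_four.holo_left
    (frickePair_four.semiInvariant_left (by norm_num) le_rfl)
    (frickePair_four.left_exponent.isBoundedAtImInfty le_rfl)
    (frickePair_four.slash_left_exponent.isBoundedAtImInfty (by norm_num))
    (hasLeadingExponent_B2_slash_lowerTri.isBoundedAtImInfty le_rfl)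

theorem isModularForm_C2 : IsModularForm (Gamma0 4) 1 C2 :=
  isModularForm_of_four frickePair_four.right_ne frickePair_four.holo_right
    (frickePair_four.semiInvariant_right (by norm_num) le_rfl)
    (frickePair_four.right_exponent.isBoundedAtImInfty (by norm_num))
    (frickePair_four.slash_right_exponent.isBoundedAtImInfty le_rfl)
    (hasLeadingExponent_C2_slash_lowerTri.isBoundedAtImInfty le_rfl)

/-- The orders of a form on `Γ₀(4)` without zeros on `ℍ`, read off the exponents at the three cusps. -/
theorem hasOrd_four {f : ℍ → ℂ} {x y z : ℚ} (hf : MDifferentiable 𝓘(ℂ) 𝓘(ℂ) f)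
    (hf0 : ∀ τ, f τ ≠ 0) (hinv : ∀ γ ∈ Gamma0 4, SemiInvariant 1 f γ)
    (hx : HasLeadingExponent f x) (hy : HasLeadingExponent (f ∣[(1 : ℤ)] fricke 4) y)
    (hz : HasLeadingExponent (f ∣[(1 : ℤ)] lowerTri 2) z) (s : HStar) :
    (HStar.Equivalent (Gamma0 4) (.cusp OnePoint.infty) s ∧ HasOrd (Gamma0 4) 1 f s x) ∨
    (HStar.Equivalent (Gamma0 4) (.cusp (0 : ℚ)) s ∧ HasOrd (Gamma0 4) 1 f s y) ∨
    (HStar.Equivalent (Gamma0 4) (.cusp (1 / 2 : ℚ)) s ∧ HasOrd (Gamma0 4) 1 f s z) ∨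
    HasOrd (Gamma0 4) 1 f s 0 := by
  cases s with
  | pt τ => exact .inr (.inr (.inr (hasOrd_pt_zero hf (hf0 τ))))
  | cusp c =>
    rcases cusp_cases_four c with hc | hc | hc
    · exact .inl ⟨hc, hasOrd_of_equivalent_infty hinv hx hc⟩
    · exact .inr (.inl ⟨hc, hasOrd_of_equivalent_zero hinv hy hc⟩)
    · exact .inr (.inr (.inl ⟨hc, hasOrd_of_equivalent_half hinv hz hc⟩))

theorem hasOrd_etaQuot (s : HStar) :
    (HStar.Equivalent (Gamma0 4) (.cusp (1 / 2 : ℚ)) s → HasOrd (Gamma0 4) 1 etaQuot s (1 / 2)) ∧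
    (¬ HStar.Equivalent (Gamma0 4) (.cusp (1 / 2 : ℚ)) s → HasOrd (Gamma0 4) 1 etaQuot s 0) := by
  refine ⟨hasOrd_of_equivalent_half semiInvariant_etaQuot
    hasLeadingExponent_etaQuot_slash_lowerTri, fun hs ↦ ?_⟩
  have := hasOrd_four mdifferentiable_etaQuot etaQuot_ne_zero semiInvariant_etaQuot
    hasLeadingExponent_etaQuot hasLeadingExponent_etaQuot_slash_fricke
    hasLeadingExponent_etaQuot_slash_lowerTri s
  tauto

theorem hasOrd_B2 (s : HStar) :
    (HStar.Equivalent (Gamma0 4) (.cusp (0 : ℚ)) s → HasOrd (Gamma0 4) 1 B2 s (1 / 2)) ∧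
    (¬ HStar.Equivalent (Gamma0 4) (.cusp (0 : ℚ)) s → HasOrd (Gamma0 4) 1 B2 s 0) := by
  have hinv := frickePair_four.semiInvariant_left (by norm_num) le_rfl
  refine ⟨hasOrd_of_equivalent_zero hinv frickePair_four.slash_left_exponent, fun hs ↦ ?_⟩
  have := hasOrd_four frickePair_four.holo_left frickePair_four.left_ne_zero hinv
    frickePair_four.left_exponent frickePair_four.slash_left_exponent
    hasLeadingExponent_B2_slash_lowerTri s
  tauto

theorem hasOrd_C2 (s : HStar) :
    (HStar.Equivalent (Gamma0 4) (.cusp OnePoint.infty) s → HasOrd (Gamma0 4) 1 C2 s (1 / 2)) ∧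
    (¬ HStar.Equivalent (Gamma0 4) (.cusp OnePoint.infty) s → HasOrd (Gamma0 4) 1 C2 s 0) := by
  have hinv := frickePair_four.semiInvariant_right (by norm_num) le_rfl
  refine ⟨hasOrd_of_equivalent_infty hinv frickePair_four.right_exponent, fun hs ↦ ?_⟩
  have := hasOrd_four frickePair_four.holo_right frickePair_four.right_ne_zero hinv
    frickePair_four.right_exponent frickePair_four.slash_right_exponent
    hasLeadingExponent_C2_slash_lowerTri s
  tauto

/-! ### The Eisenstein series of weight two on `Γ₀(N)` -/

/-- The point `N τ`. -/
def mulPt (N : ℕ) [NeZero N] (τ : ℍ) : ℍ := ⟨N * τ, natCast_mul_mem (NeZero.ne N) τ⟩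

lemma coe_mulPt (N : ℕ) [NeZero N] (τ : ℍ) : (mulPt N τ : ℂ) = N * τ := rfl

/-- The Eisenstein series `(N E₂(N τ) - E₂(τ)) / (N - 1)` of weight two on `Γ₀(N)`. -/
def eisTwo (N : ℕ) [NeZero N] (τ : ℍ) : ℂ :=
  (N * EisensteinSeries.E2 (mulPt N τ) - EisensteinSeries.E2 τ) / (N - 1)

/-- The quasi-modularity of `E₂` under `τ ↦ -1 / τ`. -/
lemma E2_S_smul (τ : ℍ) : EisensteinSeries.E2 (S • τ) =
    τ ^ 2 * EisensteinSeries.E2 τ - 1 / (2 * riemannZeta 2) * (2 * Real.pi * I) * τ := by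
  have h := congrFun (EisensteinSeries.E2_slash_action S) τ
  have h0 := τ.ne_zero
  rw [ModularForm.SL_slash_apply, ModularGroup.denom_S, zpow_neg, Pi.sub_apply, Pi.smul_apply,
    EisensteinSeries.D2_S, smul_eq_mul] at h
  have h2 : EisensteinSeries.E2 (S • τ) = (EisensteinSeries.E2 (S • τ) * ((τ : ℂ) ^ (2 : ℤ))⁻¹) *
      (τ : ℂ) ^ 2 := by
    rw [zpow_ofNat]
    field_simp
  rw [h2, h]
  field_simp

/-- The Fricke involution interchanges `E₂(τ)` and `E₂(N τ)` up to factors, whence the sign; the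
non-modular terms cancel. -/
lemma eisTwo_fricke (N : ℕ) [NeZero N] (τ : ℍ) :
    eisTwo N (fricke N • τ) = -N * τ ^ 2 * eisTwo N τ := by
  have h1 : (N : ℂ) ≠ 0 := NeZero.ne _
  have h0 := τ.ne_zero
  have e1 : fricke N • τ = S • mulPt N τ := by
    ext
    rw [coe_fricke_smul, modular_S_smul]
    change _ = (-((N : ℂ) * τ))⁻¹
    rw [inv_neg, neg_div, one_div]
  have e2 : mulPt N (fricke N • τ) = S • τ := by
    ext
    rw [coe_mulPt, coe_fricke_smul, modular_S_smul]
    field_simp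
  rw [eisTwo, e2, e1, E2_S_smul, E2_S_smul, eisTwo, coe_mulPt]
  ring

lemma mdifferentiable_eisTwo (N : ℕ) [NeZero N] : MDifferentiable 𝓘(ℂ) 𝓘(ℂ) (eisTwo N) := by
  have hE := UpperHalfPlane.mdifferentiable_iff.mp E2_mdifferentiable
  rw [UpperHalfPlane.mdifferentiable_iff]
  have h2 : DifferentiableOn ℂ
      (fun z : ℂ ↦ (EisensteinSeries.E2 ∘ ofComplex) (N * z)) {z | 0 < z.im} := by
    refine DifferentiableOn.comp (g := EisensteinSeries.E2 ∘ ofComplex)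
      (f := fun z : ℂ ↦ (N : ℂ) * z) hE (by fun_prop) fun z hz ↦ ?_
    exact natCast_mul_mem (NeZero.ne N) ⟨z, hz⟩
  refine (((h2.const_mul (N : ℂ)).sub hE).div_const ((N : ℂ) - 1)).congr fun z hz ↦ ?_
  have h3 : 0 < ((N : ℂ) * z).im := natCast_mul_mem (NeZero.ne N) ⟨z, hz⟩
  simp only [Function.comp_apply, eisTwo, Pi.sub_apply, ofComplex_apply_of_im_pos hz,
    ofComplex_apply_of_im_pos h3]
  rfl

/-- The coefficients of `E₂`. -/
def e2Coeff (m : ℕ) : ℂ := if m = 0 then 1 else -24 * ArithmeticFunction.sigma 1 m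

/-- The coefficients of `eisTwo N`. -/
def eisCoeff (N m : ℕ) : ℂ := (N * (if N ∣ m then e2Coeff (m / N) else 0) - e2Coeff m) / (N - 1)

lemma hasSum_eisTwo (N : ℕ) [NeZero N] (τ : ℍ) :
    HasSum (fun m ↦ eisCoeff N m * nome τ ^ m) (eisTwo N τ) := by
  have h1 : HasSum (fun m ↦ e2Coeff m * nome τ ^ m) (EisensteinSeries.E2 τ) :=
    EisensteinSeries.hasSum_qExpansion_E2 τ
  have h2 : HasSum (fun m ↦ e2Coeff m * nome (mulPt N τ) ^ m)
    (EisensteinSeries.E2 (mulPt N τ)) := EisensteinSeries.hasSum_qExpansion_E2 _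
  have hN : 0 < N := Nat.pos_of_ne_zero (NeZero.ne N)
  have hnome : nome (mulPt N τ) = nome τ ^ N := by
    rw [nome, nome, ← Complex.exp_nat_mul, coe_mulPt]
    congr 1
    ring
  have h3 : HasSum (fun m ↦ (if N ∣ m then e2Coeff (m / N) else 0) * nome τ ^ m)
      (EisensteinSeries.E2 (mulPt N τ)) := by
    rw [← Function.Injective.hasSum_iff (g := fun m ↦ N * m)
      (fun a b hab ↦ Nat.eq_of_mul_eq_mul_left hN hab)]
    · convert h2 using 2 with m
      simp [Nat.mul_div_cancel_left m hN, hnome, pow_mul]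
    · intro x hx
      rw [if_neg, zero_mul]
      rintro ⟨y, rfl⟩
      exact hx ⟨y, rfl⟩
  refine (((h3.mul_left (N : ℂ)).sub h1).div_const ((N : ℂ) - 1)).congr_fun fun m ↦ ?_
  rw [eisCoeff]
  ring

lemma sigma_one_eq (n : ℕ) : ArithmeticFunction.sigma 1 n = ∑ d ∈ n.divisors, d :=
  ArithmeticFunction.sigma_one_apply n

lemma mul_sigma_div_le {N m : ℕ} (hm : m ≠ 0) (h : N ∣ m) :
    N * ArithmeticFunction.sigma 1 (m / N) ≤ ArithmeticFunction.sigma 1 m := by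
  obtain ⟨k, rfl⟩ := h
  have hN : 0 < N := Nat.pos_of_ne_zero (left_ne_zero_of_mul hm)
  rw [Nat.mul_div_cancel_left k hN, sigma_one_eq, sigma_one_eq, Finset.mul_sum,
    ← Finset.sum_image (f := fun d ↦ d) (g := fun d ↦ N * d)
      (fun a _ b _ hab ↦ Nat.eq_of_mul_eq_mul_left hN hab)]
  refine Finset.sum_le_sum_of_subset fun d hd ↦ ?_
  obtain ⟨e, he, rfl⟩ := Finset.mem_image.mp hd
  rw [Nat.mem_divisors] at he ⊢
  exact ⟨Nat.mul_dvd_mul_left N he.1, hm⟩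

/-- The coefficients `24 (σ(m) - N σ(m / N)) / (N - 1)` are at most `24 m ^ 2 / (N - 1)`. -/
lemma norm_eisCoeff_le {N m : ℕ} (hN : 2 ≤ N) (hm : m ≠ 0) :
    ‖eisCoeff N m‖ ≤ 24 / (N - 1) * m ^ 2 := by
  set A : ℕ := if N ∣ m then ArithmeticFunction.sigma 1 (m / N) else 0 with hA
  have hle : N * A ≤ ArithmeticFunction.sigma 1 m := by
    rw [hA]
    split_ifs with h
    · exact mul_sigma_div_le hm h
    · simp
  have hs := ArithmeticFunction.sigma_le_pow_succ 1 m
  have hN1 : (0 : ℝ) < N - 1 := by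
    have : (2 : ℝ) ≤ N := by exact_mod_cast hN
    linarith
  have heq : eisCoeff N m =
      ((24 / (N - 1) * ((ArithmeticFunction.sigma 1 m : ℝ) - N * A) : ℝ) : ℂ) := by
    have hem : e2Coeff m = -24 * ArithmeticFunction.sigma 1 m := by rw [e2Coeff, if_neg hm]
    rw [eisCoeff, hem, hA]
    split_ifs with h
    · have : m / N ≠ 0 := (Nat.div_pos (Nat.le_of_dvd (Nat.pos_of_ne_zero hm) h)
        (by omega)).ne'
      rw [e2Coeff, if_neg this]
      push_cast
      ring
    · push_cast
      ring
  have h1 : (N : ℝ) * A ≤ ArithmeticFunction.sigma 1 m := by exact_mod_cast hle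
  have h2 : (ArithmeticFunction.sigma 1 m : ℝ) ≤ m ^ 2 := by exact_mod_cast hs
  have h3 : (0 : ℝ) ≤ N * A := by positivity
  rw [heq, Complex.norm_real, Real.norm_of_nonneg (mul_nonneg (by positivity) (by linarith))]
  gcongr
  linarith

lemma eisCoeff_zero {N : ℕ} (hN : 2 ≤ N) : eisCoeff N 0 = 1 := by
  have : (N : ℂ) - 1 ≠ 0 := by
    rw [sub_ne_zero]
    exact_mod_cast (show N ≠ 1 by omega)
  simp [eisCoeff, e2Coeff, this]

lemma eisCoeff_of_not_dvd {N m : ℕ} (hm : m ≠ 0) (h : ¬ N ∣ m) :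
    eisCoeff N m = 24 * (∑ d ∈ m.divisors, d : ℕ) / (N - 1) := by
  rw [eisCoeff, if_neg h, e2Coeff, if_neg hm, sigma_one_eq]
  ring

lemma eisCoeff_one {N : ℕ} (hN : 2 ≤ N) : eisCoeff N 1 = 24 / (N - 1) := by
  rw [eisCoeff_of_not_dvd one_ne_zero (by simp; omega)]
  simp

/-- The power series of `eisTwo N`, as a function of `q`. -/
def eisSeries (N : ℕ) (q : ℂ) : ℂ := ∑' m, eisCoeff N m * q ^ m

lemma eisTwo_eq (N : ℕ) [NeZero N] (τ : ℍ) : eisTwo N τ = eisSeries N (nome τ) :=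
  (hasSum_eisTwo N τ).tsum_eq.symm

lemma summable_eisCoeff_mul {N : ℕ} (hN : 2 ≤ N) {q : ℂ} (hq : ‖q‖ < 1) :
    Summable fun m ↦ eisCoeff N m * q ^ m := by
  rw [← summable_nat_add_iff 1]
  have h1 := (summable_pow_mul_geometric_of_norm_lt_one 2 (R := ℝ) (r := ‖q‖)
    (by simpa using hq)).mul_left (24 / ((N : ℝ) - 1))
  refine Summable.of_norm_bounded ((summable_nat_add_iff 1).mpr h1) fun m ↦ ?_
  rw [norm_mul, norm_pow, ← mul_assoc]
  exact mul_le_mul_of_nonneg_right (norm_eisCoeff_le hN m.succ_ne_zero) (by positivity)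

lemma eisSeries_zero {N : ℕ} (hN : 2 ≤ N) : eisSeries N 0 = 1 := by
  rw [eisSeries, tsum_eq_single 0 fun m hm ↦ by simp [hm]]
  simp [eisCoeff_zero hN]

/-- The constant and linear terms of the series are split off; the rest is `O(q ^ 2)`. -/
lemma hasDerivAt_eisSeries {N : ℕ} (hN : 2 ≤ N) :
    HasDerivAt (eisSeries N) (24 / (N - 1)) 0 := by
  set K : ℝ := 24 / ((N : ℝ) - 1) with hK
  have hN1 : (0 : ℝ) < N - 1 := by
    have : (2 : ℝ) ≤ N := by exact_mod_cast hN
    linarith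
  have hK0 : 0 ≤ K := by positivity
  have hsum : Summable fun n : ℕ ↦ K * (((n + 2 : ℕ) : ℝ) ^ 2 * (1 / 2) ^ (n + 2)) :=
    ((summable_nat_add_iff 2).mpr (summable_pow_mul_geometric_of_norm_lt_one 2 (R := ℝ)
      (r := 1 / 2) (by norm_num))).mul_left K
  rw [hasDerivAt_iff_isLittleO_nhds_zero]
  refine Asymptotics.IsBigO.trans_isLittleO (g := fun h : ℂ ↦ h ^ 2) ?_ ?_
  · refine Asymptotics.IsBigO.of_bound (4 * ∑' n : ℕ, K * (((n + 2 : ℕ) : ℝ) ^ 2 *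
      (1 / 2) ^ (n + 2))) ?_
    filter_upwards [Metric.ball_mem_nhds (0 : ℂ) (by norm_num : (0 : ℝ) < 1 / 2)] with q hq
    rw [mem_ball_zero_iff] at hq
    have h1 := (hasSum_nat_add_iff' 2).mpr
      (summable_eisCoeff_mul hN (q := q) (by linarith)).hasSum
    have h2 : eisSeries N (0 + q) - eisSeries N 0 - q • (24 / ((N : ℂ) - 1)) =
        ∑' m, eisCoeff N m * q ^ m - ∑ i ∈ Finset.range 2, eisCoeff N i * q ^ i := by
      rw [zero_add, eisSeries_zero hN, Finset.sum_range_succ, Finset.sum_range_one, eisCoeff_zero hN,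
        eisCoeff_one hN, eisSeries, smul_eq_mul]
      ring
    rw [h2]
    have h3 := (hsum.hasSum.mul_left 4).mul_right (‖q‖ ^ 2)
    rw [norm_pow]
    refine h1.norm_le_of_bounded h3 fun n ↦ ?_
    rw [norm_mul, norm_pow]
    have h4 := norm_eisCoeff_le hN (m := n + 2) (by omega)
    calc ‖eisCoeff N (n + 2)‖ * ‖q‖ ^ (n + 2)
        ≤ K * ((n + 2 : ℕ) : ℝ) ^ 2 * ((1 / 2) ^ n * ‖q‖ ^ 2) := by
          rw [pow_add]
          gcongr
      _ = _ := by ring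
  · simpa using Asymptotics.isLittleO_pow_id (𝕜 := ℂ) (n := 2) (by norm_num)

lemma eisTwo_vadd_one (N : ℕ) [NeZero N] (τ : ℍ) : eisTwo N ((1 : ℝ) +ᵥ τ) = eisTwo N τ := by
  rw [eisTwo_eq, eisTwo_eq, nome_vadd_one]

lemma tendsto_eisTwo {N : ℕ} [NeZero N] (hN : 2 ≤ N) : Tendsto (eisTwo N) atImInfty (𝓝 1) := by
  have h := (hasDerivAt_eisSeries hN).continuousAt.tendsto
  rw [eisSeries_zero hN] at h
  exact (h.comp tendsto_nome).congr fun τ ↦ (eisTwo_eq N τ).symm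

lemma eisTwo_slash_T (N : ℕ) [NeZero N] : eisTwo N ∣[(2 : ℤ)] T = eisTwo N := by
  ext τ
  rw [slash_T_apply, eisTwo_vadd_one]

lemma eisTwo_slash_fricke (N : ℕ) [NeZero N] : eisTwo N ∣[(2 : ℤ)] fricke N = -eisTwo N := by
  ext τ
  have h1 : (N : ℂ) ≠ 0 := NeZero.ne _
  have h0 := τ.ne_zero
  rw [slash_fricke_apply, eisTwo_fricke, zpow_neg, mul_zpow]
  simp only [Pi.neg_apply]
  norm_num
  field_simp

lemma eisTwo_slash_eq {N : ℕ} [NeZero N] (h2 : 2 ≤ N) (h4 : N ≤ 4) {γ : SL(2, ℤ)}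
    (hγ : γ ∈ Gamma0 N) : eisTwo N ∣[(2 : ℤ)] γ = eisTwo N := by
  refine slash_eq_of_mem_Gamma0 h2 h4 even_two (eisTwo_slash_T N) ?_ hγ
  rw [eisTwo_slash_fricke, SlashAction.neg_slash, eisTwo_slash_T]

theorem isModularForm_eisTwo {N : ℕ} [NeZero N] (hN : N.Prime) (h4 : N ≤ 4) :
    IsModularForm (Gamma0 N) 2 (eisTwo N) := by
  have hlead : HasLeadingExponent (eisTwo N) 0 := .of_tendsto one_ne_zero
    (tendsto_eisTwo hN.two_le)
  refine isModularForm_of_prime hN ?_ (mdifferentiable_eisTwo N)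
    (fun γ hγ ↦ ⟨1, one_ne_zero, by rw [eisTwo_slash_eq hN.two_le h4 hγ, one_smul]⟩)
    (hlead.isBoundedAtImInfty le_rfl) ?_
  · intro h
    have := tendsto_eisTwo hN.two_le
    rw [h] at this
    exact zero_ne_one (tendsto_nhds_unique tendsto_const_nhds this)
  · rw [eisTwo_slash_fricke, ← neg_one_smul ℂ]
    exact (hlead.smul (neg_ne_zero.mpr one_ne_zero)).isBoundedAtImInfty le_rfl

/-! ### Identities between forms of equal weight -/

/-- A modular function without poles that vanishes at `i∞` is zero, as modular forms of weight
zero are constant. -/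
theorem eq_zero_of_weight_zero {N : ℕ} [NeZero N] {F : ℍ → ℂ}
    (hol : MDifferentiable 𝓘(ℂ) 𝓘(ℂ) F) (hinv : ∀ γ ∈ Gamma0 N, F ∣[(0 : ℤ)] γ = F)
    (hb : ∀ g : SL(2, ℤ), IsBoundedAtImInfty (F ∣[(0 : ℤ)] g))
    (hlim : Tendsto F atImInfty (𝓝 0)) : F = 0 := by
  let f : ModularForm ((Gamma0 N).map (Matrix.SpecialLinearGroup.mapGL ℝ)) 0 :=
    { toFun := F
      slash_action_eq' := by
        rintro _ ⟨γ, hγ, rfl⟩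
        exact hinv γ hγ
      holo' := hol
      bdd_at_cusps' := by
        intro c hc
        rw [Subgroup.IsArithmetic.isCusp_iff_isCusp_SL2Z] at hc
        rw [OnePoint.isBoundedAt_iff_forall_SL2Z hc]
        exact fun γ _ ↦ hb γ }
  obtain ⟨c, hc⟩ := ModularForm.eq_const_of_weight_zero f
  have hF : F = Function.const ℍ c := hc
  rw [hF] at hlim ⊢
  have : c = 0 := tendsto_nhds_unique tendsto_const_nhds hlim
  rw [this]
  rfl

lemma slash_zero_fricke_apply (N : ℕ) [NeZero N] (F : ℍ → ℂ) (τ : ℍ) :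
    (F ∣[(0 : ℤ)] fricke N) τ = F (fricke N • τ) * (N : ℂ)⁻¹ := by
  rw [slash_fricke_apply]
  simp

lemma isBoundedAtImInfty_of_tendsto {F : ℍ → ℂ} {L : ℂ} (h : Tendsto F atImInfty (𝓝 L)) :
    IsBoundedAtImInfty F :=
  h.isBigO_one ℝ

/-- `eq_zero_of_weight_zero` in terms of `F` and of its Fricke transform `G`. -/
theorem eq_zero_of_fricke {N : ℕ} [NeZero N] (h2 : 2 ≤ N) (h4 : N ≤ 4) {F G : ℍ → ℂ}
    (hol : MDifferentiable 𝓘(ℂ) 𝓘(ℂ) F) (hF : ∀ τ, F ((1 : ℝ) +ᵥ τ) = F τ)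
    (hG : ∀ τ, G ((1 : ℝ) +ᵥ τ) = G τ) (hW : ∀ τ, F (fricke N • τ) = G τ)
    (hlim : Tendsto F atImInfty (𝓝 0)) (hbG : IsBoundedAtImInfty G)
    (hV : N = 4 → IsBoundedAtImInfty (F ∣[(0 : ℤ)] lowerTri 2)) : F = 0 := by
  have hFW : F ∣[(0 : ℤ)] fricke N = (N : ℂ)⁻¹ • G := by
    ext τ
    rw [slash_zero_fricke_apply, hW, mul_comm]
    rfl
  have hinv : ∀ γ ∈ Gamma0 N, F ∣[(0 : ℤ)] γ = F := by
    intro γ hγ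
    refine slash_eq_of_mem_Gamma0 h2 h4 Even.zero ?_ ?_ hγ
    · ext τ
      rw [slash_T_apply, hF]
    · rw [hFW]
      ext τ
      rw [slash_T_apply, Pi.smul_apply, hG, Pi.smul_apply]
  have hsemi : ∀ γ ∈ Gamma0 N, SemiInvariant 0 F γ := fun γ hγ ↦
    ⟨1, one_ne_zero, by rw [hinv γ hγ, one_smul]⟩
  have hbF := isBoundedAtImInfty_of_tendsto hlim
  have hbFW : IsBoundedAtImInfty (F ∣[(0 : ℤ)] fricke N) := by
    rw [hFW]
    exact isBoundedAtImInfty_smul hbG _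
  refine eq_zero_of_weight_zero hol hinv (fun g ↦ ?_) hlim
  have hcases : N = 4 ∨ N.Prime := by
    interval_cases N
    · exact .inr Nat.prime_two
    · exact .inr Nat.prime_three
    · exact .inl rfl
  rcases hcases with rfl | hp
  · rcases mod_four_cases g with hg | hg | hg
    · exact isBoundedAtImInfty_slash_of_mem hsemi hbF hg
    · exact isBoundedAtImInfty_slash_of_isCoprime hsemi hbFW hg
    · exact isBoundedAtImInfty_slash_of_mod_four hsemi (hV rfl) hg
  · rcases mem_Gamma0_or_isCoprime hp g with hg | hg
    · exact isBoundedAtImInfty_slash_of_mem hsemi hbF hg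
    · exact isBoundedAtImInfty_slash_of_isCoprime hsemi hbFW hg

/-- A power series in `q` without constant term is asymptotic to its linear term at `i∞`. -/
lemma tendsto_div_nome {φ : ℂ → ℂ} {d : ℂ} (h : HasDerivAt φ d 0) (h0 : φ 0 = 0) :
    Tendsto (fun τ ↦ φ (nome τ) / nome τ) atImInfty (𝓝 d) := by
  have := (hasDerivAt_iff_tendsto_slope_zero.mp h).comp tendsto_nome_punctured
  refine this.congr fun τ ↦ ?_
  simp [h0, div_eq_inv_mul]

lemma hasDerivAt_eulerProd_pow {δ : ℕ} (hδ : 2 ≤ δ) :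
    HasDerivAt (fun q ↦ eulerProd (q ^ δ)) 0 0 := by
  have h1 : HasDerivAt eulerProd (-1) ((0 : ℂ) ^ δ) := by
    rw [zero_pow (by omega)]
    exact hasDerivAt_eulerProd_zero
  have : HasDerivAt (fun q ↦ eulerProd (q ^ δ)) _ 0 := h1.comp (0 : ℂ) (hasDerivAt_pow δ (0 : ℂ))
  simpa [zero_pow (show δ - 1 ≠ 0 by omega)] using this

lemma B4_pow_four_eq (τ : ℍ) :
    B4 τ ^ 4 = eulerProd (nome τ) ^ 16 / eulerProd (nome τ ^ 2) ^ 8 := by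
  rw [show B4 τ = B2 τ from rfl, B2_eq, div_pow]
  ring

lemma C4_pow_four_eq (τ : ℍ) :
    C4 τ ^ 4 = 64 * nome τ * eulerProd (nome τ ^ 2) ^ 16 / eulerProd (nome τ) ^ 8 := by
  have h1 := eulerProd_nome_ne_zero one_ne_zero τ
  have h0 := qRoot_ne_zero τ
  rw [pow_one] at h1
  have h8 : ((2 : ℂ) ^ (3 / 2 : ℂ)) ^ 4 = 64 := by
    rw [show ((2 : ℂ) ^ (3 / 2 : ℂ)) ^ 4 = (((2 : ℂ) ^ (3 / 2 : ℂ)) ^ 2) ^ 2 by ring,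
      two_cpow_three_halves_sq]
    norm_num
  rw [C4, etaMul_eq, etaMul_eq, div_pow, mul_pow, h8, ← qRoot_pow, pow_one, pow_one]
  field_simp

lemma mdifferentiable_sub {f g : ℍ → ℂ} (hf : MDifferentiable 𝓘(ℂ) 𝓘(ℂ) f)
    (hg : MDifferentiable 𝓘(ℂ) 𝓘(ℂ) g) : MDifferentiable 𝓘(ℂ) 𝓘(ℂ) (f - g) := by
  rw [UpperHalfPlane.mdifferentiable_iff] at hf hg ⊢
  exact hf.sub hg

lemma mdifferentiable_add {f g : ℍ → ℂ} (hf : MDifferentiable 𝓘(ℂ) 𝓘(ℂ) f)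
    (hg : MDifferentiable 𝓘(ℂ) 𝓘(ℂ) g) : MDifferentiable 𝓘(ℂ) 𝓘(ℂ) (f + g) := by
  rw [UpperHalfPlane.mdifferentiable_iff] at hf hg ⊢
  exact hf.add hg

lemma mdifferentiable_mul {f g : ℍ → ℂ} (hf : MDifferentiable 𝓘(ℂ) 𝓘(ℂ) f)
    (hg : MDifferentiable 𝓘(ℂ) 𝓘(ℂ) g) : MDifferentiable 𝓘(ℂ) 𝓘(ℂ) (f * g) := by
  rw [UpperHalfPlane.mdifferentiable_iff] at hf hg ⊢
  exact hf.mul hg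

lemma differentiableAt_eulerProd_zero : DifferentiableAt ℂ eulerProd 0 :=
  hasDerivAt_eulerProd_zero.differentiableAt

lemma eulerProd_zero_pow {δ : ℕ} (hδ : δ ≠ 0) : eulerProd (0 ^ δ) = 1 := by
  rw [zero_pow hδ, eulerProd_zero]

/-- In level two, `ℬ⁴ + 𝒞⁴` is the square of the Eisenstein series. The difference is a power series
in `q` without constant term; divided by `ℬ⁴` it vanishes at `i∞`, and the Fricke involution turns
this quotient into that by `𝒞⁴ = 64 q + ⋯`, which is bounded. -/
theorem eisTwo_two_sq (τ : ℍ) : eisTwo 2 τ ^ 2 = B4 τ ^ 4 + C4 τ ^ 4 := by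
  have hp := frickePair_two
  have hs : (((√((2 : ℕ) : ℝ) : ℝ) : ℂ)) ^ 2 = 2 := ofReal_sqrt_natCast_sq 2
  set num : ℍ → ℂ := eisTwo 2 ^ 2 - B4 ^ 4 - C4 ^ 4 with hnum
  set φ : ℂ → ℂ := fun q ↦ eisSeries 2 q ^ 2 - eulerProd q ^ 16 / eulerProd (q ^ 2) ^ 8 -
    64 * q * eulerProd (q ^ 2) ^ 16 / eulerProd q ^ 8 with hφ
  have hnumφ : ∀ τ, num τ = φ (nome τ) := fun τ ↦ by
    simp only [hnum, hφ, Pi.sub_apply, Pi.pow_apply, eisTwo_eq, B4_pow_four_eq, C4_pow_four_eq]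
  have hφ0 : φ 0 = 0 := by
    simp only [hφ, eisSeries_zero le_rfl, eulerProd_zero, eulerProd_zero_pow two_ne_zero]
    norm_num
  have hφd : HasDerivAt φ (deriv φ 0) 0 := by
    have h1 := differentiableAt_eulerProd_zero
    have h2 := (hasDerivAt_eulerProd_pow (δ := 2) le_rfl).differentiableAt
    have h3 := (hasDerivAt_eisSeries (N := 2) le_rfl).differentiableAt
    refine DifferentiableAt.hasDerivAt (((h3.pow 2).sub ((h1.pow 16).div (h2.pow 8) ?_)).sub
      ((((differentiableAt_const _).mul differentiableAt_id).mul (h2.pow 16)).div (h1.pow 8) ?_))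
    · simp [eulerProd_zero]
    · simp [eulerProd_zero]
  have hnome := tendsto_div_nome hφd hφ0
  have hnum0 : Tendsto num atImInfty (𝓝 0) := by
    have := hnome.mul tendsto_nome
    rw [mul_zero] at this
    refine this.congr fun τ ↦ ?_
    rw [hnumφ, div_mul_cancel₀ _ (nome_ne_zero τ)]
  have hB : Tendsto (B4 ^ 4) atImInfty (𝓝 1) := by
    have h1 := tendsto_eulerProd_nome one_ne_zero
    have h2 := tendsto_eulerProd_nome two_ne_zero
    have := (h1.pow 16).div (h2.pow 8) (by norm_num)
    norm_num at this
    refine this.congr fun τ ↦ ?_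
    rw [Pi.div_apply, Pi.pow_apply, B4_pow_four_eq]
  have hC : Tendsto (fun τ ↦ C4 τ ^ 4 / nome τ) atImInfty (𝓝 64) := by
    have h1 := tendsto_eulerProd_nome one_ne_zero
    have h2 := tendsto_eulerProd_nome two_ne_zero
    have := ((h2.pow 16).div (h1.pow 8) (by norm_num)).const_mul 64
    norm_num at this
    refine this.congr fun τ ↦ ?_
    have := nome_ne_zero τ
    rw [C4_pow_four_eq]
    field_simp
  have key : num / B4 ^ 4 = 0 := by
    refine eq_zero_of_fricke (N := 2) (G := num / C4 ^ 4) le_rfl (by norm_num) ?_ ?_ ?_ ?_ ?_ ?_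
      (by norm_num)
    · exact mdifferentiable_div (mdifferentiable_sub (mdifferentiable_sub
        (mdifferentiable_pow (mdifferentiable_eisTwo 2) 2) (mdifferentiable_pow hp.holo_left 4))
        (mdifferentiable_pow hp.holo_right 4)) (mdifferentiable_pow hp.holo_left 4)
        fun τ ↦ pow_ne_zero 4 (hp.left_ne_zero τ)
    · intro τ
      simp only [Pi.div_apply, hnumφ, Pi.pow_apply, B4_pow_four_eq, nome_vadd_one]
    · intro τ
      simp only [Pi.div_apply, hnumφ, Pi.pow_apply, C4_pow_four_eq, nome_vadd_one]
    · intro τ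
      have h0 := τ.ne_zero
      have h1 := hp.right_ne_zero τ
      have h4 : (-I * (√((2 : ℕ) : ℝ) : ℝ) * τ : ℂ) ^ 4 = 4 * τ ^ 4 := by
        have : (-I * (√((2 : ℕ) : ℝ) : ℝ) * τ : ℂ) ^ 4 =
          (I ^ 2) ^ 2 * (((√((2 : ℕ) : ℝ) : ℝ) : ℂ) ^ 2) ^ 2 * τ ^ 4 := by ring
        rw [this, hs, I_sq]
        ring
      simp only [hnum, Pi.div_apply, Pi.sub_apply, Pi.pow_apply, hp.left_fricke,
        hp.right_fricke, eisTwo_fricke]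
      rw [mul_pow _ (B4 τ), mul_pow _ (C4 τ), h4]
      push_cast
      field_simp
      ring
    · have := hnum0.div hB one_ne_zero
      rwa [zero_div] at this
    · refine isBoundedAtImInfty_of_tendsto (L := deriv φ 0 / 64)
        ((hnome.div hC (by norm_num)).congr fun τ ↦ ?_)
      simp only [Pi.div_apply, Pi.pow_apply, hnumφ]
      rw [div_div_div_cancel_right₀ (nome_ne_zero τ)]
  have h1 := congrFun key τ
  simp only [Pi.div_apply, Pi.pow_apply, Pi.zero_apply, hnum, Pi.sub_apply, div_eq_zero_iff] at h1
  rcases h1 with h1 | h1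
  · linear_combination h1
  · exact absurd h1 (pow_ne_zero 4 (hp.left_ne_zero τ))

/-- Jacobi's identity between fourth powers of theta constants, in terms of eta quotients. As in
level two, the difference of both sides is divided by `ℬ²`. -/
theorem etaQuot_sq (τ : ℍ) : etaQuot τ ^ 2 = B2 τ ^ 2 + C2 τ ^ 2 := by
  have hp := frickePair_four
  have hBq : ∀ τ, B2 τ ^ 2 = eulerProd (nome τ) ^ 8 / eulerProd (nome τ ^ 2) ^ 4 := fun τ ↦ by
    rw [B2_eq, div_pow]
    ring
  have hCq : ∀ τ, C2 τ ^ 2 =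
      16 * nome τ * eulerProd (nome τ ^ 4) ^ 8 / eulerProd (nome τ ^ 2) ^ 4 := fun τ ↦ by
    rw [C2_eq, div_pow, ← qRoot_pow]
    ring
  have hAq : ∀ τ, etaQuot τ ^ 2 = eulerProd (-nome τ) ^ 8 / eulerProd (nome τ ^ 2) ^ 4 :=
    fun τ ↦ by
      rw [etaQuot_eq, div_pow]
      ring
  set num : ℍ → ℂ := etaQuot ^ 2 - B2 ^ 2 - C2 ^ 2 with hnum
  set φ : ℂ → ℂ := fun q ↦ eulerProd (-q) ^ 8 / eulerProd (q ^ 2) ^ 4 -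
    eulerProd q ^ 8 / eulerProd (q ^ 2) ^ 4 -
    16 * q * eulerProd (q ^ 4) ^ 8 / eulerProd (q ^ 2) ^ 4 with hφ
  have hnumφ : ∀ τ, num τ = φ (nome τ) := fun τ ↦ by
    simp only [hnum, hφ, Pi.sub_apply, Pi.pow_apply, hAq, hBq, hCq]
  have hφ0 : φ 0 = 0 := by
    simp only [hφ, neg_zero, eulerProd_zero, eulerProd_zero_pow two_ne_zero]
    norm_num
  have hφd : HasDerivAt φ (deriv φ 0) 0 := by
    have h1 := differentiableAt_eulerProd_zero
    have h2 := (hasDerivAt_eulerProd_pow (δ := 2) le_rfl).differentiableAt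
    have h4 := (hasDerivAt_eulerProd_pow (δ := 4) (by norm_num)).differentiableAt
    have h3 : DifferentiableAt ℂ (fun q ↦ eulerProd (-q)) 0 :=
      DifferentiableAt.comp (g := eulerProd) (f := fun q : ℂ ↦ -q) 0
        (by rw [neg_zero]; exact h1) (by fun_prop)
    refine DifferentiableAt.hasDerivAt ((((h3.pow 8).div (h2.pow 4) ?_).sub
      ((h1.pow 8).div (h2.pow 4) ?_)).sub
      ((((differentiableAt_const _).mul differentiableAt_id).mul (h4.pow 8)).div (h2.pow 4) ?_))
    all_goals simp [eulerProd_zero]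
  have hnome := tendsto_div_nome hφd hφ0
  have hnum0 : Tendsto num atImInfty (𝓝 0) := by
    have := hnome.mul tendsto_nome
    rw [mul_zero] at this
    refine this.congr fun τ ↦ ?_
    rw [hnumφ, div_mul_cancel₀ _ (nome_ne_zero τ)]
  have h1 := tendsto_eulerProd_nome one_ne_zero
  have h2 := tendsto_eulerProd_nome two_ne_zero
  have h4 := tendsto_eulerProd_nome four_ne_zero
  have hB : Tendsto (B2 ^ 2) atImInfty (𝓝 1) := by
    have := (h1.pow 8).div (h2.pow 4) (by norm_num)
    norm_num at this
    refine this.congr fun τ ↦ ?_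
    rw [Pi.div_apply, Pi.pow_apply, hBq]
  have hC : Tendsto (fun τ ↦ C2 τ ^ 2 / nome τ) atImInfty (𝓝 16) := by
    have := ((h4.pow 8).div (h2.pow 4) (by norm_num)).const_mul 16
    norm_num at this
    refine this.congr fun τ ↦ ?_
    have := nome_ne_zero τ
    rw [hCq]
    field_simp
  have key : num / B2 ^ 2 = 0 := by
    refine eq_zero_of_fricke (N := 4) (G := num / C2 ^ 2) (by norm_num) le_rfl ?_ ?_ ?_ ?_ ?_ ?_ ?_
    · exact mdifferentiable_div (mdifferentiable_sub (mdifferentiable_sub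
        (mdifferentiable_pow mdifferentiable_etaQuot 2) (mdifferentiable_pow hp.holo_left 2))
        (mdifferentiable_pow hp.holo_right 2)) (mdifferentiable_pow hp.holo_left 2)
        fun τ ↦ pow_ne_zero 2 (hp.left_ne_zero τ)
    · intro τ
      simp only [Pi.div_apply, hnumφ, Pi.pow_apply, hBq, nome_vadd_one]
    · intro τ
      simp only [Pi.div_apply, hnumφ, Pi.pow_apply, hCq, nome_vadd_one]
    · intro τ
      have h0 := τ.ne_zero
      have h1 := hp.right_ne_zero τ
      simp only [hnum, Pi.div_apply, Pi.sub_apply, Pi.pow_apply, hp.left_fricke,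
        hp.right_fricke, etaQuot_fricke, sqrt_four]
      push_cast
      have := I_ne_zero
      field_simp
      ring
    · have := hnum0.div hB one_ne_zero
      rwa [zero_div] at this
    · refine isBoundedAtImInfty_of_tendsto (L := deriv φ 0 / 16)
        ((hnome.div hC (by norm_num)).congr fun τ ↦ ?_)
      simp only [Pi.div_apply, Pi.pow_apply, hnumφ]
      rw [div_div_div_cancel_right₀ (nome_ne_zero τ)]
    · -- At the cusp `1 / 2` the forms `𝒜` and `𝒞` are interchanged and `ℬ`, the denominator, is
      -- preserved up to a constant.
      intro _
      obtain ⟨c, hc, hcB⟩ := B2_slash_lowerTri_two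
      have hbound : IsBoundedAtImInfty
          ((C2 ^ 2 - (c • B2) ^ 2 - etaQuot ^ 2) * ((c • B2) ^ 2)⁻¹) := by
        have e1 := (hp.right_exponent.pow 2).isBoundedAtImInfty (by norm_num)
        have e2 := ((hp.left_exponent.smul hc).pow 2)
        have e3 := (hasLeadingExponent_etaQuot.pow 2).isBoundedAtImInfty (by norm_num)
        exact Filter.BoundedAtFilter.mul ((e1.sub (e2.isBoundedAtImInfty (by norm_num))).sub e3)
          (e2.inv.isBoundedAtImInfty (by norm_num))
      convert hbound using 1
      have hpow : ∀ f : ℍ → ℂ, ∀ τ, f (lowerTri 2 • τ) =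
          (f ∣[(1 : ℤ)] lowerTri 2) τ * denom (lowerTri 2) τ := fun f τ ↦ by
        have := denom_ne_zero (lowerTri 2) τ
        rw [ModularForm.SL_slash_apply, zpow_neg_one]
        field_simp
      ext τ
      rw [ModularForm.SL_slash_apply, neg_zero, zpow_zero, mul_one]
      have eB := hpow B2 τ
      have eC := hpow C2 τ
      have eQ := hpow etaQuot τ
      rw [hcB] at eB
      rw [C2_slash_lowerTri_two] at eC
      rw [etaQuot_slash_lowerTri_two] at eQ
      have h0 := denom_ne_zero (lowerTri 2) τ
      have h1 := hp.left_ne_zero τ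
      simp only [hnum, Pi.div_apply, Pi.sub_apply, Pi.pow_apply, Pi.mul_apply, Pi.inv_apply,
        eB, eC, eQ, Pi.smul_apply, smul_eq_mul]
      field_simp
  have h1 := congrFun key τ
  simp only [Pi.div_apply, Pi.pow_apply, Pi.zero_apply, hnum, Pi.sub_apply, div_eq_zero_iff] at h1
  rcases h1 with h1 | h1
  · linear_combination h1
  · exact absurd h1 (pow_ne_zero 2 (hp.left_ne_zero τ))

lemma B3_pow_three_eq (τ : ℍ) :
    B3 τ ^ 3 = eulerProd (nome τ) ^ 9 / eulerProd (nome τ ^ 3) ^ 3 := by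
  have h3 := eulerProd_nome_ne_zero three_ne_zero τ
  have h0 := qRoot_ne_zero τ
  rw [B3, etaMul_eq, etaMul_eq, pow_one, pow_one]
  field_simp

lemma C3_pow_three_eq (τ : ℍ) :
    C3 τ ^ 3 = 27 * nome τ * eulerProd (nome τ ^ 3) ^ 9 / eulerProd (nome τ) ^ 3 := by
  have h1 := eulerProd_nome_ne_zero one_ne_zero τ
  have h0 := qRoot_ne_zero τ
  rw [pow_one] at h1
  rw [C3, etaMul_eq, etaMul_eq, ← qRoot_pow, pow_one, pow_one]
  field_simp
  ring

/-- In level three, the cube of the Eisenstein series is the square of `ℬ³ + 𝒞³`. Both sides are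
`1 + 36 q + ⋯`, so that their difference divided by `ℬ³ 𝒞³` vanishes at `i∞`; the quotient is
invariant under the Fricke involution. -/
theorem eisTwo_three_cube (τ : ℍ) : eisTwo 3 τ ^ 3 = (B3 τ ^ 3 + C3 τ ^ 3) ^ 2 := by
  have hp := frickePair_three
  have hs : (((√((3 : ℕ) : ℝ) : ℝ) : ℂ)) ^ 2 = 3 := ofReal_sqrt_natCast_sq 3
  set num : ℍ → ℂ := eisTwo 3 ^ 3 - (B3 ^ 3 + C3 ^ 3) ^ 2 with hnum
  set φ : ℂ → ℂ := fun q ↦ eisSeries 3 q ^ 3 - (eulerProd q ^ 9 / eulerProd (q ^ 3) ^ 3 +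
    27 * q * eulerProd (q ^ 3) ^ 9 / eulerProd q ^ 3) ^ 2 with hφ
  have hnumφ : ∀ τ, num τ = φ (nome τ) := fun τ ↦ by
    simp only [hnum, hφ, Pi.sub_apply, Pi.add_apply, Pi.pow_apply, eisTwo_eq, B3_pow_three_eq,
      C3_pow_three_eq]
  have hφ0 : φ 0 = 0 := by
    simp only [hφ, eisSeries_zero (N := 3) (by norm_num), eulerProd_zero,
      eulerProd_zero_pow three_ne_zero]
    norm_num
  have hφd : HasDerivAt φ 0 0 := by
    have h1 := hasDerivAt_eulerProd_zero
    have h3 := hasDerivAt_eulerProd_pow (δ := 3) (by norm_num)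
    have hE := hasDerivAt_eisSeries (N := 3) (by norm_num)
    have e := (hE.fun_pow 3).fun_sub ((((h1.fun_pow 9).fun_div (h3.fun_pow 3)
      (by simp [eulerProd_zero])).fun_add
      ((((hasDerivAt_id' (0 : ℂ)).const_mul 27).fun_mul (h3.fun_pow 9)).fun_div (h1.fun_pow 3)
      (by simp [eulerProd_zero]))).fun_pow 2)
    refine e.congr_deriv ?_
    simp [eulerProd_zero, eisSeries_zero (N := 3) (by norm_num)]
    norm_num
  have hnome := tendsto_div_nome hφd hφ0
  have h1 := tendsto_eulerProd_nome one_ne_zero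
  have h3 := tendsto_eulerProd_nome three_ne_zero
  have hBC : Tendsto (fun τ ↦ B3 τ ^ 3 * C3 τ ^ 3 / nome τ) atImInfty (𝓝 27) := by
    have := ((h1.pow 6).mul (h3.pow 6)).const_mul 27
    norm_num at this
    refine this.congr fun τ ↦ ?_
    have := nome_ne_zero τ
    have h1 := eulerProd_nome_ne_zero one_ne_zero τ
    have h3 := eulerProd_nome_ne_zero three_ne_zero τ
    rw [pow_one] at h1
    rw [B3_pow_three_eq, C3_pow_three_eq]
    field_simp
  have hlim : Tendsto (num / (B3 ^ 3 * C3 ^ 3)) atImInfty (𝓝 0) := by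
    have := hnome.div hBC (by norm_num)
    rw [zero_div] at this
    refine this.congr fun τ ↦ ?_
    simp only [Pi.div_apply, Pi.mul_apply, Pi.pow_apply, hnumφ]
    rw [div_div_div_cancel_right₀ (nome_ne_zero τ)]
  have hper : ∀ τ, (num / (B3 ^ 3 * C3 ^ 3)) ((1 : ℝ) +ᵥ τ) = (num / (B3 ^ 3 * C3 ^ 3)) τ := by
    intro τ
    simp only [Pi.div_apply, hnumφ, Pi.mul_apply, Pi.pow_apply, B3_pow_three_eq, C3_pow_three_eq,
      nome_vadd_one]
  have key : num / (B3 ^ 3 * C3 ^ 3) = 0 := by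
    refine eq_zero_of_fricke (N := 3) (by norm_num) (by norm_num) ?_ hper hper ?_ hlim
      (isBoundedAtImInfty_of_tendsto hlim) (by norm_num)
    · exact mdifferentiable_div (mdifferentiable_sub
        (mdifferentiable_pow (mdifferentiable_eisTwo 3) 3) (mdifferentiable_pow
          (mdifferentiable_add (mdifferentiable_pow hp.holo_left 3)
          (mdifferentiable_pow hp.holo_right 3)) 2))
        (mdifferentiable_mul (mdifferentiable_pow hp.holo_left 3)
          (mdifferentiable_pow hp.holo_right 3))
        fun τ ↦ mul_ne_zero (pow_ne_zero 3 (hp.left_ne_zero τ))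
          (pow_ne_zero 3 (hp.right_ne_zero τ))
    · intro τ
      have h0 := τ.ne_zero
      have hr := hp.right_ne_zero τ
      have hl := hp.left_ne_zero τ
      set w : ℂ := -I * (√((3 : ℕ) : ℝ) : ℝ) * τ with hw
      have hw2 : w ^ 2 = -3 * τ ^ 2 := by
        rw [hw, mul_pow, mul_pow, neg_sq, I_sq, hs]
        ring
      have hw0 : w ≠ 0 := fun h ↦ by
        rw [h] at hw2
        norm_num at hw2
        exact h0 hw2
      have hE : eisTwo 3 (fricke 3 • τ) = w ^ 2 * eisTwo 3 τ := by
        rw [eisTwo_fricke, hw2]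
        norm_num
      simp only [hnum, Pi.div_apply, Pi.sub_apply, Pi.add_apply, Pi.mul_apply, Pi.pow_apply,
        hp.left_fricke, hp.right_fricke, hE, ← hw]
      field_simp
      ring
  have h1 := congrFun key τ
  simp only [Pi.div_apply, Pi.pow_apply, Pi.zero_apply, hnum, Pi.sub_apply, Pi.add_apply,
    Pi.mul_apply, div_eq_zero_iff] at h1
  rcases h1 with h1 | h1
  · linear_combination h1
  · exact absurd h1 (mul_ne_zero (pow_ne_zero 3 (hp.left_ne_zero τ))
      (pow_ne_zero 3 (hp.right_ne_zero τ)))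

/-! ### A square root of the Eisenstein series of level three -/

/-- If `e ^ 3 = g ^ 2` for analytic functions, then `g / e` is analytic even at an isolated zero
of `e`: its square is `e`, so that it is continuous there with value `0 = g / 0`. -/
lemma analyticAt_div_of_cube_eq_sq {e g : ℂ → ℂ} {z : ℂ} (he : AnalyticAt ℂ e z)
    (hg : AnalyticAt ℂ g z) (h0 : ∀ᶠ w in 𝓝[≠] z, e w ≠ 0) (h : ∀ w, e w ^ 3 = g w ^ 2) :
    AnalyticAt ℂ (g / e) z := by
  by_cases hz : e z = 0
  · have hsq : ∀ w, (g / e) w ^ 2 = e w := fun w ↦ by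
      rw [Pi.div_apply, div_pow, ← h]
      by_cases hw : e w = 0
      · simp [hw]
      · field_simp
    refine Complex.analyticAt_of_differentiable_on_punctured_nhds_of_continuousAt ?_ ?_
    · have h1 := he.eventually_analyticAt.filter_mono (nhdsWithin_le_nhds (s := {z}ᶜ))
      have h2 := hg.eventually_analyticAt.filter_mono (nhdsWithin_le_nhds (s := {z}ᶜ))
      filter_upwards [h0, h1, h2] with w hw hew hgw
      exact (hgw.div hew hw).differentiableAt
    · have hval : (g / e) z = 0 := by rw [Pi.div_apply, hz, div_zero]
      have hlim : Tendsto (fun w ↦ √‖e w‖) (𝓝 z) (𝓝 0) := by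
        have := (Real.continuous_sqrt.continuousAt.comp he.continuousAt.norm).tendsto
        simpa [hz, Function.comp_def] using this
      rw [ContinuousAt, hval]
      refine tendsto_zero_iff_norm_tendsto_zero.mpr (hlim.congr fun w ↦ ?_)
      rw [← hsq w, norm_pow, Real.sqrt_sq (norm_nonneg _)]
  · exact hg.div he hz

/-- A holomorphic function on the upper half plane that is not identically zero has isolated
zeros. -/
lemma eventually_ne_zero_of_mdifferentiable {f : ℍ → ℂ} (hf : MDifferentiable 𝓘(ℂ) 𝓘(ℂ) f)
    {τ₁ : ℍ} (h1 : f τ₁ ≠ 0) {z : ℂ} (hz : 0 < z.im) :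
    ∀ᶠ w in 𝓝[≠] z, (f ∘ ofComplex) w ≠ 0 := by
  have hU : AnalyticOnNhd ℂ (f ∘ ofComplex) {z : ℂ | 0 < z.im} :=
    fun w hw ↦ analyticAt_comp_ofComplex hf hw
  refine ((hU z hz).eventually_eq_zero_or_eventually_ne_zero).resolve_left fun h ↦ h1 ?_
  have hconv : Convex ℝ {z : ℂ | 0 < z.im} := convex_halfSpace_im_gt 0
  have := hU.eqOn_zero_of_preconnected_of_eventuallyEq_zero hconv.isPreconnected hz h
    (show (τ₁ : ℂ) ∈ {z : ℂ | 0 < z.im} from τ₁.im_pos)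
  simpa using this

/-- The sum `ℬ³ + 𝒞³` in level three. -/
def cubeSum : ℍ → ℂ := B3 ^ 3 + C3 ^ 3

/-- The single-valued representation of `𝒜₃`: the square root of the Eisenstein series of level
three, realised as the quotient `𝒜₃³ / 𝒜₃²`. At zeros of the denominator the
convention `0 / 0 = 0` gives the right value. -/
def cubicA : ℍ → ℂ := cubeSum / eisTwo 3

lemma eisTwo_three_cube' (τ : ℍ) : eisTwo 3 τ ^ 3 = cubeSum τ ^ 2 := eisTwo_three_cube τ

lemma cubicA_sq (τ : ℍ) : cubicA τ ^ 2 = eisTwo 3 τ := by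
  rw [cubicA, Pi.div_apply, div_pow, ← eisTwo_three_cube']
  by_cases hw : eisTwo 3 τ = 0
  · simp [hw]
  · field_simp

lemma cubicA_cube (τ : ℍ) : cubicA τ ^ 3 = cubeSum τ := by
  rw [pow_succ, cubicA_sq, cubicA, Pi.div_apply]
  by_cases hw : eisTwo 3 τ = 0
  · have := eisTwo_three_cube' τ
    rw [hw, zero_pow three_ne_zero, eq_comm, sq_eq_zero_iff] at this
    simp [hw, this]
  · field_simp

lemma eisTwo_ne_zero {N : ℕ} [NeZero N] (hN : 2 ≤ N) : ∃ τ, eisTwo N τ ≠ 0 :=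
  ((tendsto_eisTwo hN).eventually_ne one_ne_zero).exists

lemma mdifferentiable_cubicA : MDifferentiable 𝓘(ℂ) 𝓘(ℂ) cubicA := by
  have hG : MDifferentiable 𝓘(ℂ) 𝓘(ℂ) cubeSum := mdifferentiable_add
    (mdifferentiable_pow frickePair_three.holo_left 3)
    (mdifferentiable_pow frickePair_three.holo_right 3)
  obtain ⟨τ₁, h1⟩ := eisTwo_ne_zero (N := 3) (by norm_num)
  rw [UpperHalfPlane.mdifferentiable_iff]
  intro z hz
  refine AnalyticAt.differentiableWithinAt (analyticAt_div_of_cube_eq_sq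
    (analyticAt_comp_ofComplex (mdifferentiable_eisTwo 3) hz) (analyticAt_comp_ofComplex hG hz)
    (eventually_ne_zero_of_mdifferentiable (mdifferentiable_eisTwo 3) h1 hz)
    fun w ↦ eisTwo_three_cube' (ofComplex w))

lemma tendsto_cubicA : Tendsto cubicA atImInfty (𝓝 1) := by
  have h1 := tendsto_eulerProd_nome one_ne_zero
  have h3 := tendsto_eulerProd_nome three_ne_zero
  have hB := (h1.pow 9).div (h3.pow 3) (by norm_num)
  have hC := ((tendsto_nome.const_mul 27).mul (h3.pow 9)).div (h1.pow 3) (by norm_num)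
  have := (hB.add hC).div (tendsto_eisTwo (N := 3) (by norm_num)) one_ne_zero
  norm_num at this
  refine this.congr fun τ ↦ ?_
  rw [cubicA, cubeSum]
  simp only [Pi.div_apply, Pi.add_apply, Pi.pow_apply, B3_pow_three_eq, C3_pow_three_eq]

lemma cubicA_vadd_one (τ : ℍ) : cubicA ((1 : ℝ) +ᵥ τ) = cubicA τ := by
  simp only [cubicA, cubeSum, Pi.div_apply, Pi.add_apply, Pi.pow_apply, B3_pow_three_eq,
    C3_pow_three_eq, nome_vadd_one, eisTwo_vadd_one]

lemma cubicA_fricke (τ : ℍ) :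
    cubicA (fricke 3 • τ) = -I * (√((3 : ℕ) : ℝ) : ℝ) * τ * cubicA τ := by
  have hs : (((√((3 : ℕ) : ℝ) : ℝ) : ℂ)) ^ 2 = 3 := ofReal_sqrt_natCast_sq 3
  set w : ℂ := -I * (√((3 : ℕ) : ℝ) : ℝ) * τ with hw
  have hw2 : w ^ 2 = -3 * τ ^ 2 := by
    rw [hw, mul_pow, mul_pow, neg_sq, I_sq, hs]
    ring
  have hw0 : w ≠ 0 := fun h ↦ by
    rw [h] at hw2
    norm_num at hw2
    exact τ.ne_zero hw2
  have hE : eisTwo 3 (fricke 3 • τ) = w ^ 2 * eisTwo 3 τ := by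
    rw [eisTwo_fricke, hw2]
    norm_num
  have hG : cubeSum (fricke 3 • τ) = w ^ 3 * cubeSum τ := by
    simp only [cubeSum, Pi.add_apply, Pi.pow_apply, frickePair_three.left_fricke,
      frickePair_three.right_fricke, ← hw]
    ring
  rw [cubicA, Pi.div_apply, hE, hG, mul_div_mul_comm, Pi.div_apply, pow_succ,
    mul_div_cancel_left₀ _ (pow_ne_zero 2 hw0)]

lemma semiPeriodic_cubicA : SemiPeriodic cubicA :=
  ⟨1, one_ne_zero, fun τ ↦ by rw [cubicA_vadd_one, one_mul]⟩

lemma semiInvariant_cubicA : ∀ γ ∈ Gamma0 3, SemiInvariant 1 cubicA γ := fun γ hγ ↦ by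
  refine semiInvariant_of_mem_Gamma0 (N := 3) (by norm_num) (by norm_num)
    (semiPeriodic_cubicA.semiInvariant 1) ?_ hγ
  rw [slash_fricke_of_apply cubicA_fricke]
  exact (semiPeriodic_cubicA.smul _).semiInvariant 1

lemma hasLeadingExponent_cubicA : HasLeadingExponent cubicA 0 := .of_tendsto one_ne_zero
  tendsto_cubicA

lemma hasLeadingExponent_cubicA_slash_fricke :
    HasLeadingExponent (cubicA ∣[(1 : ℤ)] fricke 3) 0 := by
  rw [slash_fricke_of_apply cubicA_fricke]
  exact hasLeadingExponent_cubicA.smul (fricke_multiplier_ne_zero 3)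

theorem isModularForm_cubicA : IsModularForm (Gamma0 3) 1 cubicA := by
  refine isModularForm_of_prime Nat.prime_three ?_ mdifferentiable_cubicA semiInvariant_cubicA
    (hasLeadingExponent_cubicA.isBoundedAtImInfty le_rfl)
    (hasLeadingExponent_cubicA_slash_fricke.isBoundedAtImInfty le_rfl)
  intro h
  have := tendsto_cubicA
  rw [h] at this
  exact zero_ne_one (tendsto_nhds_unique tendsto_const_nhds this)

/-! ### Zeros of the Eisenstein series in terms of `q` -/

section pow

variable {q q₀ : ℂ} {r : ℝ}

lemma norm_pow_succ_sub_pow_succ_le (hq : ‖q‖ ≤ r) (hq₀ : ‖q₀‖ ≤ r) (m : ℕ) :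
    ‖q ^ (m + 1) - q₀ ^ (m + 1)‖ ≤ (m + 1) * r ^ m * ‖q - q₀‖ := by
  have hr : 0 ≤ r := (norm_nonneg q).trans hq
  induction m with
  | zero => simp
  | succ m ih =>
    have e : q ^ (m + 1 + 1) - q₀ ^ (m + 1 + 1) =
        q * (q ^ (m + 1) - q₀ ^ (m + 1)) + q₀ ^ (m + 1) * (q - q₀) := by ring
    calc ‖q ^ (m + 1 + 1) - q₀ ^ (m + 1 + 1)‖
        ≤ ‖q‖ * ‖q ^ (m + 1) - q₀ ^ (m + 1)‖ + ‖q₀‖ ^ (m + 1) * ‖q - q₀‖ := by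
          rw [e, ← norm_mul, ← norm_pow, ← norm_mul]
          exact norm_add_le _ _
      _ ≤ r * ((m + 1) * r ^ m * ‖q - q₀‖) + r ^ (m + 1) * ‖q - q₀‖ := by gcongr
      _ = ((m + 1 : ℕ) + 1) * r ^ (m + 1) * ‖q - q₀‖ := by
          push_cast
          ring

/-- The remainder of the linear Taylor polynomial of a power. -/
lemma norm_pow_sub_taylor_le (hq : ‖q‖ ≤ r) (hq₀ : ‖q₀‖ ≤ r) (m : ℕ) :
    ‖q ^ (m + 2) - q₀ ^ (m + 2) - (m + 2) * q₀ ^ (m + 1) * (q - q₀)‖ ≤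
      (m + 2) * (m + 1) / 2 * r ^ m * ‖q - q₀‖ ^ 2 := by
  have hr : 0 ≤ r := (norm_nonneg q).trans hq
  induction m with
  | zero =>
    have e : q ^ (0 + 2) - q₀ ^ (0 + 2) - ((0 : ℕ) + 2) * q₀ ^ (0 + 1) * (q - q₀) =
        (q - q₀) ^ 2 := by
      push_cast
      ring
    rw [e, norm_pow]
    simp
  | succ m ih =>
    have e : q ^ (m + 1 + 2) - q₀ ^ (m + 1 + 2) - ((m + 1 : ℕ) + 2) * q₀ ^ (m + 1 + 1) * (q - q₀) =
        q * (q ^ (m + 2) - q₀ ^ (m + 2) - (m + 2) * q₀ ^ (m + 1) * (q - q₀)) +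
          (m + 2 : ℕ) * q₀ ^ (m + 1) * (q - q₀) ^ 2 := by
      push_cast
      ring
    calc _ ≤ ‖q‖ * ‖q ^ (m + 2) - q₀ ^ (m + 2) - (m + 2) * q₀ ^ (m + 1) * (q - q₀)‖ +
          (m + 2 : ℕ) * ‖q₀‖ ^ (m + 1) * ‖q - q₀‖ ^ 2 := by
          rw [e]
          refine (norm_add_le _ _).trans_eq ?_
          rw [norm_mul, norm_mul, norm_mul, norm_pow, norm_pow, Complex.norm_natCast]
      _ ≤ r * ((m + 2) * (m + 1) / 2 * r ^ m * ‖q - q₀‖ ^ 2) +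
          (m + 2 : ℕ) * r ^ (m + 1) * ‖q - q₀‖ ^ 2 := by gcongr
      _ = ((m + 1 : ℕ) + 2) * ((m + 1 : ℕ) + 1) / 2 * r ^ (m + 1) * ‖q - q₀‖ ^ 2 := by
          push_cast
          ring

end pow

lemma hasSum_eisSeries {N : ℕ} (hN : 2 ≤ N) {q : ℂ} (hq : ‖q‖ < 1) :
    HasSum (fun m ↦ eisCoeff N m * q ^ m) (eisSeries N q) :=
  (summable_eisCoeff_mul hN hq).hasSum

/-- The terms of the derivative of the Eisenstein series of level two on `‖q‖ ≤ 1 / 14`, after the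
constant one, are dominated by a geometric series. -/
lemma cube_mul_pow_le (m : ℕ) :
    ((m : ℝ) + 2) ^ 3 * (1 / 14) ^ (m + 1) ≤ 4 / 7 * (1 / 4) ^ m := by
  induction m with
  | zero => norm_num
  | succ m ih =>
    have hm : (0 : ℝ) ≤ m := m.cast_nonneg
    have h1 : ((m : ℝ) + 1 + 2) ^ 3 ≤ 7 / 2 * (m + 2) ^ 3 := by
      have : 0 ≤ 7 / 2 * ((m : ℝ) + 2) ^ 3 - (m + 1 + 2) ^ 3 := by
        ring_nf
        positivity
      linarith
    push_cast
    calc ((m : ℝ) + 1 + 2) ^ 3 * (1 / 14 : ℝ) ^ (m + 1 + 1)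
        ≤ 7 / 2 * ((m : ℝ) + 2) ^ 3 * (1 / 14 : ℝ) ^ (m + 1 + 1) := by gcongr
      _ = 1 / 4 * (((m : ℝ) + 2) ^ 3 * (1 / 14 : ℝ) ^ (m + 1)) := by ring
      _ ≤ 1 / 4 * (4 / 7 * (1 / 4 : ℝ) ^ m) := by gcongr
      _ = 4 / 7 * (1 / 4 : ℝ) ^ (m + 1) := by ring

/-- In the disc `‖q‖ ≤ 1 / 14` the linear term `24 q` dominates the Eisenstein series of level
two, which is therefore injective there. -/
theorem norm_eisSeries_two_sub_le {q q₀ : ℂ} (hq : ‖q‖ ≤ 1 / 14) (hq₀ : ‖q₀‖ ≤ 1 / 14) :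
    5 * ‖q - q₀‖ ≤ ‖eisSeries 2 q - eisSeries 2 q₀‖ := by
  have hs := (hasSum_eisSeries (N := 2) le_rfl (hq.trans_lt (by norm_num))).sub
    (hasSum_eisSeries (N := 2) le_rfl (hq₀.trans_lt (by norm_num)))
  rw [← hasSum_nat_add_iff' 2] at hs
  have hb : HasSum (fun m : ℕ ↦ 24 * ‖q - q₀‖ * (4 / 7 * (1 / 4 : ℝ) ^ m))
      (24 * ‖q - q₀‖ * (4 / 7 * (1 - 1 / 4)⁻¹)) :=
    ((hasSum_geometric_of_lt_one (by norm_num) (by norm_num)).mul_left _).mul_left _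
  have h := hs.norm_le_of_bounded hb fun m ↦ by
    have h1 := norm_eisCoeff_le (N := 2) (m := m + 2) le_rfl (by omega)
    have h2 := norm_pow_succ_sub_pow_succ_le hq hq₀ (m + 1)
    have h3 := cube_mul_pow_le m
    push_cast at h1 h2
    rw [← mul_sub, norm_mul]
    calc _ ≤ (24 / (2 - 1) * ((m : ℝ) + 2) ^ 2) *
          ((m + 1 + 1) * (1 / 14) ^ (m + 1) * ‖q - q₀‖) := by gcongr
      _ = 24 * ‖q - q₀‖ * ((m + 2) ^ 3 * (1 / 14) ^ (m + 1)) := by ring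
      _ ≤ _ := by gcongr
  simp only [Finset.sum_range_succ, Finset.sum_range_zero, eisCoeff_zero le_rfl,
    eisCoeff_one le_rfl] at h
  norm_num at h
  have h4 : ‖24 * (q - q₀)‖ ≤ ‖eisSeries 2 q - eisSeries 2 q₀‖ +
      ‖eisSeries 2 q - eisSeries 2 q₀ - (24 * q - 24 * q₀)‖ := by
    rw [mul_sub]
    exact norm_le_norm_add_norm_sub _ _
  rw [norm_mul, Complex.norm_ofNat] at h4
  linarith [norm_nonneg (q - q₀)]

/-- The terms of half the second derivative of the Eisenstein series of level three on
`‖q‖ ≤ 1 / 6`, from `q ^ 6` on, are dominated by a geometric series. -/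
lemma quartic_mul_pow_le (m : ℕ) :
    6 * ((m : ℝ) + 6) ^ 3 * (m + 5) * (1 / 6) ^ (m + 4) ≤ 5 * (1 / 2) ^ m := by
  induction m with
  | zero => norm_num
  | succ m ih =>
    have hm : (0 : ℝ) ≤ m := m.cast_nonneg
    have h1 : ((m : ℝ) + 1 + 6) ^ 3 * (m + 1 + 5) ≤ 3 * ((m + 6) ^ 3 * (m + 5)) := by
      have : 0 ≤ 3 * (((m : ℝ) + 6) ^ 3 * (m + 5)) - (m + 1 + 6) ^ 3 * (m + 1 + 5) := by
        ring_nf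
        positivity
      linarith
    push_cast
    calc 6 * ((m : ℝ) + 1 + 6) ^ 3 * (m + 1 + 5) * (1 / 6 : ℝ) ^ (m + 1 + 4)
        = 6 * (((m : ℝ) + 1 + 6) ^ 3 * (m + 1 + 5)) * (1 / 6 : ℝ) ^ (m + 1 + 4) := by ring
      _ ≤ 6 * (3 * (((m : ℝ) + 6) ^ 3 * (m + 5))) * (1 / 6 : ℝ) ^ (m + 1 + 4) := by gcongr
      _ = 1 / 2 * (6 * ((m : ℝ) + 6) ^ 3 * (m + 5) * (1 / 6 : ℝ) ^ (m + 4)) := by ring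
      _ ≤ 1 / 2 * (5 * (1 / 2 : ℝ) ^ m) := by gcongr
      _ = 5 * (1 / 2 : ℝ) ^ (m + 1) := by ring

lemma eisCoeff_three_two : eisCoeff 3 2 = 36 := by
  have : ∑ d ∈ Nat.divisors 2, d = 3 := by decide
  rw [eisCoeff_of_not_dvd (by norm_num) (by norm_num), this]
  norm_num

lemma eisCoeff_three_three : eisCoeff 3 3 = 12 := by
  have h3 : ArithmeticFunction.sigma 1 3 = 4 := by decide +kernel
  rw [eisCoeff, e2Coeff, e2Coeff, h3]
  norm_num

lemma eisCoeff_three_four : eisCoeff 3 4 = 84 := by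
  have : ∑ d ∈ Nat.divisors 4, d = 7 := by decide
  rw [eisCoeff_of_not_dvd (by norm_num) (by norm_num), this]
  norm_num

lemma eisCoeff_three_five : eisCoeff 3 5 = 72 := by
  have : ∑ d ∈ Nat.divisors 5, d = 6 := by decide
  rw [eisCoeff_of_not_dvd (by norm_num) (by norm_num), this]
  norm_num

lemma summable_deriv_eisSeries_three {q₀ : ℂ} (hq₀ : ‖q₀‖ ≤ 1 / 6) :
    Summable fun m : ℕ ↦ eisCoeff 3 m * (m * q₀ ^ (m - 1)) := by
  have hsum := (summable_pow_mul_geometric_of_norm_lt_one 3 (r := (1 / 6 : ℝ))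
    (by norm_num)).mul_left 72
  refine .of_norm_bounded hsum fun m ↦ ?_
  rcases m with _ | m
  · simp
  have h1 := norm_eisCoeff_le (N := 3) (m := m + 1) (by norm_num) (by omega)
  push_cast at h1
  rw [norm_mul, norm_mul, norm_pow, Complex.norm_natCast, Nat.add_sub_cancel]
  push_cast
  calc _ ≤ (24 / (3 - 1) * ((m : ℝ) + 1) ^ 2) * ((m + 1) * (1 / 6) ^ m) := by gcongr
    _ = _ := by ring

/-- In the disc `‖q‖ ≤ 1 / 6` the quadratic term `36 q²` dominates the remainder of the first
Taylor polynomial of the Eisenstein series of level three. In the bound `100 / 3 < 36` the terms of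
degree `3`, `4` and `5` contribute `6`, `14` and `10 / 3`, and the higher ones `10`. -/
theorem norm_eisSeries_three_sub_taylor_le {q₀ : ℂ} (hq₀ : ‖q₀‖ ≤ 1 / 6) :
    ∃ D : ℂ, ∀ q, ‖q‖ ≤ 1 / 6 →
      ‖eisSeries 3 q - eisSeries 3 q₀ - D * (q - q₀) - 36 * (q - q₀) ^ 2‖ ≤
        100 / 3 * ‖q - q₀‖ ^ 2 := by
  refine ⟨∑' m : ℕ, eisCoeff 3 m * (m * q₀ ^ (m - 1)), fun q hq ↦ ?_⟩
  have hs := ((hasSum_eisSeries (N := 3) (by norm_num) (hq.trans_lt (by norm_num))).sub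
    (hasSum_eisSeries (N := 3) (by norm_num) (hq₀.trans_lt (by norm_num)))).sub
    ((summable_deriv_eisSeries_three hq₀).hasSum.mul_right (q - q₀))
  rw [← hasSum_nat_add_iff' 6] at hs
  set D := ∑' m : ℕ, eisCoeff 3 m * (m * q₀ ^ (m - 1))
  have hb : HasSum (fun m : ℕ ↦ ‖q - q₀‖ ^ 2 * (5 * (1 / 2 : ℝ) ^ m))
      (‖q - q₀‖ ^ 2 * (5 * (1 - 1 / 2)⁻¹)) :=
    ((hasSum_geometric_of_lt_one (by norm_num) (by norm_num)).mul_left _).mul_left _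
  have h := hs.norm_le_of_bounded hb fun m ↦ by
    have h1 := norm_eisCoeff_le (N := 3) (m := m + 6) (by norm_num) (by omega)
    have h2 := norm_pow_sub_taylor_le hq hq₀ (m + 4)
    have h3 := quartic_mul_pow_le m
    have e : m + 6 - 1 = m + 4 + 1 := by omega
    have e' : eisCoeff 3 (m + 6) * q ^ (m + 6) - eisCoeff 3 (m + 6) * q₀ ^ (m + 6) -
        eisCoeff 3 (m + 6) * ((m + 6 : ℕ) * q₀ ^ (m + 6 - 1)) * (q - q₀) =
        eisCoeff 3 (m + 6) * (q ^ (m + 4 + 2) - q₀ ^ (m + 4 + 2) -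
          ((m + 4 : ℕ) + 2) * q₀ ^ (m + 4 + 1) * (q - q₀)) := by
      rw [e]
      push_cast
      ring
    rw [e', norm_mul]
    push_cast at h1 h2 ⊢
    calc _ ≤ (24 / (3 - 1) * ((m : ℝ) + 6) ^ 2) *
          ((m + 4 + 2) * (m + 4 + 1) / 2 * (1 / 6) ^ (m + 4) * ‖q - q₀‖ ^ 2) := by gcongr
      _ = ‖q - q₀‖ ^ 2 * (6 * (m + 6) ^ 3 * (m + 5) * (1 / 6) ^ (m + 4)) := by ring
      _ ≤ _ := by gcongr
  have h3 := norm_pow_sub_taylor_le hq hq₀ 1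
  have h4 := norm_pow_sub_taylor_le hq hq₀ 2
  have h5 := norm_pow_sub_taylor_le hq hq₀ 3
  simp only [Finset.sum_range_succ, Finset.sum_range_zero, eisCoeff_zero (N := 3) (by norm_num),
    eisCoeff_one (N := 3) (by norm_num), eisCoeff_three_two, eisCoeff_three_three,
    eisCoeff_three_four, eisCoeff_three_five] at h
  have key : eisSeries 3 q - eisSeries 3 q₀ - D * (q - q₀) - 36 * (q - q₀) ^ 2 =
      (eisSeries 3 q - eisSeries 3 q₀ - D * (q - q₀) - (12 * (q - q₀) +
        36 * (q ^ 2 - q₀ ^ 2) + 12 * (q ^ 3 - q₀ ^ 3) + 84 * (q ^ 4 - q₀ ^ 4) +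
        72 * (q ^ 5 - q₀ ^ 5) - (12 + 72 * q₀ + 36 * q₀ ^ 2 + 336 * q₀ ^ 3 + 360 * q₀ ^ 4) *
        (q - q₀))) +
      12 * (q ^ (1 + 2) - q₀ ^ (1 + 2) - ((1 : ℕ) + 2) * q₀ ^ (1 + 1) * (q - q₀)) +
      84 * (q ^ (2 + 2) - q₀ ^ (2 + 2) - ((2 : ℕ) + 2) * q₀ ^ (2 + 1) * (q - q₀)) +
      72 * (q ^ (3 + 2) - q₀ ^ (3 + 2) - ((3 : ℕ) + 2) * q₀ ^ (3 + 1) * (q - q₀)) := by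
    push_cast
    ring
  have h' : ‖eisSeries 3 q - eisSeries 3 q₀ - D * (q - q₀) - (12 * (q - q₀) +
        36 * (q ^ 2 - q₀ ^ 2) + 12 * (q ^ 3 - q₀ ^ 3) + 84 * (q ^ 4 - q₀ ^ 4) +
        72 * (q ^ 5 - q₀ ^ 5) - (12 + 72 * q₀ + 36 * q₀ ^ 2 + 336 * q₀ ^ 3 + 360 * q₀ ^ 4) *
        (q - q₀))‖ ≤ 10 * ‖q - q₀‖ ^ 2 := by
    refine (le_of_eq ?_).trans (h.trans_eq (by ring))
    congr 1
    norm_num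
    ring
  rw [key]
  refine (norm_add_le _ _).trans ?_
  refine (add_le_add_left ((norm_add_le _ _).trans
    (add_le_add_left (norm_add_le _ _) _)) _).trans ?_
  rw [norm_mul, norm_mul, norm_mul]
  norm_num at h3 h4 h5 h' ⊢
  linarith

/-! ### Orders of vanishing and stabilizers along an orbit -/

/-- The order of vanishing is constant along an orbit, as the automorphy factor has no zeros. -/
lemma analyticOrderAt_smul_of_semiInvariant {k : ℤ} {f : ℍ → ℂ}
    (hf : MDifferentiable 𝓘(ℂ) 𝓘(ℂ) f) {γ : SL(2, ℤ)} (h : SemiInvariant k f γ) (τ : ℍ) :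
    analyticOrderAt (f ∘ ofComplex) (γ • τ : ℍ) = analyticOrderAt (f ∘ ofComplex) τ := by
  obtain ⟨c, hc, h⟩ := h
  set g : GL (Fin 2) ℝ := Matrix.SpecialLinearGroup.mapGL ℝ γ
  have hg : 0 < g.det.val := by
    rw [Matrix.SpecialLinearGroup.det_mapGL]
    exact one_pos
  set u : ℍ → ℂ := fun τ ↦ c * denom g τ ^ k with hu
  have hu0 : ∀ τ, u τ ≠ 0 := fun τ ↦ mul_ne_zero hc (zpow_ne_zero _ (denom_ne_zero g τ))
  have hu1 : MDifferentiable 𝓘(ℂ) 𝓘(ℂ) u :=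
    mdifferentiable_mul (f := fun _ ↦ c) mdifferentiable_const (mdifferentiable_denom_zpow g k)
  have hfg : ∀ τ : ℍ, f (g • τ) = u τ * f τ := fun τ ↦ by
    have := congrFun h τ
    rw [ModularForm.SL_slash_apply, Pi.smul_apply, smul_eq_mul] at this
    have hd := denom_ne_zero g τ
    have hd' := zpow_ne_zero k hd
    change f (g • τ) * denom g τ ^ (-k) = _ at this
    rw [zpow_neg, mul_inv_eq_iff_eq_mul₀ hd'] at this
    rw [this]
    ring
  have hcomp : (f ∘ ofComplex) ∘ (fun z ↦ ((g • ofComplex z : ℍ) : ℂ)) =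
      (u ∘ ofComplex) * (f ∘ ofComplex) := by
    ext z
    simp [hfg]
  have h1 := analyticOrderAt_comp_of_deriv_ne_zero (f := f ∘ ofComplex)
    (UpperHalfPlane.analyticAt_smul hg τ) (UpperHalfPlane.deriv_smul_ne_zero hg τ)
  rw [hcomp, analyticOrderAt_mul (analyticAt_comp_ofComplex hu1 τ.im_pos)
    (analyticAt_comp_ofComplex hf τ.im_pos),
    (analyticAt_comp_ofComplex hu1 τ.im_pos).analyticOrderAt_eq_zero.mpr (by simpa using hu0 τ),
    zero_add, ofComplex_apply] at h1
  exact h1.symm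

lemma ramification_eq_of_equivalent {Γ : Subgroup SL(2, ℤ)} {τ τ' : ℍ}
    (h : HStar.Equivalent Γ (.pt τ) (.pt τ')) : ramification Γ τ' = ramification Γ τ := by
  obtain ⟨γ, hγ, h⟩ := h
  have h : τ' = (⟨γ, hγ⟩ : Γ) • τ := (HStar.pt.inj h).symm
  rw [ramification, ramification,
    Nat.card_congr (MulAction.stabilizerEquivStabilizer h).toEquiv]

lemma smul_eq_self_iff (γ : SL(2, ℤ)) (τ : ℍ) : γ • τ = τ ↔
    (γ 0 0 : ℂ) * τ + γ 0 1 = τ * (γ 1 0 * τ + γ 1 1) := by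
  have hd := denom_ne_zero γ τ
  rw [ModularGroup.denom_apply] at hd
  rw [← UpperHalfPlane.coe_inj, UpperHalfPlane.coe_specialLinearGroup_apply]
  simp only [algebraMap_int_eq, eq_intCast, ofReal_intCast]
  rw [div_eq_iff hd]

lemma intCast_mul_add_eq_zero {x y : ℤ} {τ : ℍ} (h : (x : ℂ) * τ + y = 0) : x = 0 ∧ y = 0 := by
  have h1 := congrArg Complex.im h
  have h2 := τ.im_pos.ne'
  simp [h2] at h1
  subst h1
  simpa using h

/-- If `N τ² - N τ + 1 = 0`, then an element of `Γ₀(N)` fixing `τ` has the form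
`(a, -k; N k, a - N k)`. -/
lemma entries_of_smul_eq_self {N : ℕ} {τ : ℍ} (hτ : (N : ℂ) * τ ^ 2 - N * τ + 1 = 0)
    {γ : SL(2, ℤ)} (hγ : γ ∈ Gamma0 N) (hs : γ • τ = τ) :
    γ 1 0 = -N * γ 0 1 ∧ γ 1 1 = γ 0 0 + N * γ 0 1 := by
  obtain ⟨k, hk⟩ := mem_Gamma0_iff_dvd.mp hγ
  have hs' := (smul_eq_self_iff γ τ).mp hs
  obtain ⟨h1, h2⟩ := intCast_mul_add_eq_zero (x := γ 0 0 - N * k - γ 1 1) (y := γ 0 1 + k)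
    (τ := τ) (by
      rw [hk] at hs'
      push_cast at hs' ⊢
      linear_combination hs' + (k : ℂ) * hτ)
  have h01 : γ 0 1 = -k := by linarith
  rw [h01, hk]
  constructor <;> linarith

/-- If `N τ² - N τ + 1 = 0`, then the stabilizer of `τ` in `Γ₀(N)` consists of the matrices
`(a, -k; N k, a - N k)`, whose determinant is a binary quadratic form. -/
lemma card_stabilizer_eq {N : ℕ} {τ : ℍ} (hτ : (N : ℂ) * τ ^ 2 - N * τ + 1 = 0) :
    Nat.card (MulAction.stabilizer (Gamma0 N) τ) =
      Nat.card {p : ℤ × ℤ // p.1 ^ 2 - N * p.1 * p.2 + N * p.2 ^ 2 = 1} := by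
  have hent : ∀ γ : MulAction.stabilizer (Gamma0 N) τ,
      (γ : SL(2, ℤ)) 1 0 = -N * (γ : SL(2, ℤ)) 0 1 ∧
        (γ : SL(2, ℤ)) 1 1 = (γ : SL(2, ℤ)) 0 0 + N * (γ : SL(2, ℤ)) 0 1 := fun γ ↦
    entries_of_smul_eq_self hτ γ.1.2 (MulAction.mem_stabilizer_iff.mp γ.2)
  refine Nat.card_congr (Equiv.ofBijective
    (fun γ ↦ ⟨((γ : SL(2, ℤ)) 0 0, -(γ : SL(2, ℤ)) 0 1), ?_⟩) ⟨?_, ?_⟩)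
  · obtain ⟨h1, h2⟩ := hent γ
    have hdet := (γ : SL(2, ℤ)).det_coe
    rw [Matrix.det_fin_two, h1, h2] at hdet
    change (γ : SL(2, ℤ)) 0 0 ^ 2 - N * (γ : SL(2, ℤ)) 0 0 * (-(γ : SL(2, ℤ)) 0 1) +
      N * (-(γ : SL(2, ℤ)) 0 1) ^ 2 = 1
    linarith
  · intro γ γ' h
    obtain ⟨h1, h2⟩ := hent γ
    obtain ⟨h1', h2'⟩ := hent γ'
    have h := Subtype.ext_iff.mp h
    have e0 : (γ : SL(2, ℤ)) 0 0 = (γ' : SL(2, ℤ)) 0 0 := (Prod.ext_iff.mp h).1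
    have e1 : (γ : SL(2, ℤ)) 0 1 = (γ' : SL(2, ℤ)) 0 1 := neg_injective (Prod.ext_iff.mp h).2
    refine Subtype.ext (Subtype.ext (Matrix.SpecialLinearGroup.ext _ _ fun i j ↦ ?_))
    fin_cases i <;> fin_cases j
    · exact e0
    · exact e1
    · exact h1.trans ((congrArg _ e1).trans h1'.symm)
    · exact h2.trans ((congrArg₂ _ e0 (congrArg _ e1)).trans h2'.symm)
  · rintro ⟨⟨a, k⟩, hp⟩
    obtain ⟨γ, h⟩ : ∃ γ : SL(2, ℤ), (γ : Matrix (Fin 2) (Fin 2) ℤ) =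
        !![a, -k; N * k, a - N * k] := ⟨⟨_, by
      rw [Matrix.det_fin_two_of]
      change a ^ 2 - N * a * k + N * k ^ 2 = 1 at hp
      linarith⟩, rfl⟩
    have h00 : γ 0 0 = a := by rw [h]; rfl
    have h01 : γ 0 1 = -k := by rw [h]; rfl
    have h10 : γ 1 0 = N * k := by rw [h]; rfl
    have h11 : γ 1 1 = a - N * k := by rw [h]; rfl
    have hγ : γ ∈ Gamma0 N := mem_Gamma0_iff_dvd.mpr ⟨k, h10⟩
    have hs : γ • τ = τ := by
      rw [smul_eq_self_iff, h00, h01, h10, h11]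
      push_cast
      linear_combination (-(k : ℂ)) * hτ
    refine ⟨⟨⟨γ, hγ⟩, MulAction.mem_stabilizer_iff.mpr hs⟩, Subtype.ext (Prod.ext h00 ?_)⟩
    change -γ 0 1 = k
    rw [h01, neg_neg]

lemma ellipticTwo_eq : ((2 : ℕ) : ℂ) * ellipticTwo ^ 2 - (2 : ℕ) * ellipticTwo + 1 = 0 := by
  have : (ellipticTwo : ℂ) = ⟨1 / 2, 1 / 2⟩ := rfl
  rw [this]
  apply Complex.ext <;>
  · simp [pow_two]
    try norm_num

lemma ellipticThree_eq :
    ((3 : ℕ) : ℂ) * ellipticThree ^ 2 - (3 : ℕ) * ellipticThree + 1 = 0 := by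
  have : (ellipticThree : ℂ) = ⟨1 / 2, √3 / 6⟩ := rfl
  have h3 : √(3 : ℝ) * √3 = 3 := Real.mul_self_sqrt (by norm_num)
  rw [this]
  apply Complex.ext
  · simp [pow_two]
    linear_combination (-1 / 12) * h3
  · simp [pow_two]
    ring

lemma ramification_ellipticTwo : ramification (Gamma0 2) ellipticTwo = 2 := by
  have hset : {p : ℤ × ℤ | p.1 ^ 2 - (2 : ℕ) * p.1 * p.2 + (2 : ℕ) * p.2 ^ 2 = 1} =
      (({(1, 0), (-1, 0), (1, 1), (-1, -1)} : Finset (ℤ × ℤ)) : Set (ℤ × ℤ)) := by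
    ext ⟨a, k⟩
    simp only [Set.mem_ofPred_eq, Finset.coe_insert, Finset.coe_singleton, Set.mem_insert_iff,
      Set.mem_singleton_iff, Prod.mk.injEq]
    constructor
    · intro h
      push_cast at h
      have hk1 : k ≤ 1 := by nlinarith [sq_nonneg (a - k)]
      have hk2 : -1 ≤ k := by nlinarith [sq_nonneg (a - k)]
      have ha1 : a - k ≤ 1 := by nlinarith [sq_nonneg k]
      have ha2 : -1 ≤ a - k := by nlinarith [sq_nonneg k]
      obtain ⟨b, rfl⟩ : ∃ b, a = b + k := ⟨a - k, by ring⟩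
      have hb1 : b ≤ 1 := by linarith
      have hb2 : -1 ≤ b := by linarith
      interval_cases k <;> interval_cases b <;> simp_all
    · rintro (⟨rfl, rfl⟩ | ⟨rfl, rfl⟩ | ⟨rfl, rfl⟩ | ⟨rfl, rfl⟩) <;> norm_num
  rw [ramification, card_stabilizer_eq ellipticTwo_eq, ← Set.coe_ofPred, hset, Nat.card_coe_set_eq,
    Set.ncard_coe_finset, show Finset.card _ = 4 from by decide]
  norm_num

lemma ramification_ellipticThree : ramification (Gamma0 3) ellipticThree = 3 := by
  have hset : {p : ℤ × ℤ | p.1 ^ 2 - (3 : ℕ) * p.1 * p.2 + (3 : ℕ) * p.2 ^ 2 = 1} =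
      (({(1, 0), (-1, 0), (1, 1), (2, 1), (-1, -1), (-2, -1)} : Finset (ℤ × ℤ)) :
        Set (ℤ × ℤ)) := by
    ext ⟨a, k⟩
    simp only [Set.mem_ofPred_eq, Finset.coe_insert, Finset.coe_singleton, Set.mem_insert_iff,
      Set.mem_singleton_iff, Prod.mk.injEq]
    constructor
    · intro h
      push_cast at h
      have hk1 : k ≤ 1 := by nlinarith [sq_nonneg (2 * a - 3 * k)]
      have hk2 : -1 ≤ k := by nlinarith [sq_nonneg (2 * a - 3 * k)]
      have ha1 : a ≤ 2 := by nlinarith [sq_nonneg (2 * k - a)]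
      have ha2 : -2 ≤ a := by nlinarith [sq_nonneg (2 * k - a)]
      interval_cases k <;> interval_cases a <;> simp_all
    · rintro (⟨rfl, rfl⟩ | ⟨rfl, rfl⟩ | ⟨rfl, rfl⟩ | ⟨rfl, rfl⟩ | ⟨rfl, rfl⟩ | ⟨rfl, rfl⟩) <;>
        norm_num
  rw [ramification, card_stabilizer_eq ellipticThree_eq, ← Set.coe_ofPred, hset, Nat.card_coe_set_eq,
    Set.ncard_coe_finset, show Finset.card _ = 6 from by decide]
  norm_num

/-! ### The zeros of the Eisenstein series -/

/-- Every orbit of `Γ₀(N)`, `N` prime, meets the standard fundamental domain of `SL(2, ℤ)` or its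
image under `τ ↦ (τ + j) / N` followed by the Fricke involution. -/
lemma exists_reduced {N : ℕ} [NeZero N] (hN : N.Prime) (τ : ℍ) :
    ∃ γ ∈ Gamma0 N, ∃ τ' : ℍ, 3 ≤ 4 * (N * τ'.im) ^ 2 ∧
      (τ = γ • τ' ∨ τ = γ • (fricke N • τ')) := by
  obtain ⟨g, hg⟩ := exists_smul_mem_fd τ
  have him := three_le_four_mul_im_sq_of_mem_fd hg
  rcases mem_Gamma0_or_isCoprime hN g⁻¹ with h | h
  · refine ⟨g⁻¹, h, g • τ, ?_, .inl (inv_smul_smul g τ).symm⟩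
    have h1 : (1 : ℝ) ≤ N := by exact_mod_cast hN.one_le
    have h2 := (g • τ).im_pos
    have h3 : (g • τ).im ≤ N * (g • τ).im := le_mul_of_one_le_left h2.le h1
    nlinarith
  · obtain ⟨γ, hγ, j, hj⟩ := exists_eq_mul_S_mul_T_zpow h
    refine ⟨γ, hγ, shiftDiv N j (g • τ), ?_, .inr ?_⟩
    · have : (N : ℝ) ≠ 0 := NeZero.ne _
      rw [im_shiftDiv, mul_div_cancel₀ _ this]
      exact him
    · rw [← S_smul_T_zpow_smul, ← mul_smul, ← mul_assoc, ← hj, inv_smul_smul]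

lemma exists_vadd_of_nome_eq {τ τ' : ℍ} (h : nome τ = nome τ') :
    ∃ n : ℤ, τ = (n : ℝ) +ᵥ τ' := by
  rw [nome, nome, Complex.exp_eq_exp_iff_exists_int] at h
  obtain ⟨n, hn⟩ := h
  refine ⟨n, UpperHalfPlane.ext ?_⟩
  have h0 : (2 * Real.pi * I : ℂ) ≠ 0 := Complex.two_pi_I_ne_zero
  have h1 : (2 * Real.pi * I : ℂ) * τ = (2 * Real.pi * I) * (n + τ') := by linear_combination hn
  rw [coe_vadd, mul_left_cancel₀ h0 h1]
  push_cast
  rfl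

/-- The root of `N τ² - N τ + 1 = 0` is moved by the Fricke involution in the same way as by a
translation. -/
lemma vadd_fricke_smul_eq {N : ℕ} [NeZero N] {τ₀ : ℍ} (h₀ : (N : ℂ) * τ₀ ^ 2 - N * τ₀ + 1 = 0) :
    (1 : ℝ) +ᵥ (fricke N • τ₀) = τ₀ := by
  have h1 : (N : ℂ) ≠ 0 := NeZero.ne _
  have h2 := τ₀.ne_zero
  refine UpperHalfPlane.ext ?_
  rw [coe_vadd, coe_fricke_smul]
  push_cast
  field_simp
  linear_combination -h₀

/-- The Eisenstein series is invariant under translation, and is multiplied by `-N τ ^ 2` under the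
Fricke involution. Where both have the same effect it must vanish, unless `-N τ ^ 2 = 1`. -/
lemma eisTwo_eq_zero_of_root {N : ℕ} [NeZero N] {τ₀ : ℍ}
    (h₀ : (N : ℂ) * τ₀ ^ 2 - N * τ₀ + 1 = 0) : eisTwo N τ₀ = 0 := by
  have h1 := eisTwo_vadd_one N (fricke N • τ₀)
  rw [vadd_fricke_smul_eq h₀, eisTwo_fricke] at h1
  have h2 : (N : ℂ) * τ₀ * eisTwo N τ₀ = 0 := by linear_combination h1 - eisTwo N τ₀ * h₀
  exact (mul_eq_zero.mp h2).resolve_left (mul_ne_zero (NeZero.ne _) τ₀.ne_zero)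

lemma eisTwo_smul_eq_zero_iff {N : ℕ} [NeZero N] (h2 : 2 ≤ N) (h4 : N ≤ 4) {γ : SL(2, ℤ)}
    (hγ : γ ∈ Gamma0 N) (τ : ℍ) : eisTwo N (γ • τ) = 0 ↔ eisTwo N τ = 0 := by
  have h := congrFun (eisTwo_slash_eq h2 h4 hγ) τ
  rw [ModularForm.SL_slash_apply] at h
  rw [← h, mul_eq_zero, or_iff_left (zpow_ne_zero _ (denom_ne_zero _ _))]

/-- The zeros of the Eisenstein series form one orbit, provided that a zero in the reduced region
has the same value of `q` as the given one. -/
theorem eisTwo_eq_zero_iff {N : ℕ} [NeZero N] (hN : N.Prime) (h4 : N ≤ 4) {τ₀ : ℍ}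
    (h₀ : (N : ℂ) * τ₀ ^ 2 - N * τ₀ + 1 = 0)
    (hred : ∀ τ : ℍ, 3 ≤ 4 * (N * τ.im) ^ 2 → eisTwo N τ = 0 → nome τ = nome τ₀) (τ : ℍ) :
    eisTwo N τ = 0 ↔ HStar.Equivalent (Gamma0 N) (.pt τ₀) (.pt τ) := by
  constructor
  · intro hτ
    obtain ⟨γ, hγ, τ', him, h⟩ := exists_reduced hN τ
    have hzero : eisTwo N τ' = 0 := by
      rcases h with rfl | rfl
      · exact (eisTwo_smul_eq_zero_iff hN.two_le h4 hγ _).mp hτ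
      · have := (eisTwo_smul_eq_zero_iff hN.two_le h4 hγ _).mp hτ
        rw [eisTwo_fricke] at this
        exact (mul_eq_zero.mp this).resolve_left (mul_ne_zero (neg_ne_zero.mpr (NeZero.ne _))
          (pow_ne_zero 2 τ'.ne_zero))
    obtain ⟨n, rfl⟩ := exists_vadd_of_nome_eq (hred τ' him hzero)
    have hT : ∀ m : ℤ, T ^ m ∈ Gamma0 N := fun m ↦ by
      rw [mem_Gamma0_iff_dvd]
      simp [coe_T_zpow]
    rcases h with rfl | rfl
    · exact ⟨γ * T ^ n, mul_mem hγ (hT n), by rw [HStar.act, mul_smul, modular_T_zpow_smul]⟩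
    · refine ⟨γ * (lowerTri (-(N * n)) * T ^ (-1 : ℤ)), mul_mem hγ (mul_mem ?_ (hT _)), ?_⟩
      · rw [mem_Gamma0_iff_dvd]
        exact ⟨-n, by simp [coe_lowerTri]⟩
      · -- The Fricke involution conjugates translations to lower triangular matrices.
        rw [HStar.act, mul_smul, mul_smul, modular_T_zpow_smul]
        congr 2
        have h1 : (N : ℂ) ≠ 0 := NeZero.ne _
        have h2 := τ₀.ne_zero
        have h3 : (n : ℂ) + τ₀ ≠ 0 := by
          have := ((n : ℝ) +ᵥ τ₀).ne_zero
          rwa [coe_vadd, ofReal_intCast] at this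
        have h5 : (τ₀ : ℂ) - 1 = -1 / (N * τ₀) := by
          field_simp
          linear_combination h₀
        refine UpperHalfPlane.ext ?_
        rw [coe_fricke_smul, UpperHalfPlane.coe_specialLinearGroup_apply]
        simp only [coe_lowerTri, coe_vadd, Matrix.of_apply, Matrix.cons_val', Matrix.cons_val_zero,
          Matrix.cons_val_one, Matrix.cons_val_fin_one, algebraMap_int_eq, eq_intCast]
        push_cast
        rw [show (-1 : ℂ) + τ₀ = -1 / (N * τ₀) by rw [← h5]; ring]
        have h6 : (-(N * n) : ℂ) * (-1 / (N * τ₀)) + 1 = (n + τ₀) / τ₀ := by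
          field_simp
        rw [h6]
        field_simp
        ring
  · rintro ⟨γ, hγ, h⟩
    rw [← HStar.pt.inj h, eisTwo_smul_eq_zero_iff hN.two_le h4 hγ]
    exact eisTwo_eq_zero_of_root h₀

/-- A point with `N Im τ ≥ √3 / 2` has `|q| < exp (-5.42 / N)`. The constants are `0.866 < √3 / 2` and
`5.42 < 2 * 3.14 * 0.866`. -/
lemma norm_nome_lt_of_le {τ : ℍ} {N : ℕ} {a : ℝ} (hN : 0 < N) (h : 3 ≤ 4 * (N * τ.im) ^ 2)
    (ha : a * N ≤ 5.42) : ‖nome τ‖ < Real.exp (-a) := by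
  rw [norm_nome]
  have hN' : (0 : ℝ) < N := by exact_mod_cast hN
  have h1 : 0.866 ≤ N * τ.im := by
    have := mul_pos hN' τ.im_pos
    nlinarith
  have hpi := Real.pi_gt_d2
  refine Real.exp_lt_exp.mpr (neg_lt_neg (lt_of_mul_lt_mul_right ?_ hN'.le))
  nlinarith [τ.im_pos]

/-- The estimate `exp (8 / 3) > 14`, from `e ^ 8 > 2.7 ^ 8 > 14 ^ 3`. -/
lemma norm_nome_lt_two {τ : ℍ} (h : 3 ≤ 4 * ((2 : ℕ) * τ.im) ^ 2) : ‖nome τ‖ < 1 / 14 := by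
  refine (norm_nome_lt_of_le (a := 8 / 3) two_pos h (by norm_num)).trans_le ?_
  rw [Real.exp_neg, inv_le_comm₀ (Real.exp_pos _) (by norm_num)]
  refine le_of_pow_le_pow_left₀ three_ne_zero (Real.exp_pos _).le ?_
  rw [← Real.exp_nat_mul, show ((3 : ℕ) : ℝ) * (8 / 3) = ((8 : ℕ) : ℝ) * 1 by norm_num,
    Real.exp_nat_mul]
  calc (1 / 14 : ℝ)⁻¹ ^ 3 ≤ 2.7 ^ 8 := by norm_num
    _ ≤ _ := by
      have := Real.exp_one_gt_d9
      gcongr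
      linarith

/-- The estimate `exp (9 / 5) > 6`, from `e ^ 9 > 2.71 ^ 9 > 6 ^ 5`. -/
lemma norm_nome_lt_three {τ : ℍ} (h : 3 ≤ 4 * ((3 : ℕ) * τ.im) ^ 2) : ‖nome τ‖ < 1 / 6 := by
  refine (norm_nome_lt_of_le (a := 9 / 5) three_pos h (by norm_num)).trans_le ?_
  rw [Real.exp_neg, inv_le_comm₀ (Real.exp_pos _) (by norm_num)]
  refine le_of_pow_le_pow_left₀ (n := 5) (by norm_num) (Real.exp_pos _).le ?_
  rw [← Real.exp_nat_mul, show ((5 : ℕ) : ℝ) * (9 / 5) = ((9 : ℕ) : ℝ) * 1 by norm_num,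
    Real.exp_nat_mul]
  calc (1 / 6 : ℝ)⁻¹ ^ 5 ≤ 2.71 ^ 9 := by norm_num
    _ ≤ _ := by
      have := Real.exp_one_gt_d9
      gcongr
      linarith

lemma hasDerivAt_nome (τ : ℍ) :
    HasDerivAt (nome ∘ ofComplex) (2 * Real.pi * I * nome τ) τ := by
  have h : HasDerivAt (fun z : ℂ ↦ exp (2 * Real.pi * I * z))
      (exp (2 * Real.pi * I * τ) * (2 * Real.pi * I * 1)) τ :=
    ((hasDerivAt_id (τ : ℂ)).const_mul _).cexp
  refine (h.congr_deriv (by rw [nome]; ring)).congr_of_eventuallyEq ?_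
  filter_upwards [isOpen_upperHalfPlaneSet.mem_nhds τ.im_pos] with z hz
  rw [Function.comp_apply, nome, ofComplex_apply_of_im_pos hz]

/-- A function that is bounded below by the distance in the local parameter `q` has at most simple
zeros. -/
lemma analyticOrderAt_eq_one_of_le {f : ℍ → ℂ} (hf : MDifferentiable 𝓘(ℂ) 𝓘(ℂ) f) {τ₀ : ℍ}
    (h0 : f τ₀ = 0)
    (h : ∀ᶠ z in 𝓝 (τ₀ : ℂ), ‖nome (ofComplex z) - nome τ₀‖ ≤ ‖f (ofComplex z)‖) :
    analyticOrderAt (f ∘ ofComplex) τ₀ = 1 := by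
  have han := analyticAt_comp_ofComplex hf τ₀.im_pos
  refine han.analyticOrderAt_eq_one_of_zero_deriv_ne_zero (by simpa using h0) fun hd ↦ ?_
  have h1 := han.differentiableAt.hasDerivAt
  rw [hd, hasDerivAt_iff_isLittleO] at h1
  simp only [Function.comp_apply, ofComplex_apply, h0, sub_zero, smul_zero] at h1
  have h2 : HasDerivAt (nome ∘ ofComplex) 0 τ₀ := by
    rw [hasDerivAt_iff_isLittleO]
    simp only [Function.comp_apply, ofComplex_apply, smul_zero, sub_zero]
    refine Asymptotics.IsBigO.trans_isLittleO (.of_bound 1 ?_) h1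
    simpa only [one_mul] using h
  exact mul_ne_zero Complex.two_pi_I_ne_zero (nome_ne_zero τ₀) ((hasDerivAt_nome τ₀).unique h2)

lemma eventually_norm_nome_lt {τ₀ : ℍ} {r : ℝ} (h : ‖nome τ₀‖ < r) :
    ∀ᶠ z in 𝓝 (τ₀ : ℂ), ‖nome (ofComplex z)‖ < r := by
  have h1 := (hasDerivAt_nome τ₀).continuousAt.norm
  exact h1.eventually_lt_const (by simpa using h)

/-! ### Level two -/

lemma le_im_ellipticTwo : 3 ≤ 4 * ((2 : ℕ) * ellipticTwo.im) ^ 2 := by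
  have : ellipticTwo.im = 1 / 2 := rfl
  rw [this]
  norm_num

/-- The injectivity of the Eisenstein series of level two in `q`, at its zero. -/
lemma norm_nome_sub_le_eisTwo_two {τ : ℍ} (h : ‖nome τ‖ < 1 / 14) :
    ‖nome τ - nome ellipticTwo‖ ≤ ‖eisTwo 2 τ‖ := by
  have h1 := norm_eisSeries_two_sub_le h.le (norm_nome_lt_two le_im_ellipticTwo).le
  rw [← eisTwo_eq, ← eisTwo_eq, eisTwo_eq_zero_of_root ellipticTwo_eq, sub_zero] at h1
  linarith [norm_nonneg (nome τ - nome ellipticTwo)]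

theorem eisTwo_two_eq_zero_iff (τ : ℍ) :
    eisTwo 2 τ = 0 ↔ HStar.Equivalent (Gamma0 2) (.pt ellipticTwo) (.pt τ) := by
  refine eisTwo_eq_zero_iff Nat.prime_two (by norm_num) ellipticTwo_eq (fun τ h hτ ↦ ?_) τ
  have := norm_nome_sub_le_eisTwo_two (norm_nome_lt_two h)
  rw [hτ, norm_zero] at this
  exact sub_eq_zero.mp (norm_le_zero_iff.mp this)

theorem analyticOrderAt_eisTwo_two : analyticOrderAt (eisTwo 2 ∘ ofComplex) ellipticTwo = 1 :=
  analyticOrderAt_eq_one_of_le (mdifferentiable_eisTwo 2) (eisTwo_eq_zero_of_root ellipticTwo_eq)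
    ((eventually_norm_nome_lt (norm_nome_lt_two le_im_ellipticTwo)).mono
      fun _ hz ↦ norm_nome_sub_le_eisTwo_two hz)

/-! ### Level three -/

lemma le_im_ellipticThree : 3 ≤ 4 * ((3 : ℕ) * ellipticThree.im) ^ 2 := by
  have : ellipticThree.im = √3 / 6 := rfl
  rw [this, mul_pow, div_pow, Real.sq_sqrt (by norm_num)]
  norm_num

lemma cubicA_ellipticThree : cubicA ellipticThree = 0 := by
  have := cubicA_sq ellipticThree
  rw [eisTwo_eq_zero_of_root ellipticThree_eq] at this
  exact pow_eq_zero_iff two_ne_zero |>.mp this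

/-- As the Eisenstein series of level three is a square, its linear term at its zero vanishes, and
the quadratic term gives a lower bound. -/
lemma norm_nome_sub_le_cubicA {τ : ℍ} (h : ‖nome τ‖ < 1 / 6) :
    ‖nome τ - nome ellipticThree‖ ≤ ‖cubicA τ‖ := by
  have hq₀ := norm_nome_lt_three le_im_ellipticThree
  set q₀ := nome ellipticThree with hq₀_def
  obtain ⟨D, hD⟩ := norm_eisSeries_three_sub_taylor_le hq₀.le
  have hE0 : eisSeries 3 q₀ = 0 := by
    rw [hq₀_def, ← eisTwo_eq]
    exact eisTwo_eq_zero_of_root ellipticThree_eq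
  rw [hE0] at hD
  have hderiv : HasDerivAt (eisSeries 3) D q₀ := by
    rw [hasDerivAt_iff_isLittleO]
    -- The bound is `36 + 100 / 3`.
    refine Asymptotics.IsBigO.trans_isLittleO (.of_bound (208 / 3) ?_)
      (Asymptotics.isLittleO_pow_sub_sub q₀ one_lt_two)
    filter_upwards [continuous_norm.continuousAt.eventually_lt_const hq₀] with q hq
    have h1 := hD q hq.le
    rw [hE0, smul_eq_mul, mul_comm _ D, norm_pow, norm_norm]
    have h2 := norm_le_norm_sub_add (eisSeries 3 q - 0 - D * (q - q₀)) (36 * (q - q₀) ^ 2)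
    rw [norm_mul, norm_pow, Complex.norm_ofNat] at h2
    linarith
  have hDzero : D = 0 := by
    have h1 := HasDerivAt.comp (h₂ := eisSeries 3) (h := nome ∘ ofComplex) (ellipticThree : ℂ)
      (by simpa using hderiv) (hasDerivAt_nome ellipticThree)
    have h2 := ((analyticAt_comp_ofComplex mdifferentiable_cubicA
      ellipticThree.im_pos).differentiableAt.hasDerivAt).pow 2
    have h3 : eisSeries 3 ∘ (nome ∘ ofComplex) = (cubicA ∘ ofComplex) ^ 2 := by
      ext z
      simp [cubicA_sq, eisTwo_eq]
    rw [h3] at h1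
    have h4 := h1.unique h2
    simp [cubicA_ellipticThree, nome_ne_zero] at h4
    exact h4
  have h1 := hD _ h.le
  rw [hDzero, ← eisTwo_eq, sub_zero, zero_mul, sub_zero, ← cubicA_sq] at h1
  have h2 := norm_le_norm_add_norm_sub (cubicA τ ^ 2) (36 * (nome τ - q₀) ^ 2)
  rw [norm_mul, norm_pow, norm_pow, Complex.norm_ofNat] at h2
  refine le_of_sq_le_sq ?_ (norm_nonneg _)
  linarith [sq_nonneg ‖nome τ - q₀‖]

theorem cubicA_eq_zero_iff (τ : ℍ) :
    cubicA τ = 0 ↔ HStar.Equivalent (Gamma0 3) (.pt ellipticThree) (.pt τ) := by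
  rw [← eisTwo_eq_zero_iff Nat.prime_three (by norm_num) ellipticThree_eq fun τ h hτ ↦ ?_,
    ← cubicA_sq, pow_eq_zero_iff two_ne_zero]
  have := norm_nome_sub_le_cubicA (norm_nome_lt_three h)
  rw [← cubicA_sq, pow_eq_zero_iff two_ne_zero] at hτ
  rw [hτ, norm_zero] at this
  exact sub_eq_zero.mp (norm_le_zero_iff.mp this)

theorem analyticOrderAt_cubicA : analyticOrderAt (cubicA ∘ ofComplex) ellipticThree = 1 :=
  analyticOrderAt_eq_one_of_le mdifferentiable_cubicA cubicA_ellipticThree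
    ((eventually_norm_nome_lt (norm_nome_lt_three le_im_ellipticThree)).mono
      fun _ hz ↦ norm_nome_sub_le_cubicA hz)

/-! ### The forms `𝒜` -/

/-- A root of a function tending to `1` at `i∞`, taken by the principal branch, is a given function
tending to `1`. -/
lemma cpow_inv_eventuallyEq {F a : ℍ → ℂ} {n : ℕ} (hn : n ≠ 0) (ha : Tendsto a atImInfty (𝓝 1))
    (h : ∀ τ, F τ = a τ ^ n) : (fun τ ↦ F τ ^ (1 / (n : ℂ))) =ᶠ[atImInfty] a := by
  have hlog : Tendsto (fun τ ↦ (n : ℝ) * (a τ).arg) atImInfty (𝓝 0) := by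
    have := ((Complex.continuousAt_arg Complex.one_mem_slitPlane).tendsto.comp ha).const_mul (n : ℝ)
    simpa [Function.comp_def] using this
  filter_upwards [hlog.eventually_lt_const Real.pi_pos,
    hlog.eventually_const_lt (neg_lt_zero.mpr Real.pi_pos)] with τ h1 h2
  have hn' : (0 : ℝ) < n := by exact_mod_cast Nat.pos_of_ne_zero hn
  rw [h, one_div, Complex.pow_cpow_nat_inv hn]
  · rw [neg_lt, lt_div_iff₀ hn']
    linarith
  · rw [le_div_iff₀ hn']
    linarith

lemma A2_eventuallyEq : A2 =ᶠ[atImInfty] etaQuot := by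
  have h1 : ∀ τ, (2 ^ 4 * etaMul 4 τ ^ 8 + etaMul 1 τ ^ 8) / (etaMul 2 τ ^ 2) ^ 2 =
      etaQuot τ ^ 2 := fun τ ↦ by
    have := etaMul_ne_zero two_ne_zero τ
    rw [etaQuot_sq, B2, C2]
    field_simp
    ring
  exact cpow_inv_eventuallyEq two_ne_zero tendsto_etaQuot h1

lemma A3_eventuallyEq : A3 =ᶠ[atImInfty] cubicA := by
  have h1 : ∀ τ, (3 ^ 3 * etaMul 3 τ ^ 12 + etaMul 1 τ ^ 12) / (etaMul 1 τ * etaMul 3 τ) ^ 3 =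
      cubicA τ ^ 3 := fun τ ↦ by
    have := etaMul_ne_zero one_ne_zero τ
    have := etaMul_ne_zero three_ne_zero τ
    rw [cubicA_cube, cubeSum, Pi.add_apply, Pi.pow_apply, Pi.pow_apply, B3, C3]
    field_simp
    ring
  exact cpow_inv_eventuallyEq three_ne_zero tendsto_cubicA h1

lemma A4_sq_eventuallyEq : A4 ^ 2 =ᶠ[atImInfty] eisTwo 2 := by
  have h1 : ∀ τ, (2 ^ 6 * etaMul 2 τ ^ 24 + etaMul 1 τ ^ 24) /
      (etaMul 1 τ ^ 2 * etaMul 2 τ ^ 2) ^ 4 = eisTwo 2 τ ^ 2 := fun τ ↦ by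
    have := etaMul_ne_zero one_ne_zero τ
    have := etaMul_ne_zero two_ne_zero τ
    have h8 : ((2 : ℂ) ^ (3 / 2 : ℂ)) ^ 4 = 64 := by
      rw [show 4 = 2 * 2 from rfl, pow_mul, two_cpow_three_halves_sq]
      norm_num
    rw [eisTwo_two_sq, B4, C4, div_pow (_ * _), mul_pow ((2 : ℂ) ^ (3 / 2 : ℂ)), h8]
    field_simp
    ring
  refine EventuallyEq.trans (.of_eq ?_)
    (cpow_inv_eventuallyEq two_ne_zero (tendsto_eisTwo le_rfl) h1)
  ext τ
  rw [Pi.pow_apply, A4, ← Complex.cpow_nat_mul]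
  norm_num

/-- A form of exponent zero at all cusps whose zeros on the upper half plane form one orbit of
simple zeros. -/
theorem hasOrd_of_simple_zero {N : ℕ} [NeZero N] (hN : N.Prime) {k : ℤ} {f : ℍ → ℂ} {τ₀ : ℍ}
    (hf : MDifferentiable 𝓘(ℂ) 𝓘(ℂ) f) (hinv : ∀ γ ∈ Gamma0 N, SemiInvariant k f γ)
    (hx : HasLeadingExponent f 0) (hy : HasLeadingExponent (f ∣[k] fricke N) 0)
    (hzero : ∀ τ, f τ = 0 ↔ HStar.Equivalent (Gamma0 N) (.pt τ₀) (.pt τ))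
    (hord : analyticOrderAt (f ∘ ofComplex) τ₀ = 1) {α : ℚ}
    (hα : 1 = ramification (Gamma0 N) τ₀ * α) (s : HStar) :
    (HStar.Equivalent (Gamma0 N) (.pt τ₀) s → HasOrd (Gamma0 N) k f s α) ∧
    (¬ HStar.Equivalent (Gamma0 N) (.pt τ₀) s → HasOrd (Gamma0 N) k f s 0) := by
  cases s with
  | pt τ =>
    refine ⟨fun h ↦ ⟨1, ?_, ?_⟩, fun h ↦ hasOrd_pt_zero hf fun h0 ↦ h ((hzero τ).mp h0)⟩
    · obtain ⟨γ, hγ, h⟩ := h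
      rw [← HStar.pt.inj h, analyticOrderAt_smul_of_semiInvariant hf (hinv γ hγ), hord,
        Nat.cast_one]
    · rw [ramification_eq_of_equivalent h, Nat.cast_one, hα]
  | cusp c =>
    refine ⟨fun h ↦ absurd h (not_equivalent_pt_cusp _ _), fun _ ↦ ?_⟩
    rcases cusp_cases_prime hN c with h | h
    · exact hasOrd_of_equivalent_infty hinv hx h
    · exact hasOrd_of_equivalent_zero hinv hy h

theorem hasOrd_eisTwo_two (s : HStar) :
    (HStar.Equivalent (Gamma0 2) (.pt ellipticTwo) s → HasOrd (Gamma0 2) 2 (eisTwo 2) s (1 / 2)) ∧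
    (¬ HStar.Equivalent (Gamma0 2) (.pt ellipticTwo) s → HasOrd (Gamma0 2) 2 (eisTwo 2) s 0) := by
  have hx : HasLeadingExponent (eisTwo 2) 0 := .of_tendsto one_ne_zero (tendsto_eisTwo le_rfl)
  refine hasOrd_of_simple_zero Nat.prime_two (mdifferentiable_eisTwo 2)
    (fun γ hγ ↦ ⟨1, one_ne_zero, by rw [eisTwo_slash_eq le_rfl (by norm_num) hγ, one_smul]⟩) hx ?_
    eisTwo_two_eq_zero_iff analyticOrderAt_eisTwo_two ?_ s
  · rw [eisTwo_slash_fricke, ← neg_one_smul ℂ]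
    exact hx.smul (neg_ne_zero.mpr one_ne_zero)
  · rw [ramification_ellipticTwo]
    norm_num

theorem hasOrd_cubicA (s : HStar) :
    (HStar.Equivalent (Gamma0 3) (.pt ellipticThree) s → HasOrd (Gamma0 3) 1 cubicA s (1 / 3)) ∧
    (¬ HStar.Equivalent (Gamma0 3) (.pt ellipticThree) s → HasOrd (Gamma0 3) 1 cubicA s 0) :=
  hasOrd_of_simple_zero Nat.prime_three mdifferentiable_cubicA semiInvariant_cubicA
    hasLeadingExponent_cubicA hasLeadingExponent_cubicA_slash_fricke cubicA_eq_zero_iff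
    analyticOrderAt_cubicA (by rw [ramification_ellipticThree]; norm_num) s

/-- Holomorphic functions that agree near `i∞` agree. -/
lemma eq_of_eventuallyEq {f g : ℍ → ℂ} (hf : MDifferentiable 𝓘(ℂ) 𝓘(ℂ) f)
    (hg : MDifferentiable 𝓘(ℂ) 𝓘(ℂ) g) (h : f =ᶠ[atImInfty] g) : f = g := by
  obtain ⟨A, hA⟩ := (atImInfty_mem _).mp h
  set B := max A 0 + 1
  have hB : A < B ∧ 0 < B := by
    have h1 := le_max_left A 0
    have h2 := le_max_right A 0
    exact ⟨by linarith, by linarith⟩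
  set τ₁ : ℍ := ⟨⟨0, B⟩, hB.2⟩
  refine sub_eq_zero.mp (UpperHalfPlane.eq_zero_of_frequently (τ := τ₁)
    (mdifferentiable_sub hf hg) ?_)
  have hev : ∀ᶠ τ in 𝓝 τ₁, (f - g) τ = 0 := by
    filter_upwards [UpperHalfPlane.continuous_im.continuousAt.eventually_const_lt
      (show A < τ₁.im from hB.1)] with τ hτ
    exact sub_eq_zero.mpr (hA τ hτ.le)
  exact (hev.filter_mono nhdsWithin_le_nhds).frequently

/-- A square root of the Eisenstein series of level two would have order `1 / 2` at its zero. -/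
theorem not_isSingleValued_A4 : ¬ IsSingleValued A4 := by
  rintro ⟨f, hf, hAf⟩
  have hsq : f ^ 2 = eisTwo 2 := eq_of_eventuallyEq (mdifferentiable_pow hf 2)
    (mdifferentiable_eisTwo 2) ((hAf.pow_const 2).symm.trans A4_sq_eventuallyEq)
  have h1 := analyticOrderAt_eisTwo_two
  have h2 : eisTwo 2 ∘ ofComplex = (f ∘ ofComplex) ^ 2 := by
    rw [← hsq]
    rfl
  rw [h2, analyticOrderAt_pow (analyticAt_comp_ofComplex hf ellipticTwo.im_pos)] at h1
  generalize analyticOrderAt (f ∘ ofComplex) ellipticTwo = n at h1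
  cases n with
  | top => simp at h1
  | coe n =>
    have h3 : 2 * n = 1 := by exact_mod_cast (nsmul_eq_mul 2 (n : ℕ∞)).symm.trans h1
    omega

lemma continues_A4_sq : Continues (A4 ^ 2) (eisTwo 2) :=
  ⟨mdifferentiable_eisTwo 2, A4_sq_eventuallyEq⟩

lemma continues_A3 : Continues A3 cubicA := ⟨mdifferentiable_cubicA, A3_eventuallyEq⟩

lemma continues_A2 : Continues A2 etaQuot := ⟨mdifferentiable_etaQuot, A2_eventuallyEq⟩

lemma Continues.pow {F f : ℍ → ℂ} (h : Continues F f) (n : ℕ) : Continues (F ^ n) (f ^ n) :=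
  ⟨mdifferentiable_pow h.1 n, h.2.pow_const n⟩

lemma Continues.isRootForm_one {F f : ℍ → ℂ} (h : Continues F f) {Γ : Subgroup SL(2, ℤ)}
    (hf : IsModularForm Γ 1 f) : IsRootForm Γ 1 1 F :=
  ⟨f, by rwa [pow_one], hf⟩

lemma Continues.hasRootOrd_one {F f : ℍ → ℂ} (h : Continues F f) {Γ : Subgroup SL(2, ℤ)}
    {s : HStar} {α : ℚ} (hf : HasOrd Γ 1 f s α) : HasRootOrd Γ 1 F s α :=
  ⟨1, one_pos, f, by rwa [pow_one], by rwa [Nat.cast_one, Nat.cast_one, one_mul, one_mul]⟩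

lemma hasRootOrd_A4 {s : HStar} {α : ℚ} (h : HasOrd (Gamma0 2) 2 (eisTwo 2) s (2 * α)) :
    HasRootOrd (Gamma0 2) 1 A4 s α :=
  ⟨2, two_pos, eisTwo 2, continues_A4_sq, h⟩

end EtaForms

end

open EtaForms CongruenceSubgroup in
theorem mainTheorem9 :
    -- Weight-1 forms; all are single-valued except `𝒜₄`, whose square is.
    (IsRootForm (Gamma0 2) 1 2 A4 ∧ ¬ IsSingleValued A4 ∧
      IsModularForm (Gamma0 2) 1 B4 ∧ IsModularForm (Gamma0 2) 1 C4) ∧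
    (IsRootForm (Gamma0 3) 1 1 A3 ∧
      IsModularForm (Gamma0 3) 1 B3 ∧ IsModularForm (Gamma0 3) 1 C3) ∧
    (IsRootForm (Gamma0 4) 1 1 A2 ∧
      IsModularForm (Gamma0 4) 1 B2 ∧ IsModularForm (Gamma0 4) 1 C2) ∧
    -- Zeros for `N = 2`.
    (∀ s : HStar,
      (HStar.Equivalent (Gamma0 2) (.pt ellipticTwo) s → HasRootOrd (Gamma0 2) 1 A4 s (1 / 4)) ∧
      (¬ HStar.Equivalent (Gamma0 2) (.pt ellipticTwo) s → HasRootOrd (Gamma0 2) 1 A4 s 0) ∧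
      (HStar.Equivalent (Gamma0 2) (.cusp (0 : ℚ)) s → HasOrd (Gamma0 2) 1 B4 s (1 / 4)) ∧
      (¬ HStar.Equivalent (Gamma0 2) (.cusp (0 : ℚ)) s → HasOrd (Gamma0 2) 1 B4 s 0) ∧
      (HStar.Equivalent (Gamma0 2) (.cusp OnePoint.infty) s → HasOrd (Gamma0 2) 1 C4 s (1 / 4)) ∧
      (¬ HStar.Equivalent (Gamma0 2) (.cusp OnePoint.infty) s → HasOrd (Gamma0 2) 1 C4 s 0)) ∧
    -- Zeros for `N = 3`.
    (∀ s : HStar,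
      (HStar.Equivalent (Gamma0 3) (.pt ellipticThree) s → HasRootOrd (Gamma0 3) 1 A3 s (1 / 3)) ∧
      (¬ HStar.Equivalent (Gamma0 3) (.pt ellipticThree) s → HasRootOrd (Gamma0 3) 1 A3 s 0) ∧
      (HStar.Equivalent (Gamma0 3) (.cusp (0 : ℚ)) s → HasOrd (Gamma0 3) 1 B3 s (1 / 3)) ∧
      (¬ HStar.Equivalent (Gamma0 3) (.cusp (0 : ℚ)) s → HasOrd (Gamma0 3) 1 B3 s 0) ∧
      (HStar.Equivalent (Gamma0 3) (.cusp OnePoint.infty) s → HasOrd (Gamma0 3) 1 C3 s (1 / 3)) ∧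
      (¬ HStar.Equivalent (Gamma0 3) (.cusp OnePoint.infty) s → HasOrd (Gamma0 3) 1 C3 s 0)) ∧
    -- Zeros for `N = 4`.
    (∀ s : HStar,
      (HStar.Equivalent (Gamma0 4) (.cusp (1 / 2 : ℚ)) s → HasRootOrd (Gamma0 4) 1 A2 s (1 / 2)) ∧
      (¬ HStar.Equivalent (Gamma0 4) (.cusp (1 / 2 : ℚ)) s → HasRootOrd (Gamma0 4) 1 A2 s 0) ∧
      (HStar.Equivalent (Gamma0 4) (.cusp (0 : ℚ)) s → HasOrd (Gamma0 4) 1 B2 s (1 / 2)) ∧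
      (¬ HStar.Equivalent (Gamma0 4) (.cusp (0 : ℚ)) s → HasOrd (Gamma0 4) 1 B2 s 0) ∧
      (HStar.Equivalent (Gamma0 4) (.cusp OnePoint.infty) s → HasOrd (Gamma0 4) 1 C2 s (1 / 2)) ∧
      (¬ HStar.Equivalent (Gamma0 4) (.cusp OnePoint.infty) s → HasOrd (Gamma0 4) 1 C2 s 0)) ∧
    -- The Fricke involutions, acting on the squares in weight 2.
    (((B4 ^ 2) ∣[(2 : ℤ)] fricke 2 = -C4 ^ 2 ∧ (C4 ^ 2) ∣[(2 : ℤ)] fricke 2 = -B4 ^ 2 ∧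
        ∃ f : ℍ → ℂ, Continues (A4 ^ 2) f ∧ f ∣[(2 : ℤ)] fricke 2 = -f) ∧
      ((B3 ^ 2) ∣[(2 : ℤ)] fricke 3 = -C3 ^ 2 ∧ (C3 ^ 2) ∣[(2 : ℤ)] fricke 3 = -B3 ^ 2 ∧
        ∃ f : ℍ → ℂ, Continues (A3 ^ 2) f ∧ f ∣[(2 : ℤ)] fricke 3 = -f) ∧
      ((B2 ^ 2) ∣[(2 : ℤ)] fricke 4 = -C2 ^ 2 ∧ (C2 ^ 2) ∣[(2 : ℤ)] fricke 4 = -B2 ^ 2 ∧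
        ∃ f : ℍ → ℂ, Continues (A2 ^ 2) f ∧ f ∣[(2 : ℤ)] fricke 4 = -f)) ∧
    -- The explicitly single-valued representation of `𝒜₂`.
    Continues A2 (fun τ => etaMul 2 τ ^ 10 / (etaMul 1 τ ^ 4 * etaMul 4 τ ^ 4)) := by
  have hB4 := frickePair_two
  have hB3 := frickePair_three
  have hB2 := frickePair_four
  refine ⟨⟨⟨eisTwo 2, continues_A4_sq, isModularForm_eisTwo Nat.prime_two (by norm_num)⟩,
      not_isSingleValued_A4, hB4.isModularForm_left Nat.prime_two (by norm_num) (by norm_num),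
      hB4.isModularForm_right Nat.prime_two (by norm_num) (by norm_num)⟩,
    ⟨continues_A3.isRootForm_one isModularForm_cubicA,
      hB3.isModularForm_left Nat.prime_three (by norm_num) (by norm_num),
      hB3.isModularForm_right Nat.prime_three (by norm_num) (by norm_num)⟩,
    ⟨continues_A2.isRootForm_one isModularForm_etaQuot, isModularForm_B2, isModularForm_C2⟩,
    fun s ↦ ?_, fun s ↦ ?_, fun s ↦ ?_,
    ⟨⟨sq_slash_fricke_of_apply hB4.left_fricke, sq_slash_fricke_of_apply hB4.right_fricke,
        eisTwo 2, continues_A4_sq, eisTwo_slash_fricke 2⟩,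
      ⟨sq_slash_fricke_of_apply hB3.left_fricke, sq_slash_fricke_of_apply hB3.right_fricke,
        cubicA ^ 2, continues_A3.pow 2, sq_slash_fricke_of_apply cubicA_fricke⟩,
      ⟨sq_slash_fricke_of_apply hB2.left_fricke, sq_slash_fricke_of_apply hB2.right_fricke,
        etaQuot ^ 2, continues_A2.pow 2, sq_slash_fricke_of_apply etaQuot_fricke⟩⟩,
    continues_A2⟩
  · obtain ⟨h1, h2⟩ := hasOrd_eisTwo_two s
    obtain ⟨h3, h4⟩ := hB4.hasOrd_left Nat.prime_two (by norm_num) s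
    obtain ⟨h5, h6⟩ := hB4.hasOrd_right Nat.prime_two (by norm_num) s
    refine ⟨fun h ↦ hasRootOrd_A4 ?_, fun h ↦ hasRootOrd_A4 ?_, h3, h4, h5, h6⟩
    · rw [show (2 : ℚ) * (1 / 4) = 1 / 2 by norm_num]
      exact h1 h
    · rw [mul_zero]
      exact h2 h
  · obtain ⟨h1, h2⟩ := hasOrd_cubicA s
    obtain ⟨h3, h4⟩ := hB3.hasOrd_left Nat.prime_three (by norm_num) s
    obtain ⟨h5, h6⟩ := hB3.hasOrd_right Nat.prime_three (by norm_num) s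
    exact ⟨fun h ↦ continues_A3.hasRootOrd_one (h1 h),
      fun h ↦ continues_A3.hasRootOrd_one (h2 h), h3, h4, h5, h6⟩
  · obtain ⟨h1, h2⟩ := hasOrd_etaQuot s
    obtain ⟨h3, h4⟩ := hasOrd_B2 s
    obtain ⟨h5, h6⟩ := hasOrd_C2 s
    exact ⟨fun h ↦ continues_A2.hasRootOrd_one (h1 h),
      fun h ↦ continues_A2.hasRootOrd_one (h2 h), h3, h4, h5, h6⟩
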